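/- Let $n\ge 1$, let $M\in\mathbb R^{n\times n}$ be symmetric positive semidefinite, $q\in\mathbb R^n$ and $0<u_i\le\infty$ for $i=1,\dots,n$. Consider the quadratic program $$\text{(QP)}\qquad \min_{0\le x\le u}\ \theta(x)=q^\top x+\tfrac12 x^\top Mx .$$ The comparison matrix $\overline A$ of a square matrix $A$ has entries $\overline A_{ii}=a_{ii}$ and $\overline A_{ij}=-|a_{ij}|$ for $i\ne j$. Suppose that every principal submatrix of $M$ of order $n-1$ has a positive semidefinite comparison matrix. The following algorithm ("Algorithm III") is applied to (QP). For $i=1,\dots,n$ in turn, with $M^{-i},q^{-i},u^{-i}$ obtained by removing the $i$-th row, column and component: 1. Apply PPPA (below) to the problem with data $(M^{-i},q^{-i},u^{-i})$. If it has no optimal solution, report that (QP) has none and terminate. Otherwise let $y$ be the solution computed; if $q_i+\sum_{j\ne i}m_{ij}y_j\ge 0$, return $x$ with $x_i=0$, $x^{-i}=y$ and terminate. 2. If $u_i<\infty$, apply PPPA to the problem with data $(M^{-i},(q_j+m_{ji}u_i)_{j\ne i},u^{-i})$. If it has no optimal solution, report that (QP) has none and terminate. Otherwise let $y$ be the solution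 computed; if $q_i+m_{ii}u_i+\sum_{j\ne i}m_{ij}y_j\le 0$, return $x$ with $x_i=u_i$, $x^{-i}=y$ and terminate. If none of these (at most $2n$) reduced problems has led to termination, solve the system $q+Mx=0$, $0\le x\le u$, one irreducible diagonal block of $M$ at a time: in a block choose an index set $\beta$ of two elements (one, if the block has order one) with complement $\alpha$ in the block, eliminate $x_\alpha=-M_{\alpha\alpha}^{-1}(q_\alpha+M_{\alpha\beta}x_\beta)$, and solve the remaining system of linear equations and inequalities in $x_\beta$ by Fourier–Motzkin elimination. If the system is infeasible, report that (QP) has no optimal solution; otherwise return the solution found. PPPA, for a problem with data $(M,q,u)$ and $\overline M$ positive semidefinite, is the parametric principal pivoting algorithm. By elimination it computes $d>0$ with $\overline Md\ge0$ and sets $p=\tfrac12(M+\overline M)d$; variables with $m_{ii}=0$ are separated (they occur only in $q_ix_i$). While there is an $i$ with $p_i=0$ and $q_i<0$, the problem is reduced: if $u_i=\infty$, $x_i$ is eliminated, which leaves the Schur complement of $m_{ii}$; if $u_i<\infty$, $x_i$ is replaced by $u_i-z_i$ and $z_i$ is only required to be nonnegative. Then the solution of $\min_{0\le x\le u}(q+\tau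 p)^\top x+\tfrac12x^\top Mx$ is traced for $\tau$ decreasing to $0$: starting from $\alpha=\gamma=\emptyset$, the indices are partitioned into sets $\alpha,\beta,\gamma$ of variables between their bounds, at their lower and at their upper bounds; put $(\bar q_\alpha,\bar p_\alpha)=M_{\alpha\alpha}^{-1}(q_\alpha+M_{\alpha\gamma}u_\gamma,\,p_\alpha)$ and $(\bar q_i,\bar p_i)=(q_i+M_{i\gamma}u_\gamma,\,p_i)-M_{i\alpha}(\bar q_\alpha,\bar p_\alpha)$ for $i\notin\alpha$. The next critical value $\tau$ is the largest of $0$, the $-\bar q_i/\bar p_i$ with $i\in\beta$, $\bar p_i>0$, and the $-(u_i+\bar q_i)/\bar p_i$ with $i\in\alpha$, $\bar p_i>0$, $u_i<\infty$. If it is $0$, then $(x_\alpha,x_\beta,x_\gamma)=(-\bar q_\alpha,0,u_\gamma)$ is the solution. Otherwise the first maximizing index $i$ moves from $\alpha$ to $\gamma$, or from $\beta$ to $\alpha$ provided that its entry $m_{ii}-M_{i\alpha}M_{\alpha\alpha}^{-1}M_{\alpha i}$ is positive. If that entry is zero, let $h=M_{\alpha\alpha}^{-1}M_{\alpha i}$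 and take the smallest of the ratios $(-\bar q_j-\tau\bar p_j)/h_j$ ($j\in\alpha$, $h_j>0$), $(u_j+\bar q_j+\tau\bar p_j)/(-h_j)$ ($j\in\alpha$, $h_j<0$, $u_j<\infty$), and $u_i$ (if finite): if there is no ratio, the problem has no optimal solution; if $u_i$ is the smallest, $i$ moves to $\gamma$; otherwise $i$ moves to $\alpha$ and the minimizing $j$ moves to $\beta$ (first kind of ratio) or to $\gamma$ (second kind). The inverse $M_{\alpha\alpha}^{-1}$ is updated at every pivot. Then there is an absolute constant $C$, independent of $n,M,q,u$, such that Algorithm III terminates after at most $Cn^4$ operations (arithmetic operations, comparisons, and passes through loops), and either returns an optimal solution of (QP), or reports that (QP) has no optimal solution, in which case indeed none exists. -/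

import Mathlib

namespace BoundedQP

/-! ## The quadratic program

Minimize `qᵀx + ½ xᵀMx` over `0 ≤ x ≤ u`; the value `⊤` of an upper bound means that the
variable has no upper bound. -/

/-- The comparison matrix: the diagonal is kept, every off-diagonal entry `m` becomes `-|m|`. -/
def comparisonMatrix {ι : Type*} [DecidableEq ι] (M : Matrix ι ι ℝ) : Matrix ι ι ℝ :=
  Matrix.of fun i j => if i = j then M i i else -|M i j|

/-- `M` is symmetric positive semidefinite, and each of its principal submatrices of order `n - k`
has a positive semidefinite comparison matrix. -/
def WeaklyQuasiDominant {n : ℕ} (k : ℕ) (M : Matrix (Fin n) (Fin n) ℝ) : Prop :=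
  M.PosSemidef ∧ ∀ κ : Finset (Fin n), κ.card + k = n →
    (comparisonMatrix (M.submatrix (fun i : κ => (i : Fin n)) (fun i : κ => (i : Fin n)))).PosSemidef

/-- The objective function `qᵀx + ½ xᵀMx`. -/
noncomputable def objective {n : ℕ} (M : Matrix (Fin n) (Fin n) ℝ) (q x : Fin n → ℝ) : ℝ :=
  q ⬝ᵥ x + (1 / 2) * (x ⬝ᵥ M.mulVec x)

/-- The constraints `0 ≤ x ≤ u`. -/
def Feasible {n : ℕ} (u : Fin n → WithTop ℝ) (x : Fin n → ℝ) : Prop :=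
  ∀ i, 0 ≤ x i ∧ (x i : WithTop ℝ) ≤ u i

/-- `x` is an optimal solution of the quadratic program. -/
def IsOptimal {n : ℕ} (M : Matrix (Fin n) (Fin n) ℝ) (q : Fin n → ℝ) (u : Fin n → WithTop ℝ)
    (x : Fin n → ℝ) : Prop :=
  Feasible u x ∧ ∀ y, Feasible u y → objective M q x ≤ objective M q y

/-! ## Programs with counted operations

A program over a type `K` of numbers can get at its numbers only through the constructors below;
all programs in this file are written for an arbitrary type `K` without any structure, so that
no arithmetic operation and no comparison escapes the count. -/

/-- The four arithmetic operations. -/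
inductive Arith
  | add
  | sub
  | mul
  | div

/-- Programs that compute with numbers in `K` and return an element of `α`. -/
inductive Prog (K α : Type) : Type
  /-- return a result -/
  | ret (a : α) : Prog K α
  /-- load a constant -/
  | const (m : ℕ) (k : K → Prog K α) : Prog K α
  /-- carry out an arithmetic operation -/
  | arith (o : Arith) (x y : K) (k : K → Prog K α) : Prog K α
  /-- test whether `x < y` -/
  | less (x y : K) (k : Bool → Prog K α) : Prog K α
  /-- one step of bookkeeping: every pass through the body of a loop is charged with it -/
  | tick (k : Prog K α) : Prog K α

namespace Prog

/-- Sequential composition. -/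
def bind {K α β : Type} : Prog K α → (α → Prog K β) → Prog K β
  | ret a, f => f a
  | const m k, f => const m fun z => (k z).bind f
  | arith o x y k, f => arith o x y fun z => (k z).bind f
  | less x y k, f => less x y fun b => (k b).bind f
  | tick k, f => tick (k.bind f)

instance {K : Type} : Monad (Prog K) where
  pure := ret
  bind := bind

/-- The value of an arithmetic operation. (`x / 0 = 0`, as always in Mathlib.) -/
def arithVal {K : Type} [Field K] : Arith → K → K → K
  | .add, x, y => x + y
  | .sub, x, y => x - y
  | .mul, x, y => x * y
  | .div, x, y => x / y

/-- The result of running a program. -/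
def eval {K α : Type} [Field K] [LinearOrder K] : Prog K α → α
  | ret a => a
  | const m k => (k (m : K)).eval
  | arith o x y k => (k (arithVal o x y)).eval
  | less x y k => (k (decide (x < y))).eval
  | tick k => k.eval

/-- The number of operations carried out when a program is run. -/
def cost {K α : Type} [Field K] [LinearOrder K] : Prog K α → ℕ
  | ret _ => 0
  | const m k => (k (m : K)).cost + 1
  | arith o x y k => (k (arithVal o x y)).cost + 1
  | less x y k => (k (decide (x < y))).cost + 1
  | tick k => k.cost + 1

end Prog

section Programs

variable {K α σ : Type} {n : ℕ}

/-! ### Elementary programs -/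

def lit (m : ℕ) : Prog K K := .const m .ret

def step : Prog K Unit := .tick (.ret ())

def add (x y : K) : Prog K K := .arith .add x y .ret

def sub (x y : K) : Prog K K := .arith .sub x y .ret

def mul (x y : K) : Prog K K := .arith .mul x y .ret

def div (x y : K) : Prog K K := .arith .div x y .ret

def lt (x y : K) : Prog K Bool := .less x y .ret

def neg (x : K) : Prog K K := do sub (← lit 0) x

def isPos (x : K) : Prog K Bool := do lt (← lit 0) x

def isNeg (x : K) : Prog K Bool := do lt x (← lit 0)

/-- Compute and store the entries of a vector. -/
def tab : {n : ℕ} → (Fin n → Prog K α) → Prog K (Fin n → α)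
  | 0, _ => pure Fin.elim0
  | _ + 1, f => do
    step
    let a ← f 0
    let v ← tab fun i => f i.succ
    pure (Fin.cons a v)

/-- Compute and store the entries of a square matrix. -/
def tab2 (f : Fin n → Fin n → Prog K α) : Prog K (Fin n → Fin n → α) := tab fun i => tab (f i)

/-- A loop over all indices in increasing order. -/
def loop : {n : ℕ} → σ → (σ → Fin n → Prog K σ) → Prog K σ
  | 0, s, _ => pure s
  | _ + 1, s, f => do
    step
    let s' ← f s 0
    loop s' fun t i => f t i.succ

/-- A loop over the entries of a list. -/
def loopList : List α → σ → (σ → α → Prog K σ) → Prog K σ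
  | [], s, _ => pure s
  | a :: l, s, f => do
    step
    let s' ← f s a
    loopList l s' f

/-- The sum of `f i` over the indices `i` that satisfy `c`. -/
def sumOn (c : Fin n → Bool) (f : Fin n → Prog K K) : Prog K K := do
  loop (← lit 0) fun s i => if c i then do add s (← f i) else pure s

/-- The first index with a given property. -/
def findFirst (f : Fin n → Prog K Bool) : Prog K (Option (Fin n)) :=
  loop none fun s i => match s with
    | some j => pure (some j)
    | none => do if ← f i then pure (some i) else pure none

/-! ### Parametric principal pivoting

The data of a problem of order `n` are `M : Fin n → Fin n → K`, `q : Fin n → K` and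
`u : Fin n → WithTop K`. -/

/-- What an algorithm reports: an optimal solution, that there is none, or nothing (the number of
iterations provided was exceeded). -/
inductive Outcome (K : Type) (n : ℕ)
  | optimal (x : Fin n → K)
  | noSolution
  | failed

/-- The position of a variable: between its bounds (`α`), at its lower bound (`β`) or at its upper
bound (`γ`). -/
inductive Status
  | between
  | lower
  | upper
  deriving DecidableEq

def isBetween (st : Fin n → Status) (i : Fin n) : Bool := decide (st i = .between)

/-- With `B` the inverse of `M_αα`, the vector `r̄` given by `r̄_α = M_αα⁻¹ r_α` and
`r̄_i = r_i - M_iα r̄_α` for `i ∉ α`. -/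
def transform (M : Fin n → Fin n → K) (inα : Fin n → Bool) (B : Fin n → Fin n → K)
    (r : Fin n → K) : Prog K (Fin n → K) := do
  let y ← tab fun i => sumOn inα fun j => mul (B i j) (r j)
  tab fun i => if inα i then pure (y i) else do
    sub (r i) (← sumOn inα fun j => mul (M i j) (y j))

/-- The vector `h = M_αα⁻¹ M_αi` and the Schur complement entry `m_ii - M_iα h`. -/
def schurEntry (M : Fin n → Fin n → K) (inα : Fin n → Bool) (B : Fin n → Fin n → K) (i : Fin n) :
    Prog K ((Fin n → K) × K) := do
  let h ← tab fun k => sumOn inα fun j => mul (B k j) (M j i)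
  let s ← sub (M i i) (← sumOn inα fun j => mul (M i j) (h j))
  pure (h, s)

/-- Update of the inverse when the index `i` joins `α` (bordering). -/
def addIndex (B : Fin n → Fin n → K) (i : Fin n) (h : Fin n → K) (s : K) :
    Prog K (Fin n → Fin n → K) :=
  tab2 fun k l =>
    if k = i then
      if l = i then do div (← lit 1) s else do neg (← div (h l) s)
    else
      if l = i then do neg (← div (h k) s) else do add (B k l) (← div (← mul (h k) (h l)) s)

/-- Update of the inverse when the index `j` leaves `α`. -/
def dropIndex (B : Fin n → Fin n → K) (j : Fin n) : Prog K (Fin n → Fin n → K) :=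
  tab2 fun k l => do sub (B k l) (← div (← mul (B k j) (B j l)) (B j j))

/-- `q + M_·γ u_γ`. -/
def shiftedLinearTerm (M : Fin n → Fin n → K) (q : Fin n → K) (u : Fin n → WithTop K)
    (st : Fin n → Status) : Prog K (Fin n → K) :=
  tab fun i => do
    add (q i) (← sumOn (fun k => decide (st k = .upper)) fun k => match u k with
      | ⊤ => lit 0
      | (c : K) => mul (M i k) c)

/-- Keep the larger of the best ratio so far and a new one; the earlier one wins a tie. -/
def keepMax {τ : Type} (best : Option (K × τ)) (r : K) (t : τ) : Prog K (Option (K × τ)) :=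
  match best with
  | none => pure (some (r, t))
  | some b => do if ← lt b.1 r then pure (some (r, t)) else pure (some b)

/-- Keep the smaller of the best ratio so far and a new one; the earlier one wins a tie. -/
def keepMin {τ : Type} (best : Option (K × τ)) (r : K) (t : τ) : Prog K (Option (K × τ)) :=
  match best with
  | none => pure (some (r, t))
  | some b => do if ← lt r b.1 then pure (some (r, t)) else pure (some b)

/-- The first ratio test: the largest of the ratios `-q̄_i / p̄_i` (`i ∈ β`, `p̄_i > 0`) and
`-(u_i + q̄_i) / p̄_i` (`i ∈ α`, `p̄_i > 0`, `u_i < ∞`), with a maximizing index. -/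
def criticalValue (u : Fin n → WithTop K) (st : Fin n → Status) (qb pb : Fin n → K) :
    Prog K (Option (K × Fin n)) :=
  loop none fun best i => do
    if ← isPos (pb i) then
      match st i, u i with
      | .lower, _ => do keepMax best (← neg (← div (qb i) (pb i))) i
      | .between, (c : K) => do keepMax best (← neg (← div (← add c (qb i)) (pb i))) i
      | .between, ⊤ => pure best
      | .upper, _ => pure best
    else pure best

/-- The second ratio test, at the value `τ` and for an index `i ∈ β` whose Schur complement entry
is zero: the smallest of `(-q̄_j - τ p̄_j) / h_j` (`j ∈ α`, `h_j > 0`),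
`(u_j + q̄_j + τ p̄_j) / (-h_j)` (`j ∈ α`, `h_j < 0`, `u_j < ∞`) and `u_i` (if finite). The index
that attains it is recorded together with the bound that it moves to. -/
def blockingValue (u : Fin n → WithTop K) (st : Fin n → Status) (qb pb h : Fin n → K) (τ : K)
    (i : Fin n) : Prog K (Option (K × Fin n × Status)) := do
  let best ← loop none fun best j =>
    if st j = .between then do
      let v ← add (qb j) (← mul τ (pb j))
      if ← isPos (h j) then keepMin best (← div (← neg v) (h j)) (j, Status.lower)
      else if ← isNeg (h j) then
        match u j with
        | ⊤ => pure best
        | (c : K) => do keepMin best (← div (← add c v) (← neg (h j))) (j, Status.upper)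
      else pure best
    else pure best
  match u i with
  | ⊤ => pure best
  | (c : K) => keepMin best c (i, Status.upper)

/-- The pivoting iterations. The state consists of the partition `(α, β, γ)` of the indices and of
the inverse `B` of `M_αα`; `p` is the parametric vector. The first argument bounds the number of
iterations. -/
def pivotLoop (M : Fin n → Fin n → K) (q : Fin n → K) (u : Fin n → WithTop K) (p : Fin n → K) :
    ℕ → (Fin n → Status) → (Fin n → Fin n → K) → Prog K (Outcome K n)
  | 0, _, _ => pure .failed
  | fuel + 1, st, B => do
    step
    let qb ← transform M (isBetween st) B (← shiftedLinearTerm M q u st)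
    let pb ← transform M (isBetween st) B p
    let crit ← do match ← criticalValue u st qb pb with
      | none => pure none
      | some c => do if ← isPos c.1 then pure (some c) else pure none
    match crit with
    | none => do
      -- the critical value is zero
      let x ← tab fun i => match st i, u i with
        | .between, _ => neg (qb i)
        | .lower, _ => lit 0
        | .upper, (c : K) => pure c
        | .upper, ⊤ => lit 0
      pure (.optimal x)
    | some (τ, i) =>
      if st i = .between then do
        -- a variable between its bounds reaches its upper bound
        pivotLoop M q u p fuel (Function.update st i .upper) (← dropIndex B i)
      else do
        let (h, s) ← schurEntry M (isBetween st) B i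
        if ← isPos s then
          -- a diagonal pivot
          pivotLoop M q u p fuel (Function.update st i .between) (← addIndex B i h s)
        else
          match ← blockingValue u st qb pb h τ i with
          | none => pure .noSolution
          | some (_, j, side) =>
            if j = i then pivotLoop M q u p fuel (Function.update st i .upper) B
            else do
              -- a two-by-two pivot: `j` leaves `α` and `i` enters it
              let st' := Function.update st j side
              let B' ← dropIndex B j
              let (h', s') ← schurEntry M (isBetween st') B' i
              pivotLoop M q u p fuel (Function.update st' i .between) (← addIndex B' i h' s')

/-- The comparison matrix, computed. -/
def comparison (M : Fin n → Fin n → K) : Prog K (Fin n → Fin n → K) :=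
  tab2 fun i j => if i = j then pure (M i i) else do
    if ← isPos (M i j) then neg (M i j) else pure (M i j)

/-- Gaussian elimination and back substitution for a vector `d > 0` with `A d ≥ 0`, where `A` is
symmetric positive semidefinite with nonpositive off-diagonal entries. -/
def dominanceVector : {n : ℕ} → (Fin n → Fin n → K) → Prog K (Fin n → K)
  | 0, _ => pure Fin.elim0
  | _ + 1, A => do
    if ← isPos (A 0 0) then
      let S ← tab2 fun j k => do
        sub (A j.succ k.succ) (← div (← mul (A j.succ 0) (A 0 k.succ)) (A 0 0))
      let d ← dominanceVector S
      let t ← sumOn (fun _ => true) fun k => mul (A 0 k.succ) (d k)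
      let d₀ ← do if ← isNeg t then neg (← div t (A 0 0)) else lit 1
      pure (Fin.cons d₀ d)
    else
      let d ← dominanceVector (← tab2 fun j k => pure (A j.succ k.succ))
      pure (Fin.cons (← lit 1) d)

/-- The parametric vector `p = ½ (M + M̄) d`, where `M̄` is the comparison matrix. -/
def parametricVector (M : Fin n → Fin n → K) (d : Fin n → K) : Prog K (Fin n → K) := do
  let C ← comparison M
  let two ← lit 2
  tab fun i => do
    div (← sumOn (fun _ => true) fun j => do mul (← add (M i j) (C i j)) (d j)) two

/-- Application of the pivoting method to a problem together with a vector `d > 0` such that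
`M̄ d ≥ 0`. A variable with a zero diagonal entry is separated. As long as there is an index `i`
with `p_i = 0` and `q_i < 0`, so that pivoting cannot start with `p`, the problem is reduced: if
`u_i = ∞`, then the variable `x_i` is eliminated, which leaves the Schur complement of `m_ii`; if
`u_i < ∞`, then `x_i` is replaced by `z_i = u_i - x_i` and the upper bound on `z_i` is dropped. The
first argument bounds the number of reductions. -/
def reduceAndPivot : ℕ → {n : ℕ} → (Fin n → Fin n → K) → (Fin n → K) → (Fin n → WithTop K) →
    (Fin n → K) → Prog K (Outcome K n)
  | 0, _, _, _, _, _ => pure .failed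
  | _ + 1, 0, _, _, _, _ => pure (.optimal Fin.elim0)
  | fuel + 1, n + 1, M, q, u, d => do
    step
    let p ← parametricVector M d
    let bad ← findFirst fun i => do
      if ← isPos (M i i) then
        if ← isPos (p i) then pure false else isNeg (q i)
      else pure true
    match bad with
    | none => do
      let zero ← tab2 fun _ _ => lit 0
      pivotLoop M q u p (2 * (n + 1) + 1) (fun _ => .lower) zero
    | some i =>
      if ← isPos (M i i) then
        match u i with
        | ⊤ => do
          let S ← tab2 fun j k => do
            sub (M (i.succAbove j) (i.succAbove k))
              (← div (← mul (M (i.succAbove j) i) (M i (i.succAbove k))) (M i i))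
          let r ← tab fun j => do
            sub (q (i.succAbove j)) (← mul (← div (M (i.succAbove j) i) (M i i)) (q i))
          match ← reduceAndPivot fuel S r (fun j => u (i.succAbove j))
              (fun j => d (i.succAbove j)) with
          | .optimal x => do
            let t ← add (q i) (← sumOn (fun _ => true) fun k => mul (M i (i.succAbove k)) (x k))
            pure (.optimal (i.insertNth (← neg (← div t (M i i))) x))
          | .noSolution => pure .noSolution
          | .failed => pure .failed
        | (c : K) => do
          let M' ← tab2 fun j k =>
            if (j = i ∧ k ≠ i) ∨ (j ≠ i ∧ k = i) then neg (M j k) else pure (M j k)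
          let q' ← tab fun j => do
            let t ← add (q j) (← mul (M j i) c)
            if j = i then neg t else pure t
          match ← reduceAndPivot fuel M' q' (Function.update u i ⊤) d with
          | .optimal z => do
            pure (.optimal (Function.update z i (← sub c (z i))))
          | .noSolution => pure .noSolution
          | .failed => pure .failed
      else do
        -- the `i`-th row and column are zero: the variable `x_i` occurs only in `q_i x_i`
        let fixed ← do
          if ← isNeg (q i) then
            match u i with
            | ⊤ => pure none
            | (c : K) => pure (some c)
          else do pure (some (← lit 0))
        match fixed with
        | none => pure .noSolution
        | some c =>
          match ← reduceAndPivot fuel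
              (fun j k => M (i.succAbove j) (i.succAbove k)) (fun j => q (i.succAbove j))
              (fun j => u (i.succAbove j)) (fun j => d (i.succAbove j)) with
          | .optimal x => pure (.optimal (i.insertNth c x))
          | .noSolution => pure .noSolution
          | .failed => pure .failed

/-- The parametric principal pivoting algorithm for a matrix with a positive semidefinite comparison
matrix. -/
def pppa (M : Fin n → Fin n → K) (q : Fin n → K) (u : Fin n → WithTop K) :
    Prog K (Outcome K n) := do
  let d ← dominanceVector (← comparison M)
  reduceAndPivot (2 * n + 1) M q u d

/-! ### Systems of linear inequalities in two variables -/

/-- A solution `t` of the inequalities `a t + c ≥ 0`, `(a, c)` in the list, if there is one. -/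
def solveOneVar (L : List (K × K)) : Prog K (Option K) := do
  let zero ← lit 0
  let bounds ← loopList L ((none, none) : Option (K × Unit) × Option (K × Unit)) fun b e => do
    if ← isPos e.1 then pure (← keepMax b.1 (← neg (← div e.2 e.1)) (), b.2)
    else if ← isNeg e.1 then pure (b.1, ← keepMin b.2 (← neg (← div e.2 e.1)) ())
    else pure b
  let t := match bounds with
    | (some lo, _) => lo.1
    | (none, some hi) => hi.1
    | (none, none) => zero
  let ok ← loopList L true fun ok e => do
    if ← isNeg (← add (← mul e.1 t) e.2) then pure false else pure ok
  pure (if ok then some t else none)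

/-- Fourier–Motzkin elimination: a solution `(y, z)` of the inequalities `a y + b z + c ≥ 0`,
`(a, b, c)` in the list, if there is one. -/
def solveTwoVar (L : List (K × K × K)) : Prog K (Option (K × K)) := do
  let parts ← loopList L (([], [], []) : List (K × K × K) × List (K × K × K) × List (K × K))
    fun s e => do
      if ← isPos e.2.1 then pure (e :: s.1, s.2.1, s.2.2)
      else if ← isNeg e.2.1 then pure (s.1, e :: s.2.1, s.2.2)
      else pure (s.1, s.2.1, (e.1, e.2.2) :: s.2.2)
  let elim ← loopList parts.1 parts.2.2 fun acc e => loopList parts.2.1 acc fun acc' f => do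
    let a ← sub (← mul e.2.1 f.1) (← mul f.2.1 e.1)
    let c ← sub (← mul e.2.1 f.2.2) (← mul f.2.1 e.2.2)
    pure ((a, c) :: acc')
  match ← solveOneVar elim with
  | none => pure none
  | some y => do
    let rest ← loopList L [] fun acc e => do
      pure ((e.2.1, ← add (← mul e.1 y) e.2.2) :: acc)
    match ← solveOneVar rest with
    | none => pure none
    | some z => pure (some (y, z))

/-! ### The final check -/

/-- Which indices are joined by a chain of nonzero entries of `M`, that is, lie in the same
irreducible diagonal block. -/
def sameBlock (M : Fin n → Fin n → K) : Prog K (Fin n → Fin n → Bool) := do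
  let R ← tab2 fun i j => if i = j then pure true else do
    if ← isPos (M i j) then pure true else isNeg (M i j)
  loop R fun R k => tab2 fun i j => pure (R i j || (R i k && R k j))

/-- Solution of `q + M x = 0`, `0 ≤ x ≤ u` for the variables of one irreducible diagonal block `C`
with first index `b₁`. With `β` the first two indices of the block (the only one if the block has
order one) and `α` the others, the variables `x_α = -M_αα⁻¹ (q_α + M_αβ x_β)` are eliminated and the
remaining system in `x_β` is passed to Fourier–Motzkin elimination. The entries of the result
outside the block are those of `x`. -/
def solveBlock (M : Fin n → Fin n → K) (q : Fin n → K) (u : Fin n → WithTop K)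
    (inC : Fin n → Bool) (b₁ : Fin n) (x : Fin n → K) : Prog K (Option (Fin n → K)) := do
  let zero ← lit 0
  let one ← lit 1
  let b₂ ← findFirst fun j => pure (inC j && decide (j ≠ b₁))
  let inα : Fin n → Bool := fun k => inC k && decide (k ≠ b₁) && decide (some k ≠ b₂)
  let zeroMatrix ← tab2 fun _ _ => pure zero
  let (_, B) ← loop ((fun _ => false, zeroMatrix) : (Fin n → Bool) × (Fin n → Fin n → K))
    fun s k => if inα k then do
        let (h, e) ← schurEntry M s.1 s.2 k
        pure (Function.update s.1 k true, ← addIndex s.2 k h e)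
      else pure s
  -- in the rows of `α` the vector `-(qb + g₁ y + g₂ z)` is `x_α`, in those of `β` it has to vanish
  let qb ← transform M inα B q
  let g₁ ← transform M inα B fun j => M j b₁
  let g₂ ← match b₂ with
    | none => tab fun _ => pure zero
    | some b => transform M inα B fun j => M j b
  let L ← loop ([] : List (K × K × K)) fun L k =>
    if inC k then do
      let a' ← neg (g₁ k)
      let b' ← neg (g₂ k)
      let c' ← neg (qb k)
      if inα k then
        match u k with
        | ⊤ => pure ((a', b', c') :: L)
        | (c : K) => do pure ((a', b', c') :: (g₁ k, g₂ k, ← add (qb k) c) :: L)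
      else do
        let L := (a', b', c') :: (g₁ k, g₂ k, qb k) :: L
        let m ← neg one
        if k = b₁ then
          match u k with
          | ⊤ => pure ((one, zero, zero) :: L)
          | (c : K) => pure ((one, zero, zero) :: (m, zero, c) :: L)
        else
          match u k with
          | ⊤ => pure ((zero, one, zero) :: L)
          | (c : K) => pure ((zero, one, zero) :: (zero, m, c) :: L)
    else pure L
  match ← solveTwoVar L with
  | none => pure none
  | some (y, z) => do
    let x' ← tab fun k =>
      if k = b₁ then pure y
      else if some k = b₂ then pure z
      else if inC k then do
        neg (← add (qb k) (← add (← mul (g₁ k) y) (← mul (g₂ k) z)))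
      else pure (x k)
    pure (some x')

/-- Solution of the system `q + M x = 0`, `0 ≤ x ≤ u`, one irreducible diagonal block at a time. -/
def finalCheck (M : Fin n → Fin n → K) (q : Fin n → K) (u : Fin n → WithTop K) :
    Prog K (Outcome K n) := do
  let R ← sameBlock M
  let x₀ ← tab fun _ => lit 0
  let res ← loop (some x₀) fun s i => match s with
    | none => pure none
    | some x => do
      match ← findFirst fun j => pure (R i j) with
      | some j => if j = i then solveBlock M q u (R i) i x else pure (some x)
      | none => pure (some x)
  match res with
  | some x => pure (.optimal x)
  | none => pure .noSolution

/-! ### The algorithm -/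

/-- The two reduced problems of order `n` for the index `i`: the variable `x_i` is fixed at its
lower bound and, if `u_i < ∞`, at its upper bound. The result is `none` if neither of them settles
the original problem. -/
def tryIndex (M : Fin (n + 1) → Fin (n + 1) → K) (q : Fin (n + 1) → K)
    (u : Fin (n + 1) → WithTop K) (i : Fin (n + 1)) : Prog K (Option (Outcome K (n + 1))) := do
  let M' ← tab2 fun j k => pure (M (i.succAbove j) (i.succAbove k))
  let u' ← tab fun j => pure (u (i.succAbove j))
  let qlb ← tab fun j => pure (q (i.succAbove j))
  match ← pppa M' qlb u' with
  | .failed => pure (some .failed)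
  | .noSolution => pure (some .noSolution)
  | .optimal x => do
    let g ← add (q i) (← sumOn (fun _ => true) fun j => mul (M i (i.succAbove j)) (x j))
    if ← isNeg g then
      match u i with
      | ⊤ => pure none
      | (c : K) => do
        let qub ← tab fun j => do
          add (q (i.succAbove j)) (← mul (M (i.succAbove j) i) c)
        match ← pppa M' qub u' with
        | .failed => pure (some .failed)
        | .noSolution => pure (some .noSolution)
        | .optimal x => do
          let t ← add (q i) (← mul (M i i) c)
          let g ← add t (← sumOn (fun _ => true) fun j => mul (M i (i.succAbove j)) (x j))
          if ← isPos g then pure none else pure (some (.optimal (i.insertNth c x)))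
    else pure (some (.optimal (i.insertNth (← lit 0) x)))

/-- The algorithm for the bounded quadratic program of order `n + 1`: solve the reduced problems of
all the indices by `pppa`, until one of them settles the original problem; if none does, check the
system `q + M x = 0`, `0 ≤ x ≤ u`. -/
def resolveQP (M : Fin (n + 1) → Fin (n + 1) → K) (q : Fin (n + 1) → K)
    (u : Fin (n + 1) → WithTop K) : Prog K (Outcome K (n + 1)) := do
  let res ← loop none fun s i => match s with
    | some o => pure (some o)
    | none => tryIndex M q u i
  match res with
  | some o => pure o
  | none => finalCheck M q u

end Programs

end BoundedQP

/-!
By convexity, the optimal solutions are the points that satisfy the Karush–Kuhn–Tucker conditions,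
and a feasible direction `v` with `M v = 0` and `qᵀ v < 0` shows that there are none.

Let `d > 0` and `M̄ d ≥ 0` for the comparison matrix `M̄`, and put `p = ½ (M + M̄) d`. If
`0 ≤ y ≤ d`, then `(M y)_i ≤ p_i` where `y_i = 0`, and `(M y)_i ≥ p_i` where `y_i = d_i`. Hence for
each index set `α` there is such a `y` with `y = 0` outside `α` and `(M y)_α = p_α`, and so the
transformed vector `p̄` is nonnegative. As the parameter decreases, a variable can therefore only
move from its lower bound to the interior and from there to its upper bound; moreover, the Schur
complement entry is positive whenever a variable enters `α`. So there are at most `2n` pivots, of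
`O(n²)` operations each. If `p_i = 0` and `q_i < 0`, then the off-diagonal entries of row `i` are
nonpositive, so that `x_i = 0` is impossible at a solution.

All solutions of a reduced problem give the same gradient component at the removed index. If its
sign excludes the bounds `0` and `u_i` for every `i`, an optimal solution satisfies `q + M x = 0`.
In an irreducible block, two variables suffice after elimination: if `xᵀ M x = 0` and `x` has two
zero entries there, then `|x|` lies in the kernel of `M̄`, by the hypothesis on the submatrices of
order `n - 1`, and the zeros of `|x|` spread along the nonzero entries of `M` through the whole
block.
-/

namespace BoundedQP

open Finset Matrix

/-! ## Evaluation and cost of the elementary programs -/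

section Calculus

variable {K α β σ : Type} [Field K] [LinearOrder K] {n : ℕ}

@[simp] theorem eval_bind (p : Prog K α) (f : α → Prog K β) :
    (p >>= f).eval = (f p.eval).eval := by
  change (p.bind f).eval = _
  induction p with
  | ret => rfl
  | const _ _ ih => exact ih _
  | arith _ _ _ _ ih => exact ih _
  | less _ _ _ ih => exact ih _
  | tick _ ih => exact ih

@[simp] theorem cost_bind (p : Prog K α) (f : α → Prog K β) :
    (p >>= f).cost = p.cost + (f p.eval).cost := by
  change (p.bind f).cost = _
  induction p with
  | ret => simp [Prog.bind, Prog.cost, Prog.eval]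
  | const _ _ ih => simp only [Prog.bind, Prog.cost, Prog.eval, ih]; omega
  | arith _ _ _ _ ih => simp only [Prog.bind, Prog.cost, Prog.eval, ih]; omega
  | less _ _ _ ih => simp only [Prog.bind, Prog.cost, Prog.eval, ih]; omega
  | tick _ ih => simp only [Prog.bind, Prog.cost, Prog.eval, ih]; omega

@[simp] theorem eval_pure (a : α) : (pure a : Prog K α).eval = a := rfl

@[simp] theorem cost_pure (a : α) : (pure a : Prog K α).cost = 0 := rfl

@[simp] theorem eval_ite (c : Prop) [Decidable c] (p r : Prog K α) :
    (if c then p else r).eval = if c then p.eval else r.eval := apply_ite _ _ _ _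

@[simp] theorem cost_ite (c : Prop) [Decidable c] (p r : Prog K α) :
    (if c then p else r).cost = if c then p.cost else r.cost := apply_ite _ _ _ _

@[simp] theorem eval_lit (m : ℕ) : (lit m : Prog K K).eval = m := rfl
@[simp] theorem cost_lit (m : ℕ) : (lit m : Prog K K).cost = 1 := rfl
@[simp] theorem cost_step : (step : Prog K Unit).cost = 1 := rfl
@[simp] theorem eval_add (x y : K) : (add x y).eval = x + y := rfl
@[simp] theorem cost_add (x y : K) : (add x y).cost = 1 := rfl
@[simp] theorem eval_sub (x y : K) : (sub x y).eval = x - y := rfl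
@[simp] theorem cost_sub (x y : K) : (sub x y).cost = 1 := rfl
@[simp] theorem eval_mul (x y : K) : (mul x y).eval = x * y := rfl
@[simp] theorem cost_mul (x y : K) : (mul x y).cost = 1 := rfl
@[simp] theorem eval_div (x y : K) : (div x y).eval = x / y := rfl
@[simp] theorem cost_div (x y : K) : (div x y).cost = 1 := rfl
@[simp] theorem eval_lt (x y : K) : (lt x y).eval = decide (x < y) := rfl
@[simp] theorem cost_lt (x y : K) : (lt x y).cost = 1 := rfl
@[simp] theorem eval_neg (x : K) : (neg x).eval = -x := by simp [neg]
@[simp] theorem cost_neg (x : K) : (neg x).cost = 2 := by simp [neg]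
@[simp] theorem eval_isPos (x : K) : (isPos x).eval = decide (0 < x) := by simp [isPos]
@[simp] theorem cost_isPos (x : K) : (isPos x).cost = 2 := by simp [isPos]
@[simp] theorem eval_isNeg (x : K) : (isNeg x).eval = decide (x < 0) := by simp [isNeg]
@[simp] theorem cost_isNeg (x : K) : (isNeg x).cost = 2 := by simp [isNeg]

@[simp] theorem eval_tab : ∀ {n : ℕ} (f : Fin n → Prog K α), (tab f).eval = fun i => (f i).eval
  | 0, _ => by funext i; exact i.elim0
  | n + 1, f => by
    funext i
    simp only [tab, eval_bind, eval_pure, eval_tab]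
    refine Fin.cases ?_ (fun j => ?_) i <;> simp

theorem cost_tab_le {c : ℕ} : ∀ {n : ℕ} {f : Fin n → Prog K α}, (∀ i, (f i).cost ≤ c) →
    (tab f).cost ≤ n * (c + 1)
  | 0, _, _ => by simp [tab]
  | n + 1, f, h => by
    have h₀ := h 0
    have h₁ := cost_tab_le (f := fun i : Fin n => f i.succ) fun i => h i.succ
    simp only [tab, cost_bind, cost_step, cost_pure, Nat.succ_mul]
    omega

@[simp] theorem eval_tab2 (f : Fin n → Fin n → Prog K α) :
    (tab2 f).eval = fun i j => (f i j).eval := by simp [tab2]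

theorem cost_tab2_le {c : ℕ} {f : Fin n → Fin n → Prog K α} (h : ∀ i j, (f i j).cost ≤ c) :
    (tab2 f).cost ≤ n * (n * (c + 1) + 1) :=
  cost_tab_le fun i => cost_tab_le (h i)

theorem loop_induction : ∀ {n : ℕ} {s : σ} {f : σ → Fin n → Prog K σ} (P : ℕ → σ → Prop),
    P 0 s → (∀ (i : Fin n) t, P i t → P (i + 1) (f t i).eval) → P n (loop s f).eval
  | 0, _, _, _, h₀, _ => h₀
  | n + 1, s, f, P, h₀, h => by
    simp only [loop, eval_bind]
    refine loop_induction (fun m => P (m + 1)) ?_ fun i t ht => ?_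
    · simpa using h 0 s (by simpa using h₀)
    · simpa using h i.succ t (by simpa using ht)

theorem cost_loop_le {c : ℕ} : ∀ {n : ℕ} {s : σ} {f : σ → Fin n → Prog K σ},
    (∀ t i, (f t i).cost ≤ c) → (loop s f).cost ≤ n * (c + 1)
  | 0, _, _, _ => by simp [loop]
  | n + 1, s, f, h => by
    have h₀ := h s 0
    have h₁ := cost_loop_le (s := (f s 0).eval) (f := fun t (i : Fin n) => f t i.succ)
      fun t i => h t i.succ
    simp only [loop, cost_bind, cost_step, Nat.succ_mul]
    omega

theorem cost_loopList_le {c : ℕ} {f : σ → α → Prog K σ} (h : ∀ t a, (f t a).cost ≤ c) :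
    ∀ (l : List α) (s : σ), (loopList l s f).cost ≤ l.length * (c + 1)
  | [], _ => by simp [loopList]
  | a :: l, s => by
    have h₀ := h s a
    have h₁ := cost_loopList_le h l (f s a).eval
    simp only [loopList, cost_bind, cost_step, List.length_cons, Nat.succ_mul]
    omega

@[simp] theorem eval_sumOn (c : Fin n → Bool) (f : Fin n → Prog K K) :
    (sumOn c f).eval = ∑ i with c i, (f i).eval := by
  have key : ∀ {m : ℕ} (c : Fin m → Bool) (f : Fin m → Prog K K) (s : K),
      (loop s fun s i => if c i then do add s (← f i) else pure s).eval =
        s + ∑ i with c i, (f i).eval := by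
    intro m
    induction m with
    | zero => intro c f s; simp [loop]
    | succ m ih =>
      intro c f s
      simp only [loop, eval_bind, ih, Finset.sum_filter, Fin.sum_univ_succ]
      by_cases h : c 0 <;> simp [h, add_assoc]
  simp [sumOn, key]

theorem cost_sumOn_le {b : ℕ} {c : Fin n → Bool} {f : Fin n → Prog K K}
    (h : ∀ i, (f i).cost ≤ b) : (sumOn c f).cost ≤ n * (b + 2) + 1 := by
  have := cost_loop_le (n := n) (s := (0 : K)) (c := b + 1)
    (f := fun s i => if c i then do add s (← f i) else pure s) fun t i => by
      have := h i
      simp only [cost_ite, cost_bind, cost_add, cost_pure]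
      split_ifs <;> omega
  simp only [sumOn, cost_bind, cost_lit, eval_lit, Nat.cast_zero]
  exact (add_comm _ _).trans_le (Nat.add_le_add_right this 1)

@[simp] theorem eval_findFirst (f : Fin n → Prog K Bool) :
    (findFirst f).eval = Fin.find? fun i => (f i).eval := by
  have loop_eq : ∀ {m : ℕ} (f : Fin m → Prog K Bool) (s : Option (Fin n)) (e : Fin m → Fin n),
      (loop s fun s i => match s with
        | some j => pure (some j)
        | none => do if ← f i then pure (some (e i)) else pure none).eval =
      s.or ((Fin.find? fun i => (f i).eval).map e) := by
    intro m
    induction m with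
    | zero => intro f s e; simp [loop]
    | succ m ih =>
      intro f s e
      simp only [loop, eval_bind]
      rw [ih (fun i => f i.succ) _ fun i => e i.succ, Fin.find?_succ]
      rcases s with _ | j
      · by_cases h : (f 0).eval = true <;> simp [h, Function.comp_def]
      · simp
  exact (loop_eq f none id).trans (by simp)

theorem cost_findFirst_le {c : ℕ} {f : Fin n → Prog K Bool} (h : ∀ i, (f i).cost ≤ c) :
    (findFirst f).cost ≤ n * (c + 1) := by
  refine cost_loop_le fun t i => ?_
  have := h i
  rcases t with _ | _
  · simp only [cost_bind, cost_ite, cost_pure]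
    split_ifs <;> omega
  · simp

theorem exists_eval_keepMax {τ : Type} (best : Option (K × τ)) (r : K) (t : τ) :
    ∃ b, (keepMax best r t).eval = some b ∧ r ≤ b.1 ∧ (∀ b' ∈ best, b'.1 ≤ b.1) ∧
      (b = (r, t) ∨ b ∈ best) := by
  rcases best with _ | b
  · exact ⟨(r, t), by simp [keepMax]⟩
  · by_cases h : b.1 < r
    · exact ⟨(r, t), by simp [keepMax, h, h.le]⟩
    · exact ⟨b, by simp [keepMax, h, not_lt.1 h]⟩

theorem loop_keepMax_spec {ratio : Fin n → Option K}
    {f : Option (K × Fin n) → Fin n → Prog K (Option (K × Fin n))}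
    (hf : ∀ best i, (f best i).eval = (ratio i).elim best fun r => (keepMax best r i).eval) :
    (∀ i, ∀ r ∈ ratio i, ∃ b ∈ (loop none f).eval, r ≤ b.1) ∧
      ∀ b ∈ (loop none f).eval, b.1 ∈ ratio b.2 := by
  let Inv (m : ℕ) (best : Option (K × Fin n)) : Prop :=
    (∀ i : Fin n, i < m → ∀ r ∈ ratio i, ∃ b ∈ best, r ≤ b.1) ∧ ∀ b ∈ best, b.1 ∈ ratio b.2
  suffices h : Inv n (loop none f).eval from ⟨fun i => h.1 i i.2, h.2⟩
  refine loop_induction Inv ⟨fun i hi => absurd hi (Nat.not_lt_zero _), by simp⟩ ?_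
  rintro i best ⟨hmax, hmem⟩
  rw [hf]
  rcases hr : ratio i with _ | r
  · refine ⟨fun j hj r hjr => ?_, hmem⟩
    rcases Nat.lt_succ_iff_lt_or_eq.1 hj with hj | hj
    · exact hmax j hj r hjr
    · simp [Fin.ext hj, hr] at hjr
  · obtain ⟨b, hb, hrb, hle, hor⟩ := exists_eval_keepMax best r i
    rw [Option.elim_some, hb]
    refine ⟨fun j hj r' hjr => ⟨b, rfl, ?_⟩, ?_⟩
    · rcases Nat.lt_succ_iff_lt_or_eq.1 hj with hj | hj
      · obtain ⟨b', hb', hr'⟩ := hmax j hj r' hjr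
        exact hr'.trans (hle b' hb')
      · rw [Fin.ext hj, hr, Option.mem_some_iff] at hjr
        exact hjr ▸ hrb
    · rintro _ ⟨⟩
      rcases hor with rfl | hor
      · exact hr
      · exact hmem b hor

end Calculus

/-! ## Convex quadratic programs -/

section Quadratic

variable {ι : Type*} {M : Matrix ι ι ℝ}

theorem posSemidef_isSymm (hM : M.PosSemidef) : M.IsSymm :=
  (conjTranspose_eq_transpose_of_trivial M).symm.trans hM.isHermitian.eq

variable [Fintype ι]

theorem dotProduct_mulVec_comm (hM : M.IsSymm) (x y : ι → ℝ) : x ⬝ᵥ M *ᵥ y = y ⬝ᵥ M *ᵥ x := by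
  rw [dotProduct_mulVec, ← mulVec_transpose, hM.eq, dotProduct_comm]

theorem posSemidef_dotProduct_mulVec_nonneg (hM : M.PosSemidef) (x : ι → ℝ) : 0 ≤ x ⬝ᵥ M *ᵥ x := by
  simpa using hM.dotProduct_mulVec_nonneg x

theorem posSemidef_mulVec_eq_zero (hM : M.PosSemidef) {x : ι → ℝ} (hx : x ⬝ᵥ M *ᵥ x ≤ 0) :
    M *ᵥ x = 0 :=
  (hM.dotProduct_mulVec_zero_iff x).1 (by
    simpa using le_antisymm hx (posSemidef_dotProduct_mulVec_nonneg hM x))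

theorem posSemidef_row_eq_zero {κ : Type*} [Finite κ] {M : Matrix κ κ ℝ} (hM : M.PosSemidef) {i : κ}
    (hi : M i i = 0) (j : κ) : M i j = 0 := by
  classical
  have := Fintype.ofFinite κ
  have hcol : M *ᵥ Pi.single i 1 = 0 := posSemidef_mulVec_eq_zero hM (by simp [hi])
  rw [(posSemidef_isSymm hM).apply]
  simpa using congrFun hcol j

/-- The gradient `q + M x` of the objective function. -/
def gradient (M : Matrix ι ι ℝ) (q x : ι → ℝ) : ι → ℝ := q + M *ᵥ x

theorem gradient_apply (M : Matrix ι ι ℝ) (q x : ι → ℝ) (i : ι) :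
    gradient M q x i = q i + ∑ j, M i j * x j := rfl

end Quadratic

section Elimination

variable {n : ℕ} {M : Matrix (Fin (n + 1)) (Fin (n + 1)) ℝ} {i : Fin (n + 1)}

/-- The Schur complement of the diagonal entry `M i i`. -/
noncomputable def schurComplement (M : Matrix (Fin (n + 1)) (Fin (n + 1)) ℝ) (i : Fin (n + 1)) :
    Matrix (Fin n) (Fin n) ℝ :=
  of fun j k => M (i.succAbove j) (i.succAbove k) -
    M (i.succAbove j) i * M i (i.succAbove k) / M i i

/-- The linear term that is left when the variable `x i` is eliminated through the equation
`q i + (M x) i = 0`. -/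
noncomputable def schurLinearTerm (M : Matrix (Fin (n + 1)) (Fin (n + 1)) ℝ)
    (q : Fin (n + 1) → ℝ) (i : Fin (n + 1)) (j : Fin n) : ℝ :=
  q (i.succAbove j) - M (i.succAbove j) i / M i i * q i

/-- The extension of a vector by the entry at `i` that solves the equation `q i + (M x) i = 0`. -/
noncomputable def extendByRow (M : Matrix (Fin (n + 1)) (Fin (n + 1)) ℝ) (q : Fin (n + 1) → ℝ)
    (i : Fin (n + 1)) (x : Fin n → ℝ) : Fin (n + 1) → ℝ :=
  i.insertNth (-((q i + ∑ k, M i (i.succAbove k) * x k) / M i i)) x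

theorem gradient_insertNth_self (M : Matrix (Fin (n + 1)) (Fin (n + 1)) ℝ) (q : Fin (n + 1) → ℝ)
    (c : ℝ) (x : Fin n → ℝ) :
    gradient M q (i.insertNth c x) i =
      q i + M i i * c + ∑ k, M i (i.succAbove k) * x k := by
  simp [gradient_apply, Fin.sum_univ_succAbove _ i, add_assoc]

theorem gradient_insertNth_succAbove (M : Matrix (Fin (n + 1)) (Fin (n + 1)) ℝ)
    (q : Fin (n + 1) → ℝ) (c : ℝ) (x : Fin n → ℝ) (j : Fin n) :
    gradient M q (i.insertNth c x) (i.succAbove j) =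
      gradient (M.submatrix i.succAbove i.succAbove)
        (fun j => q (i.succAbove j) + M (i.succAbove j) i * c) x j := by
  simp [gradient_apply, Fin.sum_univ_succAbove _ i, add_assoc]

theorem gradient_extendByRow_self (hi : M i i ≠ 0) (q : Fin (n + 1) → ℝ) (x : Fin n → ℝ) :
    gradient M q (extendByRow M q i x) i = 0 := by
  rw [extendByRow, gradient_insertNth_self]
  field_simp
  ring

theorem gradient_extendByRow_succAbove (q : Fin (n + 1) → ℝ) (x : Fin n → ℝ) (j : Fin n) :
    gradient M q (extendByRow M q i x) (i.succAbove j) =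
      gradient (schurComplement M i) (schurLinearTerm M q i) x j := by
  rw [extendByRow, gradient_insertNth_succAbove]
  simp only [gradient_apply, schurComplement, schurLinearTerm, of_apply, submatrix_apply, sub_mul,
    sum_sub_distrib, div_eq_mul_inv, mul_right_comm _ _ (M i i)⁻¹,
    mul_assoc _ (M i (i.succAbove _)), ← mul_sum]
  ring

theorem mulVec_extendByRow_zero (hi : M i i ≠ 0) (x : Fin n → ℝ) :
    M *ᵥ extendByRow M 0 i x = i.insertNth 0 (schurComplement M i *ᵥ x) := by
  have hgrad : M *ᵥ extendByRow M 0 i x = gradient M 0 (extendByRow M 0 i x) := by simp [gradient]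
  rw [hgrad]
  refine Fin.eq_insertNth_iff.2 ⟨gradient_extendByRow_self hi 0 x, funext fun j => ?_⟩
  rw [Fin.removeNth_apply, gradient_extendByRow_succAbove]
  simp [gradient, schurLinearTerm]

theorem posSemidef_schurComplement (hM : M.PosSemidef) (hi : M i i ≠ 0) :
    (schurComplement M i).PosSemidef := by
  refine .of_dotProduct_mulVec_nonneg (IsHermitian.ext fun j k => ?_) fun x => ?_
  · have hsymm := (posSemidef_isSymm hM).apply
    simp only [schurComplement, of_apply, star_trivial, hsymm (i.succAbove j) (i.succAbove k),
      hsymm i (i.succAbove j), hsymm (i.succAbove k) i]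
    ring
  · have hnonneg := posSemidef_dotProduct_mulVec_nonneg hM (extendByRow M 0 i x)
    rw [mulVec_extendByRow_zero hi] at hnonneg
    simpa [dotProduct, Fin.sum_univ_succAbove _ i, extendByRow] using hnonneg

end Elimination

section Optimality

variable {n : ℕ} {M : Matrix (Fin n) (Fin n) ℝ} {q x : Fin n → ℝ} {u : Fin n → WithTop ℝ}

theorem objective_add_smul (hM : M.IsSymm) (q x v : Fin n → ℝ) (t : ℝ) :
    objective M q (x + t • v) =
      objective M q x + t * (gradient M q x ⬝ᵥ v) + t ^ 2 / 2 * (v ⬝ᵥ M *ᵥ v) := by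
  simp only [objective, gradient, mulVec_add, mulVec_smul, dotProduct_add, add_dotProduct,
    smul_dotProduct, dotProduct_smul, smul_eq_mul, dotProduct_mulVec_comm hM x v,
    dotProduct_comm (M *ᵥ x) v]
  ring

/-- The Karush–Kuhn–Tucker conditions for the variable `x i`. -/
structure KKTAt (M : Matrix (Fin n) (Fin n) ℝ) (q : Fin n → ℝ) (u : Fin n → WithTop ℝ)
    (x : Fin n → ℝ) (i : Fin n) : Prop where
  nonneg : 0 ≤ x i
  le : (x i : WithTop ℝ) ≤ u i
  grad_nonpos : 0 < x i → gradient M q x i ≤ 0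
  grad_nonneg : (x i : WithTop ℝ) < u i → 0 ≤ gradient M q x i

/-- The Karush–Kuhn–Tucker conditions, which characterize the optimal solutions. -/
def KKT (M : Matrix (Fin n) (Fin n) ℝ) (q : Fin n → ℝ) (u : Fin n → WithTop ℝ)
    (x : Fin n → ℝ) : Prop := ∀ i, KKTAt M q u x i

theorem KKTAt.congr {m : ℕ} {N : Matrix (Fin m) (Fin m) ℝ} {r y : Fin m → ℝ}
    {w : Fin m → WithTop ℝ} {i : Fin n} {j : Fin m} (h : KKTAt M q u x i) (hy : y j = x i)
    (hw : w j = u i) (hgrad : gradient N r y j = gradient M q x i) : KKTAt N r w y j := by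
  constructor
  · exact hy ▸ h.nonneg
  · exact hy ▸ hw ▸ h.le
  · exact hy ▸ hgrad ▸ h.grad_nonpos
  · exact hy ▸ hw ▸ hgrad ▸ h.grad_nonneg

theorem KKTAt.gradient_mul_sub_nonneg {i : Fin n} (h : KKTAt M q u x i) {t : ℝ} (ht : 0 ≤ t)
    (htu : (t : WithTop ℝ) ≤ u i) : 0 ≤ gradient M q x i * (t - x i) := by
  rcases lt_trichotomy t (x i) with hlt | heq | hlt
  · exact mul_nonneg_of_nonpos_of_nonpos (h.grad_nonpos (ht.trans_lt hlt)) (by linarith)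
  · simp [heq]
  · exact mul_nonneg (h.grad_nonneg ((WithTop.coe_lt_coe.2 hlt).trans_le htu)) (by linarith)

theorem KKT.isOptimal (hM : M.PosSemidef) (h : KKT M q u x) : IsOptimal M q u x := by
  refine ⟨fun i => ⟨(h i).nonneg, (h i).le⟩, fun y hy => ?_⟩
  have hexpand := objective_add_smul (posSemidef_isSymm hM) q x (y - x) 1
  rw [one_smul, add_sub_cancel] at hexpand
  have hfirst : 0 ≤ gradient M q x ⬝ᵥ (y - x) :=
    sum_nonneg fun i _ => (h i).gradient_mul_sub_nonneg (hy i).1 (hy i).2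
  have hsecond := posSemidef_dotProduct_mulVec_nonneg hM (y - x)
  linarith

theorem exists_linear_add_sq_neg {a c : ℝ} (ha : a < 0) (hc : 0 < c) (b : ℝ) :
    ∃ t, 0 < t ∧ t ≤ c ∧ t * a + t ^ 2 / 2 * b < 0 := by
  have hb : 0 < |b| + 1 := by positivity
  have hquot : 0 < -a / (|b| + 1) := div_pos (neg_pos.2 ha) hb
  obtain ⟨t, ht, htc, hta⟩ : ∃ t, 0 < t ∧ t ≤ c ∧ t * (|b| + 1) ≤ -a :=
    ⟨min c (-a / (|b| + 1)), lt_min hc hquot, min_le_left _ _,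
      (le_div_iff₀ hb).1 (min_le_right _ _)⟩
  have htb : t * b ≤ t * |b| := mul_le_mul_of_nonneg_left (le_abs_self b) ht.le
  exact ⟨t, ht, htc, by nlinarith⟩

theorem IsOptimal.le_single_step (hM : M.IsSymm) (h : IsOptimal M q u x) {i : Fin n} {t : ℝ}
    (ht : 0 ≤ x i + t) (htu : ((x i + t : ℝ) : WithTop ℝ) ≤ u i) :
    0 ≤ t * gradient M q x i + t ^ 2 / 2 * M i i := by
  have hle := h.2 (x + t • Pi.single i 1) fun k => by
    by_cases hk : k = i
    · subst hk; simpa using ⟨ht, htu⟩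
    · simpa [hk] using h.1 k
  rw [objective_add_smul hM] at hle
  simpa [add_assoc] using hle

theorem IsOptimal.kkt (hM : M.IsSymm) (h : IsOptimal M q u x) : KKT M q u x := by
  intro i
  refine ⟨(h.1 i).1, (h.1 i).2, fun hx => ?_, fun hx => ?_⟩
  · by_contra! hg
    obtain ⟨t, ht, htx, hneg⟩ := exists_linear_add_sq_neg (neg_neg_of_pos hg) hx (M i i)
    have hstep := h.le_single_step hM (t := -t) (by linarith)
      ((WithTop.coe_le_coe.2 (by linarith)).trans (h.1 i).2)
    nlinarith
  · by_contra! hg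
    obtain ⟨c, hc, hcu⟩ : ∃ c : ℝ, 0 < c ∧ ((x i + c : ℝ) : WithTop ℝ) ≤ u i := by
      rcases hu : u i with _ | b
      · exact ⟨1, one_pos, le_top⟩
      · have hxb : x i < b := WithTop.coe_lt_coe.1 (hx.trans_eq hu)
        exact ⟨b - x i, by linarith, WithTop.coe_le_coe.2 (by linarith)⟩
    obtain ⟨t, ht, htc, hneg⟩ := exists_linear_add_sq_neg hg hc (M i i)
    have hx₀ := (h.1 i).1
    have hstep := h.le_single_step hM (t := t) (by linarith)
      ((WithTop.coe_le_coe.2 (by linarith)).trans hcu)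
    linarith

/-- A direction in which every feasible point can be moved indefinitely, and along which the
objective function decreases at a constant rate. -/
structure IsRay (M : Matrix (Fin n) (Fin n) ℝ) (q : Fin n → ℝ) (u : Fin n → WithTop ℝ)
    (v : Fin n → ℝ) : Prop where
  nonneg : ∀ i, 0 ≤ v i
  eq_zero : ∀ i, u i ≠ ⊤ → v i = 0
  mulVec_eq_zero : M *ᵥ v = 0
  dotProduct_neg : q ⬝ᵥ v < 0

theorem IsRay.not_exists_isOptimal (hM : M.IsSymm) {v : Fin n → ℝ} (h : IsRay M q u v) :
    ¬ ∃ x, IsOptimal M q u x := by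
  rintro ⟨x, hx⟩
  have hle := hx.2 (x + (1 : ℝ) • v) fun i => by
    have hv := h.nonneg i
    refine ⟨by simpa using add_nonneg (hx.1 i).1 hv, ?_⟩
    by_cases hu : u i = ⊤
    · simp [hu]
    · simpa [h.eq_zero i hu] using (hx.1 i).2
  rw [objective_add_smul hM, gradient, add_dotProduct, dotProduct_comm (M *ᵥ x),
    dotProduct_mulVec_comm hM v x, h.mulVec_eq_zero] at hle
  simp only [dotProduct_zero] at hle
  linarith [h.dotProduct_neg]

/-- The gradient is monotone, and the optimality conditions at `x` and at `y` bound
`(x - y)ᵀ M (x - y)` from above by zero. -/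
theorem mulVec_eq_of_kktAt (hM : M.PosSemidef) {y : Fin n → ℝ}
    (h : ∀ j, x j = y j ∨ KKTAt M q u x j ∧ KKTAt M q u y j) : M *ᵥ x = M *ᵥ y := by
  have hsub : M *ᵥ (x - y) = gradient M q x - gradient M q y := by
    simp [gradient, mulVec_sub]
  have hzero := posSemidef_mulVec_eq_zero hM (x := x - y) <| by
    rw [hsub]
    refine sum_nonpos fun j _ => ?_
    rcases h j with h | ⟨hx, hy⟩
    · simp [h]
    · have hxy := hx.gradient_mul_sub_nonneg hy.nonneg hy.le
      have hyx := hy.gradient_mul_sub_nonneg hx.nonneg hx.le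
      simp only [Pi.sub_apply]
      linarith
  rw [mulVec_sub] at hzero
  exact sub_eq_zero.1 hzero

theorem exists_kkt_of_box (hM : M.IsSymm) (q : Fin n → ℝ) {b : Fin n → ℝ} (hb : 0 ≤ b) :
    ∃ x, KKT M q (fun i => (b i : WithTop ℝ)) x := by
  have hcont : Continuous (objective M q) := by
    unfold objective dotProduct mulVec dotProduct
    fun_prop
  obtain ⟨x, hx, hmin⟩ := isCompact_Icc.exists_isMinOn ⟨0, le_rfl, hb⟩ hcont.continuousOn
  exact ⟨x, IsOptimal.kkt hM ⟨fun i => ⟨hx.1 i, WithTop.coe_le_coe.2 (hx.2 i)⟩, fun y hy =>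
    hmin ⟨fun i => (hy i).1, fun i => WithTop.coe_le_coe.1 (hy i).2⟩⟩⟩

end Optimality

/-! ## Dominance and the parametric vector -/

section Dominance

variable {n : ℕ} {M : Matrix (Fin n) (Fin n) ℝ} {d y : Fin n → ℝ} {i j : Fin n}

theorem comparisonMatrix_self (M : Matrix (Fin n) (Fin n) ℝ) (i : Fin n) :
    comparisonMatrix M i i = M i i := by simp [comparisonMatrix]

theorem comparisonMatrix_of_ne (M : Matrix (Fin n) (Fin n) ℝ) (h : i ≠ j) :
    comparisonMatrix M i j = -|M i j| := by simp [comparisonMatrix, h]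

theorem comparisonMatrix_submatrix {ι κ : Type*} [DecidableEq ι] [DecidableEq κ]
    (M : Matrix ι ι ℝ) {f : κ → ι} (hf : f.Injective) :
    comparisonMatrix (M.submatrix f f) = (comparisonMatrix M).submatrix f f := by
  funext i j
  simp [comparisonMatrix, hf.eq_iff]

/-- A vector `d > 0` with `M̄ d ≥ 0` for the comparison matrix `M̄` of `M`; such a vector witnesses
that `M̄` is positive semidefinite. -/
structure Dominates (M : Matrix (Fin n) (Fin n) ℝ) (d : Fin n → ℝ) : Prop where
  pos : ∀ i, 0 < d i
  nonneg : ∀ i, 0 ≤ ∑ j, comparisonMatrix M i j * d j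

/-- The parametric vector `½ (M + M̄) d`, in the direction of which the linear term is moved. -/
noncomputable def paramVector (M : Matrix (Fin n) (Fin n) ℝ) (d : Fin n → ℝ) (i : Fin n) : ℝ :=
  (∑ j, (M i j + comparisonMatrix M i j) * d j) / 2

theorem Dominates.mulVec_le_paramVector (h : Dominates M d) (hy : ∀ j, 0 ≤ y j ∧ y j ≤ d j)
    (hi : y i = 0) : (M *ᵥ y) i ≤ paramVector M d i := by
  have hterm : ∀ j, 2 * (M i j * y j) ≤ (M i j - comparisonMatrix M i j) * d j := fun j => by
    obtain ⟨hy₀, hyd⟩ := hy j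
    rcases eq_or_ne i j with rfl | hij
    · simp [comparisonMatrix_self, hi]
    · rw [comparisonMatrix_of_ne M hij]
      rcases abs_cases (M i j) with ⟨e, hs⟩ | ⟨e, hs⟩ <;> rw [e] <;> nlinarith
  have hsum := sum_le_sum fun j (_ : j ∈ univ) => hterm j
  have hdom := h.nonneg i
  simp only [← mul_sum, sub_mul, sum_sub_distrib] at hsum
  simp only [paramVector, add_mul, sum_add_distrib, mulVec, dotProduct]
  linarith

theorem paramVector_le_mulVec (hy : ∀ j, 0 ≤ y j ∧ y j ≤ d j) (hi : y i = d i) :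
    paramVector M d i ≤ (M *ᵥ y) i := by
  rw [paramVector, div_le_iff₀ two_pos, mulVec, dotProduct, sum_mul]
  refine sum_le_sum fun j _ => ?_
  obtain ⟨hy₀, hyd⟩ := hy j
  rcases eq_or_ne i j with rfl | hij
  · rw [comparisonMatrix_self, hi]; linarith
  · rw [comparisonMatrix_of_ne M hij]
    rcases abs_cases (M i j) with ⟨e, hs⟩ | ⟨e, hs⟩ <;> rw [e] <;> nlinarith

theorem Dominates.paramVector_nonneg (h : Dominates M d) (i : Fin n) : 0 ≤ paramVector M d i := by
  simpa using h.mulVec_le_paramVector (y := 0) (i := i) (fun j => ⟨le_rfl, (h.pos j).le⟩) rfl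

theorem Dominates.nonpos_of_paramVector_eq_zero (h : Dominates M d) (hi : paramVector M d i = 0)
    (hij : i ≠ j) : M i j ≤ 0 := by
  have hcol := h.mulVec_le_paramVector (y := Pi.single j (d j)) (i := i)
    (fun k => by
      rcases eq_or_ne k j with rfl | hk
      · simp [(h.pos k).le]
      · simp [hk, (h.pos k).le])
    (by simp [hij])
  rw [hi] at hcol
  simp only [mulVec_single, Pi.smul_apply, col_apply, MulOpposite.smul_eq_mul_unop,
    MulOpposite.unop_op] at hcol
  exact nonpos_of_mul_nonpos_left hcol (h.pos j)

/-- A solution of the quadratic program with linear term `-p` over the box `0 ≤ y ≤ d` that is cut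
down to the index set `s` has the property: the two bounds above show that its gradient vanishes
where a bound is active. -/
theorem Dominates.exists_mulVec_eq (hM : M.IsSymm) (h : Dominates M d) (s : Finset (Fin n)) :
    ∃ y : Fin n → ℝ, (∀ j, 0 ≤ y j ∧ y j ≤ d j) ∧ (∀ j ∉ s, y j = 0) ∧
      ∀ i ∈ s, (M *ᵥ y) i = paramVector M d i := by
  obtain ⟨y, hy⟩ := exists_kkt_of_box hM (-paramVector M d) (b := fun i => if i ∈ s then d i else 0)
    fun i => by have := (h.pos i).le; simp only [Pi.zero_apply]; split_ifs <;> order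
  have hle : ∀ j, y j ≤ if j ∈ s then d j else 0 := fun j => WithTop.coe_le_coe.1 (hy j).le
  have hbox : ∀ j, 0 ≤ y j ∧ y j ≤ d j := fun j =>
    ⟨(hy j).nonneg, (hle j).trans (by have := h.pos j; split_ifs <;> order)⟩
  refine ⟨y, hbox, fun j hj => ?_, fun i hi => ?_⟩
  · exact le_antisymm ((hle j).trans_eq (if_neg hj)) (hy j).nonneg
  · have hgrad : gradient M (-paramVector M d) y i = (M *ᵥ y) i - paramVector M d i :=
      neg_add_eq_sub _ _
    have hge : y i < d i → 0 ≤ (M *ᵥ y) i - paramVector M d i := fun hyd =>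
      hgrad ▸ (hy i).grad_nonneg (WithTop.coe_lt_coe.2 (by simpa [hi] using hyd))
    have hle : 0 < y i → (M *ᵥ y) i - paramVector M d i ≤ 0 := fun hy₀ =>
      hgrad ▸ (hy i).grad_nonpos hy₀
    refine le_antisymm ?_ ?_
    · rcases (hbox i).1.eq_or_lt with hy₀ | hy₀
      · exact h.mulVec_le_paramVector hbox hy₀.symm
      · exact sub_nonpos.1 (hle hy₀)
    · rcases (hbox i).2.eq_or_lt with hyd | hyd
      · exact paramVector_le_mulVec hbox hyd
      · exact sub_nonneg.1 (hge hyd)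

end Dominance

/-! ## The inverse of a principal submatrix -/

section Inverse

variable {n : ℕ} {M B : Matrix (Fin n) (Fin n) ℝ} {s : Finset (Fin n)} {d r r' y : Fin n → ℝ}
  {i j : Fin n}

/-- The rows and columns of `B` in `s` form the inverse of the principal submatrix of the symmetric
matrix `M` with rows and columns in `s`. The other entries of `B` are arbitrary. -/
structure InverseOn (M : Matrix (Fin n) (Fin n) ℝ) (s : Finset (Fin n))
    (B : Matrix (Fin n) (Fin n) ℝ) : Prop where
  symm : ∀ i ∈ s, ∀ j ∈ s, B i j = B j i
  mul : ∀ i ∈ s, ∀ j ∈ s, ∑ k ∈ s, M i k * B k j = if i = j then 1 else 0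

/-- The vector `r̄` given by `r̄_s = M_ss⁻¹ r_s` and `r̄_i = r_i - M_is r̄_s` for `i ∉ s`, where `B`
is the inverse of `M_ss`. -/
def pivotTransform (M : Matrix (Fin n) (Fin n) ℝ) (s : Finset (Fin n))
    (B : Matrix (Fin n) (Fin n) ℝ) (r : Fin n → ℝ) (i : Fin n) : ℝ :=
  if i ∈ s then ∑ j ∈ s, B i j * r j else r i - ∑ j ∈ s, M i j * ∑ k ∈ s, B j k * r k

/-- The vector `M_ss⁻¹ M_si`, where `B` is the inverse of `M_ss`. -/
def schurColumn (M : Matrix (Fin n) (Fin n) ℝ) (s : Finset (Fin n))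
    (B : Matrix (Fin n) (Fin n) ℝ) (i k : Fin n) : ℝ :=
  ∑ j ∈ s, B k j * M j i

/-- The Schur complement entry `m_ii - M_is M_ss⁻¹ M_si`, where `B` is the inverse of `M_ss`. -/
def schurPivot (M : Matrix (Fin n) (Fin n) ℝ) (s : Finset (Fin n))
    (B : Matrix (Fin n) (Fin n) ℝ) (i : Fin n) : ℝ :=
  M i i - ∑ j ∈ s, M i j * schurColumn M s B i j

theorem eval_transform (M : Matrix (Fin n) (Fin n) ℝ) (a : Fin n → Bool)
    (B : Matrix (Fin n) (Fin n) ℝ) (r : Fin n → ℝ) :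
    (transform M a B r).eval = pivotTransform M {i | a i} B r := by
  funext i
  simp [transform, pivotTransform]

theorem eval_schurEntry (M : Matrix (Fin n) (Fin n) ℝ) (a : Fin n → Bool)
    (B : Matrix (Fin n) (Fin n) ℝ) (i : Fin n) :
    (schurEntry M a B i).eval = (schurColumn M {i | a i} B i, schurPivot M {i | a i} B i) := by
  simp [schurEntry, schurPivot, schurColumn, funext_iff]

theorem eval_addIndex (B : Matrix (Fin n) (Fin n) ℝ) (i : Fin n) (h : Fin n → ℝ) (e : ℝ)
    (k l : Fin n) : (addIndex B i h e).eval k l = (if k = i ∨ l = i then 0 else B k l) +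
      Function.update h i (-1) k * Function.update h i (-1) l / e := by
  by_cases hk : k = i <;> by_cases hl : l = i <;> simp [addIndex, hk, hl, neg_div]

theorem eval_dropIndex (B : Matrix (Fin n) (Fin n) ℝ) (j k l : Fin n) :
    (dropIndex B j).eval k l = B k l - B k j * B j l / B j j := by
  simp [dropIndex]

theorem mulVec_eq_sum_of_support (hy : ∀ j ∉ s, y j = 0) (i : Fin n) :
    (M *ᵥ y) i = ∑ j ∈ s, M i j * y j :=
  (sum_subset (subset_univ s) fun j _ hj => by rw [hy j hj, mul_zero]).symm

theorem pivotTransform_of_mem (hi : i ∈ s) : pivotTransform M s B r i = ∑ j ∈ s, B i j * r j :=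
  if_pos hi

theorem pivotTransform_of_notMem (hi : i ∉ s) :
    pivotTransform M s B r i = r i - ∑ j ∈ s, M i j * pivotTransform M s B r j := by
  rw [pivotTransform, if_neg hi]
  congr 1
  exact sum_congr rfl fun j hj => by rw [pivotTransform_of_mem hj]

theorem schurPivot_eq_pivotTransform (hi : i ∉ s) :
    schurPivot M s B i = pivotTransform M s B (fun j => M j i) i :=
  (if_neg hi).symm

theorem pivotTransform_congr (hr : ∀ j ∈ s, r j = r' j) (hi : r i = r' i) :
    pivotTransform M s B r i = pivotTransform M s B r' i := by
  have hB : ∀ k, ∑ j ∈ s, B k j * r j = ∑ j ∈ s, B k j * r' j := fun k =>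
    sum_congr rfl fun j hj => by rw [hr j hj]
  simp only [pivotTransform, hB, hi]

theorem pivotTransform_add_smul (r r' : Fin n → ℝ) (t : ℝ) :
    pivotTransform M s B (r + t • r') = pivotTransform M s B r + t • pivotTransform M s B r' := by
  funext i
  have hB : ∀ k, ∑ j ∈ s, B k j * (r + t • r') j =
      ∑ j ∈ s, B k j * r j + t * ∑ j ∈ s, B k j * r' j := fun k => by
    simp only [Pi.add_apply, Pi.smul_apply, smul_eq_mul, mul_add, sum_add_distrib, mul_sum,
      mul_left_comm]
  simp only [Pi.add_apply (pivotTransform M s B r), Pi.smul_apply, pivotTransform, hB]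
  split_ifs
  · rfl
  · simp only [mul_add, sum_add_distrib, mul_left_comm (M _ _) t, ← mul_sum, Pi.add_apply,
      Pi.smul_apply, smul_eq_mul]
    ring

theorem inverseOn_empty : InverseOn M ∅ B := ⟨by simp, by simp⟩

theorem InverseOn.sum_mul_sum (h : InverseOn M s B) (r : Fin n → ℝ) (hi : i ∈ s) :
    ∑ k ∈ s, M i k * ∑ j ∈ s, B k j * r j = r i := by
  simp only [mul_sum, ← mul_assoc]
  rw [sum_comm]
  simp only [← sum_mul]
  rw [sum_congr rfl fun j hj => by rw [h.mul i hi j hj]]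
  simp [hi]

theorem InverseOn.sum_mul_pivotTransform (h : InverseOn M s B) (r : Fin n → ℝ) (hi : i ∈ s) :
    ∑ j ∈ s, M i j * pivotTransform M s B r j = r i := by
  rw [← h.sum_mul_sum r hi]
  exact sum_congr rfl fun j hj => by rw [pivotTransform_of_mem hj]

theorem InverseOn.sum_inverse_mul (hM : M.IsSymm) (h : InverseOn M s B) (hi : i ∈ s) (hj : j ∈ s) :
    ∑ k ∈ s, B i k * M k j = if i = j then 1 else 0 := by
  simp only [eq_comm (a := i), ← h.mul j hj i hi]
  exact sum_congr rfl fun k hk => by rw [h.symm i hi k hk, hM.apply, mul_comm]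

theorem InverseOn.pivotTransform_mulVec (hM : M.IsSymm) (h : InverseOn M s B)
    (hy : ∀ j ∉ s, y j = 0) : pivotTransform M s B (M *ᵥ y) = y := by
  have hB : ∀ i ∈ s, ∑ j ∈ s, B i j * (M *ᵥ y) j = y i := fun i hi => by
    simp only [mulVec_eq_sum_of_support hy, mul_sum, ← mul_assoc]
    rw [sum_comm]
    simp only [← sum_mul]
    rw [sum_congr rfl fun k hk => by rw [h.sum_inverse_mul hM hi hk]]
    simp [hi]
  funext i
  by_cases hi : i ∈ s
  · rw [pivotTransform_of_mem hi, hB i hi]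
  · rw [pivotTransform, if_neg hi, hy i hi, mulVec_eq_sum_of_support hy, sub_eq_zero]
    exact sum_congr rfl fun j hj => by rw [hB j hj]

theorem InverseOn.sum_mul_schurColumn (h : InverseOn M s B) (i : Fin n) (hj : j ∈ s) :
    ∑ k ∈ s, M j k * schurColumn M s B i k = M j i :=
  h.sum_mul_sum (fun k => M k i) hj

theorem InverseOn.sum_mul_inverse (hM : M.IsSymm) (h : InverseOn M s B) (i : Fin n) (hj : j ∈ s) :
    ∑ k ∈ s, M i k * B k j = schurColumn M s B i j :=
  sum_congr rfl fun k hk => by rw [h.symm k hk j hj, hM.apply, mul_comm]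

theorem InverseOn.sum_mul_update_schurColumn (h : InverseOn M s B) (hi : i ∉ s)
    (hj : j ∈ insert i s) :
    ∑ k ∈ insert i s, M j k * Function.update (schurColumn M s B i) i (-1) k =
      if j = i then -schurPivot M s B i else 0 := by
  rw [sum_insert hi, Function.update_self, sum_congr rfl fun k hk => by
    rw [Function.update_of_ne (ne_of_mem_of_not_mem hk hi)]]
  rcases mem_insert.1 hj with rfl | hjs
  · rw [if_pos rfl, schurPivot]; ring
  · rw [h.sum_mul_schurColumn i hjs, if_neg (ne_of_mem_of_not_mem hjs hi)]; ring

theorem InverseOn.addIndex (hM : M.IsSymm) (hB : InverseOn M s B) (hi : i ∉ s)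
    (he : schurPivot M s B i ≠ 0) :
    InverseOn M (insert i s)
      (addIndex B i (schurColumn M s B i) (schurPivot M s B i)).eval := by
  set w : Fin n → ℝ := Function.update (schurColumn M s B i) i (-1) with hw
  have hne : ∀ k ∈ s, k ≠ i := fun k hk => ne_of_mem_of_not_mem hk hi
  have hwi : w i = -1 := Function.update_self ..
  have hws : ∀ k ∈ s, w k = schurColumn M s B i k := fun k hk => Function.update_of_ne (hne k hk) ..
  refine ⟨fun k hk l hl => ?_, fun k hk l hl => ?_⟩
  · rw [eval_addIndex, eval_addIndex, mul_comm (Function.update _ _ _ k)]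
    congr 1
    simp only [or_comm (a := k = i)]
    split_ifs with hkl
    · rfl
    · rw [not_or] at hkl
      exact hB.symm k (mem_of_mem_insert_of_ne hk hkl.2) l (mem_of_mem_insert_of_ne hl hkl.1)
  · have hsum : ∑ m ∈ insert i s, M k m *
          (BoundedQP.addIndex B i (schurColumn M s B i) (schurPivot M s B i)).eval m l =
        ∑ m ∈ insert i s, M k m * (if m = i ∨ l = i then 0 else B m l) +
          (if k = i then -schurPivot M s B i else 0) * w l / schurPivot M s B i := by
      simp only [eval_addIndex, mul_add, sum_add_distrib, ← hB.sum_mul_update_schurColumn hi hk,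
        sum_mul, sum_div, ← hw]
      congr 1
      exact sum_congr rfl fun m _ => by ring
    rw [hsum]
    rcases mem_insert.1 hl with rfl | hls
    · simp only [or_true, if_true, mul_zero, sum_const_zero, zero_add, hwi]
      split_ifs <;> simp [he]
    · have hMB : ∑ m ∈ insert i s, M k m * (if m = i ∨ l = i then 0 else B m l) =
          ∑ m ∈ s, M k m * B m l := by
        rw [sum_insert hi, if_pos (Or.inl rfl), mul_zero, zero_add]
        exact sum_congr rfl fun m hm => by rw [if_neg (not_or.2 ⟨hne m hm, hne l hls⟩)]
      rw [hMB]
      rcases eq_or_ne k i with rfl | hki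
      · rw [hB.sum_mul_inverse hM k hls, hws l hls, if_pos rfl, if_neg (hne l hls).symm]
        field_simp
        ring
      · rw [hB.mul k (mem_of_mem_insert_of_ne hk hki) l hls, if_neg hki, zero_mul, zero_div,
          add_zero]

theorem InverseOn.diag_ne_zero (hM : M.PosSemidef) (hB : InverseOn M s B) (hj : j ∈ s) :
    B j j ≠ 0 := by
  intro hjj
  let y : Fin n → ℝ := fun k => if k ∈ s then B k j else 0
  have hMy : ∀ i ∈ s, (M *ᵥ y) i = if i = j then 1 else 0 := fun i hi => by
    rw [mulVec_eq_sum_of_support (s := s) fun k hk => if_neg hk, ← hB.mul i hi j hj]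
    exact sum_congr rfl fun k hk => by simp only [if_pos hk]
  have hquad : y ⬝ᵥ M *ᵥ y = 0 := sum_eq_zero fun i _ => by
    by_cases hi : i ∈ s
    · rw [hMy i hi]
      rcases eq_or_ne i j with rfl | hij
      · simp [y, hi, hjj]
      · simp [hij]
    · simp [y, hi]
  have hzero := hMy j hj
  rw [posSemidef_mulVec_eq_zero hM hquad.le, if_pos rfl] at hzero
  exact zero_ne_one hzero

theorem InverseOn.dropIndex (hM : M.PosSemidef) (hB : InverseOn M s B) (hj : j ∈ s) :
    InverseOn M (s.erase j) (dropIndex B j).eval := by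
  have hjj := hB.diag_ne_zero hM hj
  refine ⟨fun k hk l hl => ?_, fun k hk l hl => ?_⟩ <;> rw [mem_erase] at hk hl
  · rw [eval_dropIndex, eval_dropIndex, hB.symm k hk.2 l hl.2, hB.symm k hk.2 j hj,
      hB.symm j hj l hl.2]
    ring
  · have hrow : M k j * (BoundedQP.dropIndex B j).eval j l = 0 := by
      rw [eval_dropIndex]; field_simp; ring
    calc ∑ m ∈ s.erase j, M k m * (BoundedQP.dropIndex B j).eval m l
        = ∑ m ∈ s, M k m * (BoundedQP.dropIndex B j).eval m l := sum_erase s hrow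
      _ = ∑ m ∈ s, M k m * B m l - (∑ m ∈ s, M k m * B m j) * B j l / B j j := by
        rw [sum_mul, sum_div, ← sum_sub_distrib]
        exact sum_congr rfl fun m _ => by rw [eval_dropIndex]; ring
      _ = if k = l then 1 else 0 := by
        rw [hB.mul k hk.2 l hl.2, hB.mul k hk.2 j hj, if_neg hk.1]; ring

theorem InverseOn.pivotTransform_paramVector_nonneg (hM : M.IsSymm) (hB : InverseOn M s B)
    (hd : Dominates M d) (i : Fin n) : 0 ≤ pivotTransform M s B (paramVector M d) i := by
  obtain ⟨y, hy, hys, hMy⟩ := hd.exists_mulVec_eq hM s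
  have hbar : ∀ k ∈ s, pivotTransform M s B (paramVector M d) k = y k := fun k hk => by
    rw [← pivotTransform_congr hMy (hMy k hk), hB.pivotTransform_mulVec hM hys]
  by_cases hi : i ∈ s
  · rw [hbar i hi]; exact (hy i).1
  · rw [pivotTransform_of_notMem hi, sum_congr rfl fun k hk => by rw [hbar k hk],
      ← mulVec_eq_sum_of_support hys]
    exact sub_nonneg.2 (hd.mulVec_le_paramVector hy (hys i hi))

/-- On `s ∪ {i}` the parametric vector equals `M y` for some `y ≥ 0` supported there, and
`y_i` times the Schur complement entry is the `i`-th transformed value. -/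
theorem InverseOn.schurPivot_pos (hM : M.IsSymm) (hB : InverseOn M s B) (hd : Dominates M d)
    (hi : i ∉ s) (hp : 0 < pivotTransform M s B (paramVector M d) i) :
    0 < schurPivot M s B i := by
  obtain ⟨y, hy, hys, hMy⟩ := hd.exists_mulVec_eq hM (insert i s)
  let y₀ : Fin n → ℝ := Function.update y i 0
  have hy₀ : ∀ j ∉ s, y₀ j = 0 := fun j hj => by
    rcases eq_or_ne j i with rfl | hji
    · exact Function.update_self ..
    · rw [show y₀ j = y j from Function.update_of_ne hji .., hys j (by simp [hji, hj])]
  have hsplit : M *ᵥ y = M *ᵥ y₀ + y i • fun j => M j i := by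
    have hy_eq : y = y₀ + Pi.single i (y i) := by
      funext j; rcases eq_or_ne j i with rfl | hji <;> simp [y₀, *]
    conv_lhs => rw [hy_eq, mulVec_add, mulVec_single]
    ext j; simp [mul_comm]
  have hbar : pivotTransform M s B (paramVector M d) i = y i * schurPivot M s B i := by
    rw [← pivotTransform_congr (fun j hj => hMy j (mem_insert_of_mem hj))
      (hMy i (mem_insert_self i s)), hsplit, pivotTransform_add_smul,
      hB.pivotTransform_mulVec hM hy₀, schurPivot_eq_pivotTransform hi]
    simp [hy₀ i hi]
  exact pos_of_mul_pos_right (hbar ▸ hp) (hy i).1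

end Inverse
/-! ## The pivoting iterations -/

section Pivot

variable {n : ℕ} {M B : Matrix (Fin n) (Fin n) ℝ} {p q r x : Fin n → ℝ} {u : Fin n → WithTop ℝ}
  {st : Fin n → Status} {i : Fin n} {τ T : ℝ}

/-- A variable with value `x`, upper bound `u` and partial derivative `g` of the objective function
is optimal in the given position. -/
def Status.Fits (u : WithTop ℝ) (x g : ℝ) : Status → Prop
  | .between => 0 ≤ x ∧ (x : WithTop ℝ) ≤ u ∧ g = 0
  | .lower => x = 0 ∧ 0 ≤ u ∧ 0 ≤ g
  | .upper => 0 ≤ x ∧ (x : WithTop ℝ) = u ∧ g ≤ 0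

/-- The value of a variable in the given position, where `-v` is the value between the bounds. The
upper position is only used for `u ≠ ⊤`. -/
def Status.value (u : WithTop ℝ) (v : ℝ) : Status → ℝ
  | .between => -v
  | .lower => 0
  | .upper => u.untopD 0

/-- The candidate of a variable in the first ratio test: the value `τ` of the parameter at which
the variable with transformed linear term `b + τ c` reaches a bound or leaves it. -/
noncomputable def Status.ratio (u : WithTop ℝ) (b c : ℝ) (a : Status) : Option ℝ :=
  if 0 < c then
    match a, u with
    | .lower, _ => some (-(b / c))
    | .between, (t : ℝ) => some (-((t + b) / c))
    | .between, ⊤ => none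
    | .upper, _ => none
  else none

theorem Status.Fits.ratio_le {a : Status} {u : WithTop ℝ} {x g b c T ρ : ℝ} (h : a.Fits u x g)
    (hv : b + T * c = if a = .between then -x else g) (hρ : ρ ∈ a.ratio u b c) : ρ ≤ T := by
  unfold Status.ratio at hρ
  split_ifs at hρ with hc
  swap
  · cases hρ
  rcases a
  · rcases u with _ | t
    · cases hρ
    · cases hρ
      have hxt := WithTop.coe_le_coe.1 h.2.1
      rw [if_pos rfl] at hv
      rw [neg_le, le_div_iff₀ hc]
      linarith
  · cases hρ
    have hg := h.2.2
    rw [if_neg nofun] at hv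
    rw [neg_le, le_div_iff₀ hc]
    linarith
  · cases hρ

theorem Status.Fits.of_ratio_le {a : Status} {u : WithTop ℝ} {x g b c T τ : ℝ} (h : a.Fits u x g)
    (hv : b + T * c = if a = .between then -x else g) (hτ : τ ≤ T) (hc : 0 ≤ c)
    (hρ : ∀ ρ ∈ a.ratio u b c, ρ ≤ τ) :
    a.Fits u (a.value u (b + τ * c)) (if a = .between then 0 else b + τ * c) := by
  have hmono : τ * c ≤ T * c := mul_le_mul_of_nonneg_right hτ hc
  rcases a
  · obtain ⟨hx, hxu, -⟩ := h
    rw [if_pos rfl] at hv ⊢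
    refine ⟨by simp only [Status.value]; linarith, ?_, rfl⟩
    rcases u with _ | t
    · exact le_top
    · refine WithTop.coe_le_coe.2 (?_ : -(b + τ * c) ≤ t)
      rcases hc.eq_or_lt with rfl | hc
      · linarith [WithTop.coe_le_coe.1 hxu]
      · have hle := hρ (-((t + b) / c)) (if_pos hc)
        rw [neg_le, le_div_iff₀ hc] at hle
        linarith
  · obtain ⟨-, hu, hg⟩ := h
    rw [if_neg nofun] at hv ⊢
    refine ⟨rfl, hu, ?_⟩
    rcases hc.eq_or_lt with rfl | hc
    · linarith
    · have hle := hρ (-(b / c)) (if_pos hc)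
      rw [neg_le, le_div_iff₀ hc] at hle
      linarith
  · obtain ⟨hx, rfl, hg⟩ := h
    rw [if_neg nofun] at hv ⊢
    exact ⟨hx, rfl, by linarith⟩

theorem Status.Fits.upper_of_mem_ratio {a : Status} {u : WithTop ℝ} {x g b c τ : ℝ}
    (h : a.Fits u x g) (ha : a = .between) (hx : x = -(b + τ * c))
    (hτ : τ ∈ a.ratio u b c) : Status.upper.Fits u x g := by
  subst ha
  unfold Status.ratio at hτ
  split_ifs at hτ with hc
  swap
  · cases hτ
  rcases u with _ | t
  · cases hτ
  · cases hτ
    refine ⟨h.1, congrArg WithTop.some ?_, h.2.2.le⟩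
    rw [hx, neg_mul, div_mul_cancel₀ _ hc.ne']
    ring

theorem Status.Fits.between_of_mem_ratio {a : Status} {u : WithTop ℝ} {x g b c τ : ℝ}
    (h : a.Fits u x g) (ha : a = .lower) (hg : g = b + τ * c)
    (hτ : τ ∈ a.ratio u b c) : Status.between.Fits u x g := by
  subst ha
  unfold Status.ratio at hτ
  split_ifs at hτ with hc
  swap
  · cases hτ
  cases hτ
  refine ⟨h.1.ge, h.1 ▸ h.2.1, ?_⟩
  rw [hg, neg_mul, div_mul_cancel₀ _ hc.ne', add_neg_cancel]

/-- The vector `x` solves the problem with linear term `r`, with the variables in the positions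
`st`. -/
def SolvesAt (M : Matrix (Fin n) (Fin n) ℝ) (r : Fin n → ℝ) (u : Fin n → WithTop ℝ)
    (st : Fin n → Status) (x : Fin n → ℝ) : Prop :=
  ∀ i, (st i).Fits (u i) (x i) (gradient M r x i)

theorem SolvesAt.kkt (h : SolvesAt M q u st x) : KKT M q u x := by
  intro i
  have hi := h i
  rcases hst : st i <;> rw [hst] at hi
  · exact ⟨hi.1, hi.2.1, fun _ => hi.2.2.le, fun _ => hi.2.2.ge⟩
  · exact ⟨hi.1.ge, hi.1 ▸ hi.2.1, fun hpos => absurd hi.1 hpos.ne', fun _ => hi.2.2⟩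
  · exact ⟨hi.1, hi.2.1.le, fun _ => hi.2.2, fun hlt => absurd hi.2.1 hlt.ne⟩

theorem SolvesAt.update (h : SolvesAt M q u st x) {a : Status}
    (ha : a.Fits (u i) (x i) (gradient M q x i)) : SolvesAt M q u (Function.update st i a) x := by
  intro j
  rcases eq_or_ne j i with rfl | hj
  · rwa [Function.update_self]
  · rw [Function.update_of_ne hj]
    exact h j

/-- The indices of the variables between their bounds. -/
def betweenSet (st : Fin n → Status) : Finset (Fin n) := {i | isBetween st i}

theorem mem_betweenSet : i ∈ betweenSet st ↔ st i = .between := by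
  simp [betweenSet, isBetween]

theorem betweenSet_update_of_ne {a : Status} (ha : a ≠ .between) :
    betweenSet (Function.update st i a) = (betweenSet st).erase i := by
  ext j
  rcases eq_or_ne j i with rfl | h <;> simp [mem_betweenSet, *]

theorem betweenSet_update_between :
    betweenSet (Function.update st i .between) = insert i (betweenSet st) := by
  ext j
  rcases eq_or_ne j i with rfl | h <;> simp [mem_betweenSet, *]

/-- The linear term after the variables at their upper bounds have been fixed. -/
def shiftedTerm (M : Matrix (Fin n) (Fin n) ℝ) (r : Fin n → ℝ) (u : Fin n → WithTop ℝ)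
    (st : Fin n → Status) (i : Fin n) : ℝ :=
  r i + ∑ k with st k = .upper, M i k * (u k).untopD 0

/-- The vector `q̄` of the algorithm. -/
def reducedTerm (M : Matrix (Fin n) (Fin n) ℝ) (r : Fin n → ℝ) (u : Fin n → WithTop ℝ)
    (st : Fin n → Status) (B : Matrix (Fin n) (Fin n) ℝ) : Fin n → ℝ :=
  pivotTransform M (betweenSet st) B (shiftedTerm M r u st)

theorem eval_shiftedLinearTerm :
    (shiftedLinearTerm M q u st).eval = shiftedTerm M q u st := by
  funext i
  simp only [shiftedLinearTerm, eval_tab, eval_bind, eval_add, eval_sumOn, shiftedTerm,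
    decide_eq_true_eq]
  congr 1
  refine sum_congr rfl fun k _ => ?_
  rcases u k with _ | c
  · exact (Nat.cast_zero (R := ℝ)).trans (mul_zero (M i k)).symm
  · rfl

theorem reducedTerm_add_smul (q p : Fin n → ℝ) (τ : ℝ) : reducedTerm M (q + τ • p) u st B =
    reducedTerm M q u st B + τ • pivotTransform M (betweenSet st) B p := by
  rw [reducedTerm, reducedTerm, ← pivotTransform_add_smul]
  congr 1
  funext i
  simp only [shiftedTerm, Pi.add_apply]
  ring

theorem gradient_eq_shiftedTerm_add (hl : ∀ i, st i = .lower → x i = 0)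
    (hu : ∀ i, st i = .upper → x i = (u i).untopD 0) (i : Fin n) :
    gradient M r x i = shiftedTerm M r u st i + ∑ j ∈ betweenSet st, M i j * x j := by
  have hsplit : ∀ j, M i j * x j = (if st j = .upper then M i j * (u j).untopD 0 else 0) +
      (if j ∈ betweenSet st then M i j * x j else 0) := fun j => by
    simp only [mem_betweenSet]
    rcases hj : st j
    · simp
    · simp [hl j hj]
    · simp [hu j hj]
  rw [gradient_apply, sum_congr rfl fun j _ => hsplit j, sum_add_distrib, shiftedTerm, sum_filter,
    ← sum_filter (p := fun j => j ∈ betweenSet st), filter_mem_eq_inter, univ_inter, add_assoc]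

theorem gradient_value_reducedTerm (hB : InverseOn M (betweenSet st) B) (i : Fin n) :
    gradient M r (fun j => (st j).value (u j) (reducedTerm M r u st B j)) i =
      if st i = .between then 0 else reducedTerm M r u st B i := by
  rw [gradient_eq_shiftedTerm_add (u := u) (st := st) (fun i hi => by rw [hi]; rfl)
    (fun i hi => by rw [hi]; rfl)]
  have hbetween : ∑ j ∈ betweenSet st, M i j * (st j).value (u j) (reducedTerm M r u st B j) =
      -∑ j ∈ betweenSet st, M i j * reducedTerm M r u st B j := by
    rw [← sum_neg_distrib]
    exact sum_congr rfl fun j hj => by rw [mem_betweenSet.1 hj]; exact mul_neg _ _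
  rw [hbetween, ← sub_eq_add_neg]
  split_ifs with hi
  · rw [reducedTerm, hB.sum_mul_pivotTransform _ (mem_betweenSet.2 hi), sub_self]
  · exact (pivotTransform_of_notMem (mt mem_betweenSet.1 hi)).symm

theorem SolvesAt.reducedTerm_eq (hM : M.IsSymm) (hB : InverseOn M (betweenSet st) B)
    (h : SolvesAt M r u st x) (i : Fin n) :
    reducedTerm M r u st B i = if st i = .between then -x i else gradient M r x i := by
  let y : Fin n → ℝ := fun j => if j ∈ betweenSet st then x j else 0
  have hgrad : ∀ j, gradient M r x j = shiftedTerm M r u st j + (M *ᵥ y) j := fun j => by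
    rw [gradient_eq_shiftedTerm_add (u := u) (st := st)
        (fun k hk => by have hfit := h k; rw [hk] at hfit; exact hfit.1)
        (fun k hk => by
          have hfit := h k
          rw [hk] at hfit
          rw [← hfit.2.1]; rfl),
      mulVec_eq_sum_of_support (s := betweenSet st) fun k hk => if_neg hk]
    congr 1
    exact sum_congr rfl fun k hk => by rw [if_pos hk]
  have hshift : ∀ j, st j = .between → shiftedTerm M r u st j = (M *ᵥ -y) j := fun j hj => by
    have hfit := h j
    rw [hj] at hfit
    have hzero := hfit.2.2
    rw [hgrad] at hzero
    rw [mulVec_neg, Pi.neg_apply]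
    linarith
  have htransform : ∀ j, st j = .between → reducedTerm M r u st B j = -x j := fun j hj => by
    rw [reducedTerm, pivotTransform_congr (fun k hk => hshift k (mem_betweenSet.1 hk))
        (hshift j hj),
      hB.pivotTransform_mulVec hM (fun k hk => by simp [y, hk])]
    simp [y, mem_betweenSet.2 hj]
  split_ifs with hi
  · exact htransform i hi
  · rw [hgrad, mulVec_eq_sum_of_support (s := betweenSet st) fun k hk => if_neg hk, reducedTerm,
      pivotTransform_of_notMem (mt mem_betweenSet.1 hi), sub_eq_add_neg, ← sum_neg_distrib]
    congr 1
    refine sum_congr rfl fun j hj => ?_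
    rw [← reducedTerm, htransform j (mem_betweenSet.1 hj), mul_neg, neg_neg, if_pos hj]

theorem SolvesAt.of_ratio_le (hM : M.IsSymm) (hB : InverseOn M (betweenSet st) B)
    (h : SolvesAt M (q + T • p) u st x) (hτ : τ ≤ T)
    (hp : ∀ i, 0 ≤ pivotTransform M (betweenSet st) B p i)
    (hρ : ∀ i, ∀ ρ ∈ (st i).ratio (u i) (reducedTerm M q u st B i)
      (pivotTransform M (betweenSet st) B p i), ρ ≤ τ) :
    SolvesAt M (q + τ • p) u st
      fun j => (st j).value (u j) (reducedTerm M (q + τ • p) u st B j) := by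
  intro i
  have hv := h.reducedTerm_eq hM hB i
  rw [reducedTerm_add_smul] at hv
  rw [gradient_value_reducedTerm hB, reducedTerm_add_smul]
  exact (h i).of_ratio_le hv hτ (hp i) (hρ i)

theorem SolvesAt.ratio_le (hM : M.IsSymm) (hB : InverseOn M (betweenSet st) B)
    (h : SolvesAt M (q + T • p) u st x) {ρ : ℝ}
    (hρ : ρ ∈ (st i).ratio (u i) (reducedTerm M q u st B i)
      (pivotTransform M (betweenSet st) B p i)) : ρ ≤ T := by
  have hv := h.reducedTerm_eq hM hB i
  rw [reducedTerm_add_smul] at hv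
  exact (h i).ratio_le hv hρ

theorem criticalValue_spec (u : Fin n → WithTop ℝ) (st : Fin n → Status) (b c : Fin n → ℝ) :
    (∀ i, ∀ ρ ∈ (st i).ratio (u i) (b i) (c i),
      ∃ m ∈ (criticalValue u st b c).eval, ρ ≤ m.1) ∧
    ∀ m ∈ (criticalValue u st b c).eval, m.1 ∈ (st m.2).ratio (u m.2) (b m.2) (c m.2) := by
  refine loop_keepMax_spec fun best i => ?_
  simp only [eval_bind, eval_isPos, eval_ite, decide_eq_true_eq, Status.ratio, eval_pure]
  by_cases h : 0 < c i
  · simp only [h, if_true]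
    rcases st i <;> rcases u i with _ | t <;> simp
  · simp [h]

/-- The number of pivots that a variable may still take part in. -/
def Status.weight : Status → ℕ
  | .lower => 2
  | .between => 1
  | .upper => 0

/-- A bound on the number of pivots that are still possible. -/
def pivotsLeft (st : Fin n → Status) : ℕ := ∑ i, (st i).weight

theorem pivotsLeft_update (st : Fin n → Status) (i : Fin n) (a : Status)
    (h : (st i).weight = a.weight + 1) :
    pivotsLeft (Function.update st i a) + 1 = pivotsLeft st := by
  rw [pivotsLeft, pivotsLeft, ← add_sum_erase _ _ (mem_univ i),
    ← add_sum_erase univ (fun i => (st i).weight) (mem_univ i), Function.update_self, h,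
    sum_congr rfl fun j hj => by rw [Function.update_of_ne (ne_of_mem_erase hj)]]
  omega

theorem eval_pivotLoop_of_nonpos (fuel : ℕ)
    (h : ∀ m ∈ (criticalValue u st (reducedTerm M q u st B)
      (pivotTransform M (betweenSet st) B p)).eval, m.1 ≤ 0) :
    (pivotLoop M q u p (fuel + 1) st B).eval =
      .optimal fun i => (st i).value (u i) (reducedTerm M q u st B i) := by
  have hreduced : (transform M (isBetween st) B (shiftedTerm M q u st)).eval =
      reducedTerm M q u st B := eval_transform M (isBetween st) B (shiftedTerm M q u st)
  have htransform : (transform M (isBetween st) B p).eval =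
      pivotTransform M (betweenSet st) B p := eval_transform M (isBetween st) B p
  simp only [pivotLoop, eval_bind, eval_shiftedLinearTerm, hreduced, htransform]
  rcases hc : (criticalValue u st (reducedTerm M q u st B)
    (pivotTransform M (betweenSet st) B p)).eval with _ | ⟨τ, i⟩
  on_goal 2 => have hτ : ¬0 < τ := not_lt.2 (h _ hc)
  all_goals
    simp only [eval_pure, eval_bind, eval_isPos, decide_eq_true_eq, if_false, eval_tab, *]
    refine congrArg Outcome.optimal (funext fun i => ?_)
    rcases st i <;> rcases u i with _ | c <;> simp <;> rfl

theorem eval_pivotLoop_of_between (fuel : ℕ) (hi : st i = .between) (hτ : 0 < τ)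
    (hc : (criticalValue u st (reducedTerm M q u st B)
      (pivotTransform M (betweenSet st) B p)).eval = some (τ, i)) :
    (pivotLoop M q u p (fuel + 1) st B).eval =
      (pivotLoop M q u p fuel (Function.update st i .upper) (dropIndex B i).eval).eval := by
  have hreduced : (transform M (isBetween st) B (shiftedTerm M q u st)).eval =
      reducedTerm M q u st B := eval_transform M (isBetween st) B (shiftedTerm M q u st)
  have htransform : (transform M (isBetween st) B p).eval =
      pivotTransform M (betweenSet st) B p := eval_transform M (isBetween st) B p
  simp only [pivotLoop, eval_bind, eval_shiftedLinearTerm, hreduced, htransform, hc, eval_isPos,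
    decide_eq_true_eq, hτ, if_true, eval_pure, hi]

theorem eval_pivotLoop_of_lower (fuel : ℕ) (hi : st i = .lower) (hτ : 0 < τ)
    (hs : 0 < schurPivot M (betweenSet st) B i)
    (hc : (criticalValue u st (reducedTerm M q u st B)
      (pivotTransform M (betweenSet st) B p)).eval = some (τ, i)) :
    (pivotLoop M q u p (fuel + 1) st B).eval =
      (pivotLoop M q u p fuel (Function.update st i .between)
        (addIndex B i (schurColumn M (betweenSet st) B i)
          (schurPivot M (betweenSet st) B i)).eval).eval := by
  have hreduced : (transform M (isBetween st) B (shiftedTerm M q u st)).eval =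
      reducedTerm M q u st B := eval_transform M (isBetween st) B (shiftedTerm M q u st)
  have htransform : (transform M (isBetween st) B p).eval =
      pivotTransform M (betweenSet st) B p := eval_transform M (isBetween st) B p
  have hschur : (schurEntry M (isBetween st) B i).eval =
      (schurColumn M (betweenSet st) B i, schurPivot M (betweenSet st) B i) :=
    eval_schurEntry M (isBetween st) B i
  simp only [pivotLoop, eval_bind, eval_shiftedLinearTerm, hreduced, htransform, hc, eval_isPos,
    decide_eq_true_eq, hτ, if_true, eval_pure, hi, hschur, hs, reduceCtorEq, if_false]

theorem SolvesAt.pivot_of_between (hM : M.PosSemidef) (hB : InverseOn M (betweenSet st) B)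
    (h : SolvesAt M (q + τ • p) u st
      fun j => (st j).value (u j) (reducedTerm M (q + τ • p) u st B j))
    (hi : st i = .between)
    (hτ : τ ∈ (st i).ratio (u i) (reducedTerm M q u st B i)
      (pivotTransform M (betweenSet st) B p i)) :
    InverseOn M (betweenSet (Function.update st i .upper)) (dropIndex B i).eval ∧
      SolvesAt M (q + τ • p) u (Function.update st i .upper)
        (fun j => (st j).value (u j) (reducedTerm M (q + τ • p) u st B j)) ∧
      pivotsLeft (Function.update st i .upper) + 1 = pivotsLeft st := by
  refine ⟨?_, h.update ((h i).upper_of_mem_ratio hi ?_ hτ),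
    pivotsLeft_update st i _ (by rw [hi]; rfl)⟩
  · have hset := betweenSet_update_of_ne (st := st) (i := i) (a := .upper) (by decide)
    exact hset ▸ hB.dropIndex hM (mem_betweenSet.2 hi)
  · simp only [hi, reducedTerm_add_smul]
    rfl

theorem SolvesAt.pivot_of_lower (hM : M.IsSymm) (hB : InverseOn M (betweenSet st) B)
    {d : Fin n → ℝ} (hd : Dominates M d)
    (h : SolvesAt M (q + τ • paramVector M d) u st
      fun j => (st j).value (u j) (reducedTerm M (q + τ • paramVector M d) u st B j))
    (hi : st i = .lower)
    (hτ : τ ∈ (st i).ratio (u i) (reducedTerm M q u st B i)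
      (pivotTransform M (betweenSet st) B (paramVector M d) i)) :
    0 < schurPivot M (betweenSet st) B i ∧
      InverseOn M (betweenSet (Function.update st i .between))
        (addIndex B i (schurColumn M (betweenSet st) B i)
          (schurPivot M (betweenSet st) B i)).eval ∧
      SolvesAt M (q + τ • paramVector M d) u (Function.update st i .between)
        (fun j => (st j).value (u j) (reducedTerm M (q + τ • paramVector M d) u st B j)) ∧
      pivotsLeft (Function.update st i .between) + 1 = pivotsLeft st := by
  have hmem : i ∉ betweenSet st := by simp [mem_betweenSet, hi]
  have hs : 0 < schurPivot M (betweenSet st) B i := by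
    refine hB.schurPivot_pos hM hd hmem ?_
    by_contra hc
    rw [hi, Status.ratio, if_neg hc] at hτ
    cases hτ
  refine ⟨hs, ?_, h.update ((h i).between_of_mem_ratio hi ?_ hτ),
    pivotsLeft_update st i _ (by rw [hi]; rfl)⟩
  · exact betweenSet_update_between (st := st) (i := i) ▸ hB.addIndex hM hmem hs.ne'
  · rw [gradient_value_reducedTerm hB, hi, if_neg (by decide), reducedTerm_add_smul]
    rfl

theorem eval_pivotLoop_spec (hM : M.PosSemidef) {d : Fin n → ℝ} (hd : Dominates M d) :
    ∀ (fuel : ℕ) (st : Fin n → Status) (B : Matrix (Fin n) (Fin n) ℝ) (T : ℝ) (x : Fin n → ℝ),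
      InverseOn M (betweenSet st) B → 0 ≤ T → SolvesAt M (q + T • paramVector M d) u st x →
      pivotsLeft st + 1 ≤ fuel →
      ∃ x, (pivotLoop M q u (paramVector M d) fuel st B).eval = .optimal x ∧ KKT M q u x
  | 0, _, _, _, _, _, _, _, hf => by omega
  | fuel + 1, st, B, _, _, hB, hT, h, hf => by
    have hsymm := posSemidef_isSymm hM
    have hp := hB.pivotTransform_paramVector_nonneg hsymm hd
    obtain ⟨hmax, hatt⟩ := criticalValue_spec u st (reducedTerm M q u st B)
      (pivotTransform M (betweenSet st) B (paramVector M d))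
    by_cases hlast : ∀ m ∈ (criticalValue u st (reducedTerm M q u st B)
        (pivotTransform M (betweenSet st) B (paramVector M d))).eval, m.1 ≤ 0
    · refine ⟨_, eval_pivotLoop_of_nonpos fuel hlast, SolvesAt.kkt (st := st) ?_⟩
      have hzero := h.of_ratio_le hsymm hB hT hp fun i ρ hρ =>
        let ⟨m, hm, hle⟩ := hmax i ρ hρ
        hle.trans (hlast m hm)
      rwa [zero_smul, add_zero] at hzero
    push Not at hlast
    obtain ⟨⟨τ, i⟩, hcrit, hτ : 0 < τ⟩ := hlast
    have hratio : τ ∈ (st i).ratio (u i) _ _ := hatt _ hcrit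
    have hsol := h.of_ratio_le hsymm hB (h.ratio_le hsymm hB hratio) hp fun j ρ hj => by
      obtain ⟨m, hm, hle⟩ := hmax j ρ hj
      cases hcrit.symm.trans hm
      exact hle
    cases hi : st i
    · obtain ⟨hB', hsol', hleft⟩ := hsol.pivot_of_between hM hB hi hratio
      rw [eval_pivotLoop_of_between fuel hi hτ hcrit]
      exact eval_pivotLoop_spec hM hd fuel _ _ τ _ hB' hτ.le hsol' (by omega)
    · obtain ⟨hs, hB', hsol', hleft⟩ := hsol.pivot_of_lower hsymm hB hd hi hratio
      rw [eval_pivotLoop_of_lower fuel hi hτ hs hcrit]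
      exact eval_pivotLoop_spec hM hd fuel _ _ τ _ hB' hτ.le hsol' (by omega)
    · rw [hi, Status.ratio.eq_def, ite_self] at hratio
      cases hratio

end Pivot
/-! ## The vector `d` -/

section DominanceVector

variable {n : ℕ}

theorem eval_comparison (M : Matrix (Fin n) (Fin n) ℝ) :
    (comparison M).eval = comparisonMatrix M := by
  funext i j
  simp only [comparison, eval_tab2, eval_ite, eval_pure, eval_bind, eval_isPos, decide_eq_true_eq,
    eval_neg]
  split_ifs with hij hpos
  · rw [← hij, comparisonMatrix_self]
  · rw [comparisonMatrix_of_ne M hij, abs_of_pos hpos]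
  · rw [comparisonMatrix_of_ne M hij, abs_of_nonpos (not_lt.1 hpos), neg_neg]

theorem eval_parametricVector (M : Matrix (Fin n) (Fin n) ℝ) (d : Fin n → ℝ) :
    (parametricVector M d).eval = paramVector M d := by
  funext i
  simp [parametricVector, eval_comparison, paramVector]

theorem eval_dominanceVector_of_pos {A : Matrix (Fin (n + 1)) (Fin (n + 1)) ℝ} (h : 0 < A 0 0) :
    (dominanceVector A).eval =
      if ∑ k : Fin n, A 0 k.succ * (dominanceVector (schurComplement A 0)).eval k < 0 then
        extendByRow A 0 0 (dominanceVector (schurComplement A 0)).eval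
      else Fin.cons 1 (dominanceVector (schurComplement A 0)).eval := by
  have hschur : (fun j k : Fin n => A j.succ k.succ - A j.succ 0 * A 0 k.succ / A 0 0) =
      schurComplement A 0 := rfl
  simp only [dominanceVector, eval_bind, eval_isPos, decide_eq_true_eq, h, if_true, eval_tab2,
    eval_sub, eval_mul, eval_div, eval_sumOn, filter_true, eval_isNeg, eval_ite, eval_neg,
    eval_lit, eval_pure, Nat.cast_one, hschur]
  split_ifs <;> simp [extendByRow]

theorem eval_dominanceVector_of_nonpos {A : Matrix (Fin (n + 1)) (Fin (n + 1)) ℝ}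
    (h : A 0 0 ≤ 0) :
    (dominanceVector A).eval =
      Fin.cons 1 (dominanceVector (A.submatrix Fin.succ Fin.succ)).eval := by
  simp only [dominanceVector, eval_bind, eval_isPos, decide_eq_true_eq, h.not_gt,
    if_false, eval_tab2, eval_lit, eval_pure, Nat.cast_one]
  rfl

theorem mulVec_cons_nonneg {A : Matrix (Fin (n + 1)) (Fin (n + 1)) ℝ} {d : Fin n → ℝ} {t : ℝ}
    (ht : 0 ≤ t) (hdiag : 0 ≤ A 0 0) (hrow : ∀ k : Fin n, A 0 k.succ = 0)
    (hcol : ∀ k : Fin n, A k.succ 0 = 0) (hd : 0 ≤ A.submatrix Fin.succ Fin.succ *ᵥ d) :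
    0 ≤ A *ᵥ (Fin.cons t d : Fin (n + 1) → ℝ) := by
  refine Fin.cases ?_ fun j => ?_
  · simpa [mulVec, dotProduct, Fin.sum_univ_succ, hrow] using mul_nonneg hdiag ht
  · simpa [mulVec, dotProduct, Fin.sum_univ_succ, hcol] using hd j

theorem eval_dominanceVector_spec : ∀ {n : ℕ} {A : Matrix (Fin n) (Fin n) ℝ}, A.PosSemidef →
    (∀ i j, i ≠ j → A i j ≤ 0) →
    (∀ i, 0 < (dominanceVector A).eval i) ∧ 0 ≤ A *ᵥ (dominanceVector A).eval
  | 0, _, _, _ => ⟨fun i => i.elim0, fun i => i.elim0⟩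
  | n + 1, A, hA, hneg => by
    have hsymm := (posSemidef_isSymm hA).apply
    have hrow : ∀ k : Fin n, A 0 k.succ ≤ 0 := fun k => hneg _ _ (Fin.succ_ne_zero k).symm
    have hsub : ∀ i j : Fin n, i ≠ j → A i.succ j.succ ≤ 0 := fun i j hij =>
      hneg _ _ fun h => hij (Fin.succ_injective _ h)
    rcases (hA.diag_nonneg (i := 0)).eq_or_lt with hzero | hpos
    · obtain ⟨hd, hAd⟩ := eval_dominanceVector_spec (hA.submatrix Fin.succ) hsub
      have hrow₀ := posSemidef_row_eq_zero hA hzero.symm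
      rw [eval_dominanceVector_of_nonpos hzero.ge]
      exact ⟨Fin.cases one_pos hd, mulVec_cons_nonneg zero_le_one hzero.le (fun k => hrow₀ _)
        (fun k => by rw [hsymm, hrow₀]) hAd⟩
    · obtain ⟨hd, hSd⟩ := eval_dominanceVector_spec (posSemidef_schurComplement hA hpos.ne')
        fun i j hij => sub_nonpos.2 ((hsub i j hij).trans (div_nonneg
          (mul_nonneg_of_nonpos_of_nonpos (hsymm 0 i.succ ▸ hrow i) (hrow j)) hpos.le))
      rw [eval_dominanceVector_of_pos hpos]
      generalize (dominanceVector (schurComplement A 0)).eval = d at hd hSd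
      have hterm : ∀ k ∈ univ, A 0 (Fin.succ k) * d k ≤ 0 := fun k _ =>
        mul_nonpos_of_nonpos_of_nonneg (hrow k) (hd k).le
      split_ifs with ht
      · refine ⟨fun i => ?_, ?_⟩
        · refine Fin.cases ?_ (fun k => ?_) i
          · simpa [extendByRow] using div_neg_of_neg_of_pos ht hpos
          · simpa [extendByRow] using hd k
        · rw [mulVec_extendByRow_zero hpos.ne', Fin.insertNth_zero]
          exact Fin.cases le_rfl hSd
      · have hrow₀ : ∀ k : Fin n, A 0 k.succ = 0 := fun k =>
          (mul_eq_zero.1 ((sum_eq_zero_iff_of_nonpos hterm).1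
            (le_antisymm (sum_nonpos hterm) (not_lt.1 ht)) k (mem_univ k))).resolve_right (hd k).ne'
        have hcol₀ : ∀ k : Fin n, A k.succ 0 = 0 := fun k => by rw [hsymm, hrow₀]
        have hschur : schurComplement A 0 = A.submatrix Fin.succ Fin.succ := by
          ext j k
          simp [schurComplement, hrow₀]
        exact ⟨Fin.cases one_pos hd,
          mulVec_cons_nonneg zero_le_one hpos.le hrow₀ hcol₀ (hschur ▸ hSd)⟩

theorem dominates_dominanceVector {M : Matrix (Fin n) (Fin n) ℝ}
    (h : (comparisonMatrix M).PosSemidef) :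
    Dominates M (dominanceVector (comparisonMatrix M)).eval := by
  obtain ⟨hpos, hnonneg⟩ := eval_dominanceVector_spec h fun i j hij => by
    rw [comparisonMatrix_of_ne M hij]
    exact neg_nonpos.2 (abs_nonneg _)
  exact ⟨hpos, hnonneg⟩

end DominanceVector
/-! ## Reductions -/

section SchurReduction

variable {n : ℕ} {M : Matrix (Fin (n + 1)) (Fin (n + 1)) ℝ} {q : Fin (n + 1) → ℝ}
  {u : Fin (n + 1) → WithTop ℝ} {d : Fin (n + 1) → ℝ} {i : Fin (n + 1)}

theorem Dominates.submatrix_succAbove (h : Dominates M d) (i : Fin (n + 1)) :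
    Dominates (M.submatrix i.succAbove i.succAbove) fun j => d (i.succAbove j) := by
  refine ⟨fun j => h.pos _, fun j => ?_⟩
  have hrow := h.nonneg (i.succAbove j)
  rw [Fin.sum_univ_succAbove _ i, comparisonMatrix_of_ne M (Fin.succAbove_ne i j)] at hrow
  simp only [comparisonMatrix_submatrix M Fin.succAbove_right_injective, submatrix_apply]
  linarith [mul_nonneg (abs_nonneg (M (i.succAbove j) i)) (h.pos i).le]

theorem comparisonMatrix_add_le_schurComplement (hi : 0 < M i i) (j k : Fin n) :
    comparisonMatrix M (i.succAbove j) (i.succAbove k) +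
        |M (i.succAbove j) i| / M i i * comparisonMatrix M i (i.succAbove k) ≤
      comparisonMatrix (schurComplement M i) j k := by
  have hprod : |M (i.succAbove j) i| / M i i * comparisonMatrix M i (i.succAbove k) =
      -|M (i.succAbove j) i * M i (i.succAbove k) / M i i| := by
    rw [comparisonMatrix_of_ne M (Fin.succAbove_ne i k).symm, abs_div, abs_mul, abs_of_pos hi]
    ring
  rw [hprod]
  rcases eq_or_ne j k with rfl | hjk
  · rw [comparisonMatrix_self, comparisonMatrix_self, ← sub_eq_add_neg]
    exact sub_le_sub_left (le_abs_self _) _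
  · rw [comparisonMatrix_of_ne _ hjk, comparisonMatrix_of_ne M
      fun e => hjk (Fin.succAbove_right_injective e), ← neg_add, neg_le_neg_iff]
    exact abs_sub _ _

theorem Dominates.schurComplement (h : Dominates M d) (hi : 0 < M i i) :
    Dominates (schurComplement M i) fun j => d (i.succAbove j) := by
  refine ⟨fun j => h.pos _, fun j => ?_⟩
  have hrow := h.nonneg (i.succAbove j)
  have hpivot := h.nonneg i
  rw [Fin.sum_univ_succAbove _ i, comparisonMatrix_of_ne M (Fin.succAbove_ne i j)] at hrow
  rw [Fin.sum_univ_succAbove _ i, comparisonMatrix_self] at hpivot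
  set a := |M (i.succAbove j) i|
  have hscaled := mul_nonneg (div_nonneg (abs_nonneg (M (i.succAbove j) i)) hi.le) hpivot
  calc (0 : ℝ)
    _ ≤ (-a * d i + ∑ k, comparisonMatrix M (i.succAbove j) (i.succAbove k) * d (i.succAbove k)) +
        a / M i i * (M i i * d i + ∑ k, comparisonMatrix M i (i.succAbove k) * d (i.succAbove k)) :=
      add_nonneg hrow hscaled
    _ = ∑ k, (comparisonMatrix M (i.succAbove j) (i.succAbove k) +
        a / M i i * comparisonMatrix M i (i.succAbove k)) * d (i.succAbove k) := by
      simp only [add_mul, sum_add_distrib, mul_assoc, ← mul_sum]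
      field_simp
      ring
    _ ≤ _ := sum_le_sum fun k _ => mul_le_mul_of_nonneg_right
      (comparisonMatrix_add_le_schurComplement hi j k) (h.pos _).le

theorem extendByRow_self_nonneg (hi : 0 < M i i) (hrow : ∀ j, i ≠ j → M i j ≤ 0) (hq : q i ≤ 0)
    {x : Fin n → ℝ} (hx : ∀ j, 0 ≤ x j) : 0 ≤ extendByRow M q i x i := by
  have hsum : ∑ k, M i (i.succAbove k) * x k ≤ 0 := sum_nonpos fun k _ =>
    mul_nonpos_of_nonpos_of_nonneg (hrow _ (Fin.succAbove_ne i k).symm) (hx k)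
  rw [extendByRow, Fin.insertNth_apply_same, ← neg_div]
  exact div_nonneg (by linarith) hi.le

theorem kkt_extendByRow (hi : 0 < M i i) (hrow : ∀ j, i ≠ j → M i j ≤ 0) (hq : q i ≤ 0)
    (hu : u i = ⊤) {x : Fin n → ℝ}
    (h : KKT (schurComplement M i) (schurLinearTerm M q i) (fun j => u (i.succAbove j)) x) :
    KKT M q u (extendByRow M q i x) := by
  refine (Fin.forall_iff_succAbove i).2 ⟨?_, fun k => ?_⟩
  · have hgrad := gradient_extendByRow_self hi.ne' q x
    exact ⟨extendByRow_self_nonneg hi hrow hq fun k => (h k).nonneg, hu ▸ le_top,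
      fun _ => hgrad.le, fun _ => hgrad.ge⟩
  · exact (h k).congr (Fin.insertNth_apply_succAbove ..) rfl
      (gradient_extendByRow_succAbove q x k)

theorem isRay_extendByRow (hM : M.IsSymm) (hi : 0 < M i i) (hrow : ∀ j, i ≠ j → M i j ≤ 0)
    (hu : u i = ⊤) {v : Fin n → ℝ}
    (h : IsRay (schurComplement M i) (schurLinearTerm M q i) (fun j => u (i.succAbove j)) v) :
    IsRay M q u (extendByRow M 0 i v) where
  nonneg := (Fin.forall_iff_succAbove i).2
    ⟨extendByRow_self_nonneg hi hrow le_rfl h.nonneg, fun k => by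
      simpa [extendByRow] using h.nonneg k⟩
  eq_zero := (Fin.forall_iff_succAbove i).2
    ⟨fun hne => absurd hu hne, fun k => by simpa [extendByRow] using h.eq_zero k⟩
  mulVec_eq_zero := by
    rw [mulVec_extendByRow_zero hi.ne', h.mulVec_eq_zero]
    exact Fin.insertNth_eq_iff.2 ⟨rfl, rfl⟩
  dotProduct_neg := by
    suffices q ⬝ᵥ extendByRow M 0 i v = schurLinearTerm M q i ⬝ᵥ v from
      this ▸ h.dotProduct_neg
    have hcol : ∑ k, M (i.succAbove k) i / M i i * q i * v k =
        q i * (∑ k, M i (i.succAbove k) * v k) / M i i := by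
      rw [mul_sum, sum_div]
      exact sum_congr rfl fun k _ => by rw [hM.apply]; ring
    simp only [dotProduct, Fin.sum_univ_succAbove _ i, extendByRow, Fin.insertNth_apply_same,
      Fin.insertNth_apply_succAbove, schurLinearTerm, sub_mul, sum_sub_distrib, hcol,
      Pi.zero_apply, zero_add]
    ring

end SchurReduction

section Reflection

variable {n : ℕ} {M : Matrix (Fin n) (Fin n) ℝ} {q : Fin n → ℝ} {u : Fin n → WithTop ℝ}
  {i : Fin n}

/-- The signs of the variables in the reflection of the variable `x i`. -/
def reflSign (i : Fin n) : Fin n → ℝ := Function.update 1 i (-1)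

theorem reflSign_self (i : Fin n) : reflSign i i = -1 := Function.update_self ..

theorem reflSign_of_ne {j : Fin n} (h : j ≠ i) : reflSign i j = 1 := Function.update_of_ne h ..

theorem reflSign_mul_reflSign (i : Fin n) : reflSign i * reflSign i = 1 := by
  funext j
  rcases eq_or_ne j i with rfl | h
  · simp [reflSign_self]
  · simp [reflSign_of_ne h]

/-- The matrix of the program in which the variable `x i` is replaced by `c - x i`. -/
def reflectedMatrix (M : Matrix (Fin n) (Fin n) ℝ) (i : Fin n) : Matrix (Fin n) (Fin n) ℝ :=
  diagonal (reflSign i) * M * diagonal (reflSign i)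

/-- The linear term of the program in which the variable `x i` is replaced by `c - x i`. -/
def reflectedTerm (M : Matrix (Fin n) (Fin n) ℝ) (q : Fin n → ℝ) (i : Fin n) (c : ℝ) :
    Fin n → ℝ :=
  reflSign i * (q + c • M.col i)

theorem reflectedMatrix_apply (M : Matrix (Fin n) (Fin n) ℝ) (i j k : Fin n) :
    reflectedMatrix M i j k = reflSign i j * M j k * reflSign i k := by
  simp [reflectedMatrix]

theorem reflectedMatrix_mulVec (M : Matrix (Fin n) (Fin n) ℝ) (i : Fin n) (z : Fin n → ℝ) :
    reflectedMatrix M i *ᵥ z = reflSign i * (M *ᵥ (reflSign i * z)) := by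
  have hdiag : ∀ w, diagonal (reflSign i) *ᵥ w = reflSign i * w := fun w =>
    funext fun j => mulVec_diagonal ..
  rw [reflectedMatrix, ← mulVec_mulVec, ← mulVec_mulVec, hdiag, hdiag]

theorem posSemidef_reflectedMatrix (hM : M.PosSemidef) (i : Fin n) :
    (reflectedMatrix M i).PosSemidef := by
  simpa [reflectedMatrix] using hM.mul_mul_conjTranspose_same (diagonal (reflSign i))

theorem Dominates.reflect {d : Fin n → ℝ} (h : Dominates M d) (i : Fin n) :
    Dominates (reflectedMatrix M i) d := by
  have habs : ∀ k, |reflSign i k| = 1 := fun k => by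
    rw [← abs_one, abs_eq_abs, ← mul_self_eq_one_iff]
    exact congrFun (reflSign_mul_reflSign i) k
  have hentry : ∀ j k, comparisonMatrix (reflectedMatrix M i) j k = comparisonMatrix M j k := by
    intro j k
    rcases eq_or_ne j k with rfl | hjk
    · rw [comparisonMatrix_self, comparisonMatrix_self, reflectedMatrix_apply, mul_right_comm]
      simpa using congrFun (congrArg (· * M.diag) (reflSign_mul_reflSign i)) j
    · rw [comparisonMatrix_of_ne _ hjk, comparisonMatrix_of_ne _ hjk, reflectedMatrix_apply,
        abs_mul, abs_mul, habs, habs, one_mul, mul_one]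
  exact ⟨h.pos, by simpa only [hentry] using h.nonneg⟩

theorem gradient_reflect (M : Matrix (Fin n) (Fin n) ℝ) (q : Fin n → ℝ) (i : Fin n) (c : ℝ)
    (z : Fin n → ℝ) :
    gradient M q (Function.update z i (c - z i)) =
      reflSign i * gradient (reflectedMatrix M i) (reflectedTerm M q i c) z := by
  have hreflect : Function.update z i (c - z i) = c • Pi.single i 1 + reflSign i * z := by
    funext k
    rcases eq_or_ne k i with rfl | hk
    · simp [reflSign_self, sub_eq_add_neg]
    · simp [reflSign_of_ne hk, hk]
  rw [gradient, gradient, reflectedMatrix_mulVec, reflectedTerm, ← mul_add, ← mul_assoc,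
    reflSign_mul_reflSign, one_mul, hreflect, mulVec_add, mulVec_smul, mulVec_single_one]
  abel

/-- The bound `z i ≤ c`, which the reflected program drops, holds nevertheless: at `z i > c` the
gradient with respect to `x i = c - z i < 0` would be negative. -/
theorem kkt_reflect (hi : 0 < M i i) (hrow : ∀ j, i ≠ j → M i j ≤ 0) (hq : q i < 0) {c : ℝ}
    (hc : 0 < c) (hu : u i = c) {z : Fin n → ℝ}
    (h : KKT (reflectedMatrix M i) (reflectedTerm M q i c) (Function.update u i ⊤) z) :
    KKT M q u (Function.update z i (c - z i)) := by
  intro j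
  have hgrad := congrFun (gradient_reflect M q i c z) j
  rw [Pi.mul_apply] at hgrad
  rcases eq_or_ne j i with rfl | hj
  · rw [reflSign_self, neg_one_mul] at hgrad
    have hgrad_le : gradient M q (Function.update z j (c - z j)) j ≤ 0 := by
      rw [hgrad, neg_nonpos]
      exact (h j).grad_nonneg (by simp)
    have hgrad_ge : 0 < z j → 0 ≤ gradient M q (Function.update z j (c - z j)) j := fun hz => by
      rw [hgrad, neg_nonneg]
      exact (h j).grad_nonpos hz
    have hle : z j ≤ c := by
      by_contra! hlt
      refine (hgrad_ge (hc.trans hlt)).not_gt ?_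
      rw [gradient_apply, ← add_sum_erase _ _ (mem_univ j), Function.update_self]
      have hrest : ∑ k ∈ univ.erase j, M j k * Function.update z j (c - z j) k ≤ 0 :=
        sum_nonpos fun k hk => by
          rw [Function.update_of_ne (ne_of_mem_erase hk)]
          exact mul_nonpos_of_nonpos_of_nonneg (hrow k (ne_of_mem_erase hk).symm) (h k).nonneg
      have hself := mul_neg_of_pos_of_neg hi (sub_neg.2 hlt)
      linarith
    refine ⟨?_, ?_, fun _ => hgrad_le, fun hlt => hgrad_ge ?_⟩
    · simpa using hle
    · rw [Function.update_self, hu, WithTop.coe_le_coe]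
      exact sub_le_self c (h j).nonneg
    · rw [Function.update_self, hu, WithTop.coe_lt_coe] at hlt
      exact (sub_lt_self_iff c).1 hlt
  · exact (h j).congr (by simp [hj]) (by simp [hj]) (by rw [hgrad, reflSign_of_ne hj, one_mul])

theorem eq_zero_of_reflectedMatrix_mulVec_eq_zero (hi : 0 < M i i)
    (hrow : ∀ j, i ≠ j → M i j ≤ 0) {v : Fin n → ℝ} (hv : ∀ j, 0 ≤ v j)
    (h : reflectedMatrix M i *ᵥ v = 0) : v i = 0 := by
  have hterm : ∀ k ∈ univ, 0 ≤ reflectedMatrix M i i k * v k := fun k _ => by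
    refine mul_nonneg ?_ (hv k)
    rw [reflectedMatrix_apply, reflSign_self, neg_one_mul]
    rcases eq_or_ne k i with rfl | hk
    · simpa [reflSign_self] using hi.le
    · simpa [reflSign_of_ne hk] using hrow k hk.symm
  have hzero := (sum_eq_zero_iff_of_nonneg hterm).1 (congrFun h i) i (mem_univ i)
  rw [reflectedMatrix_apply, reflSign_self] at hzero
  simpa [hi.ne'] using hzero

theorem isRay_reflect (hM : M.IsSymm) (hi : 0 < M i i) (hrow : ∀ j, i ≠ j → M i j ≤ 0) {c : ℝ}
    {v : Fin n → ℝ}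
    (h : IsRay (reflectedMatrix M i) (reflectedTerm M q i c) (Function.update u i ⊤) v) :
    IsRay M q u v := by
  have hvi : v i = 0 :=
    eq_zero_of_reflectedMatrix_mulVec_eq_zero hi hrow h.nonneg h.mulVec_eq_zero
  have hsign : reflSign i * v = v := funext fun k => by
    rcases eq_or_ne k i with rfl | hk
    · simp [hvi]
    · simp [reflSign_of_ne hk]
  have hMv : M *ᵥ v = 0 := by
    have hmul := h.mulVec_eq_zero
    rw [reflectedMatrix_mulVec, hsign] at hmul
    rw [← one_mul (M *ᵥ v), ← reflSign_mul_reflSign i, mul_assoc, hmul, mul_zero]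
  refine ⟨h.nonneg, fun j hj => ?_, hMv, ?_⟩
  · rcases eq_or_ne j i with rfl | hji
    · exact hvi
    · exact h.eq_zero j (by simpa [hji] using hj)
  · suffices q ⬝ᵥ v = reflectedTerm M q i c ⬝ᵥ v from this ▸ h.dotProduct_neg
    have hcol : M.col i ⬝ᵥ v = 0 := by
      rw [← hM.eq]
      exact congrFun hMv i
    have hmove : reflectedTerm M q i c ⬝ᵥ v = (q + c • M.col i) ⬝ᵥ (reflSign i * v) :=
      sum_congr rfl fun k _ => by simp only [reflectedTerm, Pi.mul_apply]; ring
    rw [hmove, hsign, add_dotProduct, smul_dotProduct, hcol, smul_zero, add_zero]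

end Reflection

section ZeroRow

variable {n : ℕ} {M : Matrix (Fin (n + 1)) (Fin (n + 1)) ℝ} {q : Fin (n + 1) → ℝ}
  {u : Fin (n + 1) → WithTop ℝ} {i : Fin (n + 1)}

theorem kkt_insertNth_of_row_eq_zero (hM : M.IsSymm) (hrow : ∀ j, M i j = 0) {c : ℝ} (hc : 0 ≤ c)
    (hcu : (c : WithTop ℝ) ≤ u i) (hpos : 0 < c → q i ≤ 0)
    (hlt : (c : WithTop ℝ) < u i → 0 ≤ q i) {x : Fin n → ℝ}
    (h : KKT (M.submatrix i.succAbove i.succAbove) (fun j => q (i.succAbove j))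
      (fun j => u (i.succAbove j)) x) :
    KKT M q u (i.insertNth c x) := by
  refine (Fin.forall_iff_succAbove i).2 ⟨?_, fun k => (h k).congr (by simp) rfl ?_⟩
  · constructor <;> simpa [gradient_insertNth_self, hrow]
  · rw [gradient_insertNth_succAbove]
    simp [gradient, hM.apply i, hrow]

theorem isRay_insertNth_zero (hM : M.PosSemidef) {v : Fin n → ℝ}
    (h : IsRay (M.submatrix i.succAbove i.succAbove) (fun j => q (i.succAbove j))
      (fun j => u (i.succAbove j)) v) :
    IsRay M q u (i.insertNth 0 v) where
  nonneg := (Fin.forall_iff_succAbove i).2 ⟨by simp, by simpa using h.nonneg⟩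
  eq_zero := (Fin.forall_iff_succAbove i).2 ⟨by simp, by simpa using h.eq_zero⟩
  mulVec_eq_zero := by
    have hrest : ∀ k, (M *ᵥ i.insertNth 0 v) (i.succAbove k) = 0 := fun k => by
      simpa [mulVec, dotProduct, Fin.sum_univ_succAbove _ i] using congrFun h.mulVec_eq_zero k
    refine posSemidef_mulVec_eq_zero hM ?_
    simp [dotProduct, Fin.sum_univ_succAbove _ i, hrest]
  dotProduct_neg := by
    simpa [dotProduct, Fin.sum_univ_succAbove _ i] using h.dotProduct_neg

end ZeroRow

/-! ## Correctness of the parametric principal pivoting algorithm -/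

section Outcome

variable {n m : ℕ} {M : Matrix (Fin n) (Fin n) ℝ} {q : Fin n → ℝ} {u : Fin n → WithTop ℝ}

/-- The outcome is a solution of the optimality conditions, or it is reported correctly that the
objective function is unbounded from below. -/
def Resolves (M : Matrix (Fin n) (Fin n) ℝ) (q : Fin n → ℝ) (u : Fin n → WithTop ℝ)
    (o : Outcome ℝ n) : Prop :=
  (∃ x, o = .optimal x ∧ KKT M q u x) ∨ (o = .noSolution ∧ ∃ v, IsRay M q u v)

/-- The outcome for a program whose solutions are obtained by `f` from those of a reduced one. -/
def Outcome.map (f : (Fin n → ℝ) → Fin m → ℝ) : Outcome ℝ n → Outcome ℝ m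
  | .optimal x => .optimal (f x)
  | .noSolution => .noSolution
  | .failed => .failed

theorem Resolves.map {N : Matrix (Fin m) (Fin m) ℝ} {r : Fin m → ℝ} {w : Fin m → WithTop ℝ}
    {o : Outcome ℝ m} (h : Resolves N r w o) {f g : (Fin m → ℝ) → Fin n → ℝ}
    (hf : ∀ x, KKT N r w x → KKT M q u (f x)) (hg : ∀ v, IsRay N r w v → IsRay M q u (g v)) :
    Resolves M q u (o.map f) := by
  rcases h with ⟨x, rfl, hx⟩ | ⟨rfl, v, hv⟩
  · exact .inl ⟨f x, rfl, hf x hx⟩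
  · exact .inr ⟨rfl, g v, hg v hv⟩

theorem isRay_single (hM : M.IsSymm) {i : Fin n} (hrow : ∀ j, M i j = 0) (hq : q i < 0)
    (hu : u i = ⊤) : IsRay M q u (Pi.single i 1) where
  nonneg j := by rw [Pi.single_apply]; split_ifs <;> norm_num
  eq_zero j hj := Pi.single_eq_of_ne (by rintro rfl; exact hj hu) 1
  mulVec_eq_zero := by
    rw [mulVec_single_one]
    exact funext fun j => (hM.apply i j).trans (hrow j)
  dotProduct_neg := by simpa

end Outcome

section FiniteBounds

variable {n : ℕ}

/-- The number of finite upper bounds. -/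
noncomputable def finiteBounds (u : Fin n → WithTop ℝ) : ℕ := by
  classical exact #{i | u i ≠ ⊤}

theorem finiteBounds_succAbove_le (u : Fin (n + 1) → WithTop ℝ) (i : Fin (n + 1)) :
    finiteBounds (fun j => u (i.succAbove j)) ≤ finiteBounds u := by
  classical
  refine card_le_card_of_injOn i.succAbove (fun j hj => ?_) Fin.succAbove_right_injective.injOn
  simpa using hj

theorem finiteBounds_update_top {u : Fin n → WithTop ℝ} {i : Fin n} (h : u i ≠ ⊤) :
    finiteBounds (Function.update u i ⊤) < finiteBounds u := by
  classical
  refine card_lt_card ((ssubset_iff_of_subset fun j hj => ?_).2 ⟨i, by simpa, by simp⟩)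
  rcases eq_or_ne j i with rfl | hji
  · simp at hj
  · simpa [hji] using hj

end FiniteBounds

section ReduceAndPivot

theorem exists_solvesAt_lower {n : ℕ} (M : Matrix (Fin n) (Fin n) ℝ) {q p : Fin n → ℝ}
    {u : Fin n → WithTop ℝ} (hp : ∀ i, 0 ≤ p i) (hq : ∀ i, 0 < p i ∨ 0 ≤ q i)
    (hu : ∀ i, 0 ≤ u i) : ∃ T : ℝ, 0 ≤ T ∧ SolvesAt M (q + T • p) u (fun _ => .lower) 0 := by
  have hratio : ∀ i ∈ univ, 0 ≤ |q i| / p i := fun i _ => div_nonneg (abs_nonneg _) (hp i)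
  refine ⟨∑ i, |q i| / p i, sum_nonneg hratio, fun i => ⟨rfl, hu i, ?_⟩⟩
  have hle := single_le_sum hratio (mem_univ i)
  simp only [gradient, mulVec_zero, Pi.add_apply, Pi.smul_apply, smul_eq_mul, Pi.zero_apply]
  rcases hq i with hpos | hnonneg
  · rw [div_le_iff₀ hpos] at hle
    linarith [neg_abs_le (q i)]
  · linarith [mul_nonneg (sum_nonneg hratio) (hp i)]

theorem resolves_pivotLoop_lower {n : ℕ} {M : Matrix (Fin n) (Fin n) ℝ} {q d : Fin n → ℝ}
    {u : Fin n → WithTop ℝ} (hM : M.PosSemidef) (hd : Dominates M d) (hu : ∀ i, 0 ≤ u i)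
    (hq : ∀ i, 0 < paramVector M d i ∨ 0 ≤ q i) (B : Matrix (Fin n) (Fin n) ℝ)
    (hB : InverseOn M ∅ B) :
    Resolves M q u
      (pivotLoop M q u (paramVector M d) (2 * n + 1) (fun _ => .lower) B).eval := by
  obtain ⟨T, hT, hstart⟩ := exists_solvesAt_lower M hd.paramVector_nonneg hq hu
  refine .inl (eval_pivotLoop_spec hM hd _ _ _ T 0 ?_ hT hstart ?_)
  · have hempty : betweenSet (fun _ : Fin n => Status.lower) = ∅ := by
      ext i
      simp [mem_betweenSet]
    exact hempty ▸ hB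
  · simp [pivotsLeft, Status.weight, mul_comm]

variable {n : ℕ} {M : Matrix (Fin (n + 1)) (Fin (n + 1)) ℝ} {q : Fin (n + 1) → ℝ}
  {u : Fin (n + 1) → WithTop ℝ} {d : Fin (n + 1) → ℝ} {i : Fin (n + 1)}

/-- The variable `x i` has to be removed or reflected before pivoting can start. -/
def NeedsReduction (M : Matrix (Fin n) (Fin n) ℝ) (q d : Fin n → ℝ) (i : Fin n) : Prop :=
  0 < M i i → paramVector M d i ≤ 0 ∧ q i < 0

open Classical in
/-- The outcome of `reduceAndPivot` when the variable `x i` is removed or reflected first. -/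
noncomputable def reduceAt (fuel : ℕ) (M : Matrix (Fin (n + 1)) (Fin (n + 1)) ℝ)
    (q : Fin (n + 1) → ℝ) (u : Fin (n + 1) → WithTop ℝ) (d : Fin (n + 1) → ℝ)
    (i : Fin (n + 1)) : Outcome ℝ (n + 1) :=
  if 0 < M i i then
    match u i with
    | ⊤ => (reduceAndPivot fuel (schurComplement M i) (schurLinearTerm M q i)
        (fun j => u (i.succAbove j)) (fun j => d (i.succAbove j))).eval.map (extendByRow M q i)
    | (c : ℝ) => (reduceAndPivot fuel (reflectedMatrix M i) (reflectedTerm M q i c)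
        (Function.update u i ⊤) d).eval.map fun z => Function.update z i (c - z i)
  else
    match if q i < 0 then u i else 0 with
    | ⊤ => .noSolution
    | (c : ℝ) => (reduceAndPivot fuel (M.submatrix i.succAbove i.succAbove)
        (fun j => q (i.succAbove j)) (fun j => u (i.succAbove j))
        (fun j => d (i.succAbove j))).eval.map fun x => i.insertNth c x

theorem ite_neg_eq_reflectedMatrix {n : ℕ} (M : Matrix (Fin n) (Fin n) ℝ) (i : Fin n) :
    (fun j k => if (j = i ∧ k ≠ i) ∨ (j ≠ i ∧ k = i) then -M j k else M j k) =
      reflectedMatrix M i := by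
  funext j k
  rw [reflectedMatrix_apply]
  by_cases hj : j = i <;> by_cases hk : k = i <;> simp [reflSign, hj, hk]

theorem ite_neg_eq_reflectedTerm {n : ℕ} (M : Matrix (Fin n) (Fin n) ℝ) (q : Fin n → ℝ)
    (i : Fin n) (c : ℝ) :
    (fun j => if j = i then -(q j + M j i * c) else q j + M j i * c) = reflectedTerm M q i c := by
  funext j
  by_cases hj : j = i <;> simp [reflectedTerm, reflSign, hj, mul_comm c]

open Classical in
theorem eval_reduceAndPivot (fuel : ℕ) (M : Matrix (Fin (n + 1)) (Fin (n + 1)) ℝ)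
    (q : Fin (n + 1) → ℝ) (u : Fin (n + 1) → WithTop ℝ) (d : Fin (n + 1) → ℝ) :
    (reduceAndPivot (fuel + 1) M q u d).eval =
      (Fin.find? fun i => decide (NeedsReduction M q d i)).elim
        (pivotLoop M q u (paramVector M d) (2 * (n + 1) + 1) (fun _ => .lower) fun _ _ => 0).eval
        (reduceAt fuel M q u d) := by
  have hcond : ∀ i, (do
      if ← isPos (M i i) then
        if ← isPos (paramVector M d i) then pure false else isNeg (q i)
      else pure true : Prog ℝ Bool).eval = decide (NeedsReduction M q d i) := fun i => by
    by_cases hM : 0 < M i i <;> by_cases hp : 0 < paramVector M d i <;>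
      simp [NeedsReduction, hM, hp, not_lt.1]
  simp only [reduceAndPivot, eval_bind, eval_parametricVector, eval_findFirst, hcond]
  rcases Fin.find? fun i => decide (NeedsReduction M q d i) with _ | i
  · simp
  · have hschur : (fun j k => M (i.succAbove j) (i.succAbove k) -
        M (i.succAbove j) i * M i (i.succAbove k) / M i i) = schurComplement M i := rfl
    have hterm : (fun j => q (i.succAbove j) - M (i.succAbove j) i / M i i * q i) =
        schurLinearTerm M q i := rfl
    have hminor : (fun j k => M (i.succAbove j) (i.succAbove k)) =
        M.submatrix i.succAbove i.succAbove := rfl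
    simp only [Option.elim, eval_bind, eval_isPos, decide_eq_true_eq, reduceAt, hminor]
    split_ifs with hi hq
    · rcases u i with _ | c
      · simp only [eval_bind, eval_tab2, eval_tab, eval_sub, eval_mul, eval_div, hschur, hterm]
        split <;> simp [*, Outcome.map, extendByRow]
      · simp only [eval_bind, eval_tab2, eval_tab, eval_ite, eval_neg, eval_pure, eval_add,
          eval_mul, ite_neg_eq_reflectedMatrix, ite_neg_eq_reflectedTerm]
        split <;> simp [*, Outcome.map]
    · simp only [eval_bind, eval_isNeg, decide_eq_true_eq, hq, if_true]
      rcases u i with _ | c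
      · rfl
      · simp only [eval_bind, eval_pure]
        split <;> simp [*, Outcome.map]
    · simp only [eval_bind, eval_isNeg, decide_eq_true_eq, hq, if_false, eval_pure, eval_lit]
      split <;> simp [*, Outcome.map]

theorem Resolves.reduce_schurComplement (hM : M.IsSymm) (hi : 0 < M i i)
    (hrow : ∀ j, i ≠ j → M i j ≤ 0) (hq : q i < 0) (hu : u i = ⊤) {o : Outcome ℝ n}
    (h : Resolves (schurComplement M i) (schurLinearTerm M q i) (fun j => u (i.succAbove j)) o) :
    Resolves M q u (o.map (extendByRow M q i)) :=
  h.map (fun _ hx => kkt_extendByRow hi hrow hq.le hu hx) fun _ hv =>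
    isRay_extendByRow hM hi hrow hu hv

theorem Resolves.reduce_reflect {n : ℕ} {M : Matrix (Fin n) (Fin n) ℝ} {q : Fin n → ℝ}
    {u : Fin n → WithTop ℝ} {i : Fin n} (hM : M.IsSymm) (hi : 0 < M i i)
    (hrow : ∀ j, i ≠ j → M i j ≤ 0) (hq : q i < 0) {c : ℝ} (hc : 0 < c) (hu : u i = c)
    {o : Outcome ℝ n}
    (h : Resolves (reflectedMatrix M i) (reflectedTerm M q i c) (Function.update u i ⊤) o) :
    Resolves M q u (o.map fun z => Function.update z i (c - z i)) :=
  h.map (fun _ hz => kkt_reflect hi hrow hq hc hu hz) fun _ hv => isRay_reflect hM hi hrow hv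

theorem Resolves.reduce_zeroRow (hM : M.PosSemidef) (hi : M i i = 0) {c : ℝ} (hc : 0 ≤ c)
    (hcu : (c : WithTop ℝ) ≤ u i) (hpos : 0 < c → q i ≤ 0)
    (hlt : (c : WithTop ℝ) < u i → 0 ≤ q i) {o : Outcome ℝ n}
    (h : Resolves (M.submatrix i.succAbove i.succAbove) (fun j => q (i.succAbove j))
      (fun j => u (i.succAbove j)) o) :
    Resolves M q u (o.map fun x => i.insertNth c x) :=
  h.map (fun _ hx => kkt_insertNth_of_row_eq_zero (posSemidef_isSymm hM)
    (posSemidef_row_eq_zero hM hi) hc hcu hpos hlt hx) fun _ hv => isRay_insertNth_zero hM hv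

theorem resolves_reduceAt {fuel : ℕ}
    (ih : ∀ {m : ℕ} {N : Matrix (Fin m) (Fin m) ℝ} (r : Fin m → ℝ) {w : Fin m → WithTop ℝ}
      {e : Fin m → ℝ}, N.PosSemidef → Dominates N e → (∀ i, 0 < w i) →
      m + finiteBounds w + 1 ≤ fuel → Resolves N r w (reduceAndPivot fuel N r w e).eval)
    (hM : M.PosSemidef) (hd : Dominates M d) (hu : ∀ i, 0 < u i)
    (hf : n + 1 + finiteBounds u ≤ fuel) (hi : NeedsReduction M q d i) :
    Resolves M q u (reduceAt fuel M q u d i) := by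
  classical
  have hsymm := posSemidef_isSymm hM
  have hbounds := finiteBounds_succAbove_le u i
  rw [reduceAt]
  split_ifs with hii hq
  · obtain ⟨hp, hq⟩ := hi hii
    have hrow : ∀ j, i ≠ j → M i j ≤ 0 := fun j =>
      hd.nonpos_of_paramVector_eq_zero (hp.antisymm (hd.paramVector_nonneg i))
    rcases hui : u i with _ | c
    · exact (ih _ (posSemidef_schurComplement hM hii.ne') (hd.schurComplement hii)
        (fun j => hu _) (by omega)).reduce_schurComplement hsymm hii hrow hq hui
    · have hc : u i = c := hui
      have hfewer := finiteBounds_update_top (u := u) (hc ▸ WithTop.coe_ne_top)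
      refine (ih _ (posSemidef_reflectedMatrix hM i) (hd.reflect i) (fun j => ?_)
        (by omega)).reduce_reflect hsymm hii hrow hq (WithTop.coe_pos.1 (hc ▸ hu i)) hc
      rcases eq_or_ne j i with rfl | hj
      · simp
      · simpa [hj] using hu j
  all_goals
    have hzero : M i i = 0 := (not_lt.1 hii).antisymm hM.diag_nonneg
    have hrec := ih (fun j => q (i.succAbove j)) (w := fun j => u (i.succAbove j))
      (hM.submatrix i.succAbove) (hd.submatrix_succAbove i) (fun j => hu _) (by omega)
  · rcases hui : u i with _ | c
    · exact .inr ⟨rfl, _, isRay_single hsymm (posSemidef_row_eq_zero hM hzero) hq hui⟩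
    · have hc : u i = c := hui
      exact hrec.reduce_zeroRow hM hzero (WithTop.coe_pos.1 (hc ▸ hu i)).le hc.ge
        (fun _ => hq.le) fun hlt => absurd hc hlt.ne'
  · exact hrec.reduce_zeroRow hM hzero le_rfl (hu i).le (fun h => absurd h (lt_irrefl _))
      fun _ => not_lt.1 hq

theorem eval_reduceAndPivot_spec : ∀ (fuel : ℕ) {n : ℕ} {M : Matrix (Fin n) (Fin n) ℝ}
    (q : Fin n → ℝ) {u : Fin n → WithTop ℝ} {d : Fin n → ℝ}, M.PosSemidef → Dominates M d →
    (∀ i, 0 < u i) → n + finiteBounds u + 1 ≤ fuel →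
    Resolves M q u (reduceAndPivot fuel M q u d).eval
  | 0, _, _, _, _, _, _, _, _, hf => by omega
  | _ + 1, 0, _, _, _, _, _, _, _, _ => .inl ⟨_, rfl, fun i => i.elim0⟩
  | fuel + 1, n + 1, M, q, u, d, hM, hd, hu, hf => by
    classical
    rw [eval_reduceAndPivot]
    rcases hfind : Fin.find? fun i => decide (NeedsReduction M q d i) with _ | i
    · have hready : ∀ i, 0 < paramVector M d i ∨ 0 ≤ q i := fun i => by
        have hi := Fin.find?_eq_none_iff.1 hfind i
        rw [decide_eq_false_iff_not, NeedsReduction, Classical.not_imp, not_and_or] at hi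
        exact hi.2.imp not_le.1 not_lt.1
      exact resolves_pivotLoop_lower hM hd (fun i => (hu i).le) hready _ inverseOn_empty
    · exact resolves_reduceAt (eval_reduceAndPivot_spec fuel) hM hd hu (by omega)
        (by simpa using (Fin.find?_eq_some_iff.1 hfind).1)

theorem eval_pppa_spec {n : ℕ} {M : Matrix (Fin n) (Fin n) ℝ} (q : Fin n → ℝ)
    {u : Fin n → WithTop ℝ} (hM : M.PosSemidef) (hC : (comparisonMatrix M).PosSemidef)
    (hu : ∀ i, 0 < u i) : Resolves M q u (pppa M q u).eval := by
  classical
  simp only [pppa, eval_bind, eval_comparison]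
  refine eval_reduceAndPivot_spec _ q hM (dominates_dominanceVector hC) hu ?_
  have hcard : finiteBounds u ≤ n := (card_le_univ _).trans_eq (Fintype.card_fin n)
  omega

end ReduceAndPivot

/-! ## Systems of linear inequalities in two variables -/

section LoopList

variable {K α β σ : Type} [Field K] [LinearOrder K]

theorem loopList_induction {f : σ → α → Prog K σ} (P : List α → σ → Prop) {s : σ} (h₀ : P [] s)
    (hstep : ∀ l a t, P l t → P (l ++ [a]) (f t a).eval) (L : List α) :
    P L (loopList L s f).eval := by
  suffices ∀ (L l : List α) (t : σ), P l t → P (l ++ L) (loopList L t f).eval by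
    simpa using this L [] s h₀
  intro L
  induction L with
  | nil => intro l t ht; simpa [loopList] using ht
  | cons a L ih =>
    intro l t ht
    simpa [loopList] using ih (l ++ [a]) _ (hstep l a t ht)

theorem mem_eval_loopList {f : List β → α → Prog K (List β)} {p : α → β → Prop}
    (hf : ∀ acc a b, b ∈ (f acc a).eval ↔ b ∈ acc ∨ p a b) (L : List α) (acc : List β) (b : β) :
    b ∈ (loopList L acc f).eval ↔ b ∈ acc ∨ ∃ a ∈ L, p a b :=
  loopList_induction (fun l acc' => b ∈ acc' ↔ b ∈ acc ∨ ∃ a ∈ l, p a b) (by simp)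
    (fun l a t ht => by simp [hf, ht, or_assoc, or_and_right, exists_or]) L

end LoopList

section OneVariable

/-- The lower bounds on a number `t` that the inequalities `a t + c ≥ 0` give, for `(a, c)` in the
list. -/
def lowerRatios (L : List (ℝ × ℝ)) : Set ℝ :=
  {r | ∃ e ∈ L, 0 < e.1 ∧ r = -(e.2 / e.1)}

/-- The upper bounds on a number `t` that the inequalities `a t + c ≥ 0` give, for `(a, c)` in the
list. -/
def upperRatios (L : List (ℝ × ℝ)) : Set ℝ :=
  {r | ∃ e ∈ L, e.1 < 0 ∧ r = -(e.2 / e.1)}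

theorem forall_nonneg_iff (L : List (ℝ × ℝ)) (t : ℝ) :
    (∀ e ∈ L, 0 ≤ e.1 * t + e.2) ↔ t ∈ upperBounds (lowerRatios L) ∧
      t ∈ lowerBounds (upperRatios L) ∧ ∀ e ∈ L, e.1 = 0 → 0 ≤ e.2 := by
  constructor
  · refine fun h => ⟨?_, ?_, fun e he h0 => by simpa [h0] using h e he⟩
    · rintro _ ⟨e, he, hpos, rfl⟩
      rw [neg_le, le_div_iff₀ hpos]
      linarith [h e he]
    · rintro _ ⟨e, he, hneg, rfl⟩
      rw [le_neg, div_le_iff_of_neg hneg]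
      linarith [h e he]
  · rintro ⟨hlower, hupper, hzero⟩ e he
    rcases lt_trichotomy e.1 0 with hneg | h0 | hpos
    · have hle := hupper ⟨e, he, hneg, rfl⟩
      rw [le_neg, div_le_iff_of_neg hneg] at hle
      linarith
    · simpa [h0] using hzero e he h0
    · have hle := hlower ⟨e, he, hpos, rfl⟩
      rw [neg_le, le_div_iff₀ hpos] at hle
      linarith

theorem finite_lowerRatios (L : List (ℝ × ℝ)) : (lowerRatios L).Finite :=
  (L.finite_toSet.image fun e => -(e.2 / e.1)).subset
    fun _ ⟨e, he, _, hr⟩ => ⟨e, he, hr.symm⟩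

theorem finite_upperRatios (L : List (ℝ × ℝ)) : (upperRatios L).Finite :=
  (L.finite_toSet.image fun e => -(e.2 / e.1)).subset
    fun _ ⟨e, he, _, hr⟩ => ⟨e, he, hr.symm⟩

theorem exists_mem_upperBounds_lowerBounds {s t : Set ℝ} (hs : s.Finite) (ht : t.Finite)
    (h : ∀ a ∈ s, ∀ b ∈ t, a ≤ b) : ∃ z, z ∈ upperBounds s ∧ z ∈ lowerBounds t := by
  rcases s.eq_empty_or_nonempty with rfl | hs'
  · obtain ⟨z, hz⟩ := ht.bddBelow
    exact ⟨z, by simp, hz⟩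
  rcases t.eq_empty_or_nonempty with rfl | ht'
  · obtain ⟨z, hz⟩ := hs.bddAbove
    exact ⟨z, hz, by simp⟩
  exact exists_between_of_forall_le hs' ht' h

/-- The recorded value is the largest element of `S`; none is recorded if `S` is empty. -/
def IsMaximum (S : Set ℝ) (o : Option (ℝ × Unit)) : Prop :=
  o.elim (S = ∅) fun b => IsGreatest S b.1

/-- The recorded value is the smallest element of `S`; none is recorded if `S` is empty. -/
def IsMinimum (S : Set ℝ) (o : Option (ℝ × Unit)) : Prop :=
  o.elim (S = ∅) fun b => IsLeast S b.1

theorem IsMaximum.keepMax {S : Set ℝ} {o : Option (ℝ × Unit)} (h : IsMaximum S o) (r : ℝ) :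
    IsMaximum (insert r S) (keepMax o r ()).eval := by
  rcases o with _ | b
  · obtain rfl : S = ∅ := h
    simp [IsMaximum, BoundedQP.keepMax, isGreatest_singleton]
  · have hmax := IsGreatest.insert r h
    by_cases hlt : b.1 < r
    · simpa [IsMaximum, BoundedQP.keepMax, hlt, max_eq_left hlt.le] using hmax
    · simpa [IsMaximum, BoundedQP.keepMax, hlt, max_eq_right (not_lt.1 hlt)] using hmax

theorem IsMinimum.keepMin {S : Set ℝ} {o : Option (ℝ × Unit)} (h : IsMinimum S o) (r : ℝ) :
    IsMinimum (insert r S) (keepMin o r ()).eval := by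
  rcases o with _ | b
  · obtain rfl : S = ∅ := h
    simp [IsMinimum, BoundedQP.keepMin, isLeast_singleton]
  · have hmin := IsLeast.insert r h
    by_cases hlt : r < b.1
    · simpa [IsMinimum, BoundedQP.keepMin, hlt, min_eq_left hlt.le] using hmin
    · simpa [IsMinimum, BoundedQP.keepMin, hlt, min_eq_right (not_lt.1 hlt)] using hmin

theorem lowerRatios_concat (L : List (ℝ × ℝ)) (e : ℝ × ℝ) : lowerRatios (L ++ [e]) =
    if 0 < e.1 then insert (-(e.2 / e.1)) (lowerRatios L) else lowerRatios L := by
  ext r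
  split_ifs with h <;> simp [lowerRatios, h, or_and_right, exists_or, or_comm]

theorem upperRatios_concat (L : List (ℝ × ℝ)) (e : ℝ × ℝ) : upperRatios (L ++ [e]) =
    if e.1 < 0 then insert (-(e.2 / e.1)) (upperRatios L) else upperRatios L := by
  ext r
  split_ifs with h <;> simp [upperRatios, h, or_and_right, exists_or, or_comm]

/-- The value that is tried for `t`, given the largest lower bound and the smallest upper bound. -/
def candidate : Option (ℝ × Unit) × Option (ℝ × Unit) → ℝ
  | (some lo, _) => lo.1
  | (none, some hi) => hi.1
  | (none, none) => 0

theorem forall_nonneg_candidate {L : List (ℝ × ℝ)} {s : Option (ℝ × Unit) × Option (ℝ × Unit)}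
    (hlower : IsMaximum (lowerRatios L) s.1) (hupper : IsMinimum (upperRatios L) s.2)
    (h : ∃ t, ∀ e ∈ L, 0 ≤ e.1 * t + e.2) : ∀ e ∈ L, 0 ≤ e.1 * candidate s + e.2 := by
  simp only [forall_nonneg_iff] at h ⊢
  obtain ⟨t, ht_lower, ht_upper, hzero⟩ := h
  refine ⟨?_, ?_, hzero⟩
  · rcases s with ⟨_ | lo, hi⟩
    · simp [show lowerRatios L = ∅ from hlower]
    · exact hlower.2
  · rcases s with ⟨_ | lo, _ | hi⟩
    · simp [show upperRatios L = ∅ from hupper]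
    · exact hupper.2
    · simp [show upperRatios L = ∅ from hupper]
    · exact fun r hr => (ht_lower hlower.1).trans (ht_upper hr)

open Classical in
theorem eval_solveOneVar (L : List (ℝ × ℝ)) : ∃ s, IsMaximum (lowerRatios L) s.1 ∧
    IsMinimum (upperRatios L) s.2 ∧ (solveOneVar L).eval =
      if ∀ e ∈ L, 0 ≤ e.1 * candidate s + e.2 then some (candidate s) else none := by
  have hcheck : ∀ t : ℝ, (loopList (K := ℝ) L true fun ok e => do
      if ← isNeg (← add (← mul e.1 t) e.2) then pure false else pure ok).eval = true ↔
        ∀ e ∈ L, 0 ≤ e.1 * t + e.2 := fun t => by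
    refine loopList_induction (K := ℝ) (s := true) (fun l (ok : Bool) => ok = true ↔
      ∀ e ∈ l, 0 ≤ e.1 * t + e.2) (by simp) (fun l e ok hok => ?_) L
    simp only [List.forall_mem_append, List.forall_mem_singleton, ← hok]
    by_cases h : e.1 * t + e.2 < 0
    · simp [h]
    · simp [h, not_lt.1 h]
  simp only [solveOneVar, eval_bind, eval_lit, Nat.cast_zero, eval_pure]
  generalize hbounds : (loopList (K := ℝ) L
    ((none, none) : Option (ℝ × Unit) × Option (ℝ × Unit)) _).eval = s
  have hs : IsMaximum (lowerRatios L) s.1 ∧ IsMinimum (upperRatios L) s.2 := by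
    rw [← hbounds]
    refine loopList_induction
      (fun l (s : Option (ℝ × Unit) × Option (ℝ × Unit)) =>
        IsMaximum (lowerRatios l) s.1 ∧ IsMinimum (upperRatios l) s.2)
      ⟨by simp [IsMaximum, lowerRatios], by simp [IsMinimum, upperRatios]⟩ ?_ L
    rintro l e s ⟨hlower, hupper⟩
    simp only [lowerRatios_concat, upperRatios_concat]
    rcases lt_trichotomy e.1 0 with hneg | h0 | hpos
    · simpa [hneg, hneg.not_gt] using ⟨hlower, hupper.keepMin _⟩
    · simpa [h0] using ⟨hlower, hupper⟩
    · simpa [hpos, hpos.not_gt] using ⟨hlower.keepMax _, hupper⟩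
  refine ⟨s, hs.1, hs.2, ?_⟩
  rcases s with ⟨_ | lo, _ | hi⟩ <;> simp [hcheck, candidate]

theorem eval_solveOneVar_spec {L : List (ℝ × ℝ)} {t : ℝ} (h : (solveOneVar L).eval = some t) :
    ∀ e ∈ L, 0 ≤ e.1 * t + e.2 := by
  classical
  obtain ⟨s, -, -, heval⟩ := eval_solveOneVar L
  rw [heval, Option.ite_none_right_eq_some] at h
  exact (Option.some.inj h.2) ▸ h.1

theorem exists_eval_solveOneVar {L : List (ℝ × ℝ)} (h : ∃ t, ∀ e ∈ L, 0 ≤ e.1 * t + e.2) :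
    ∃ t, (solveOneVar L).eval = some t := by
  classical
  obtain ⟨s, hlower, hupper, heval⟩ := eval_solveOneVar L
  exact ⟨candidate s, heval.trans (if_pos (forall_nonneg_candidate hlower hupper h))⟩

end OneVariable

section TwoVariables

/-- The combination of two inequalities `a y + b z + c ≥ 0`, given by `e` and `f` as `(a, b, c)`,
in which the multiples of `z` cancel. It follows from them if `e.2.1 > 0 > f.2.1`. -/
def cancelSecond (e f : ℝ × ℝ × ℝ) : ℝ × ℝ :=
  (e.2.1 * f.1 - f.2.1 * e.1, e.2.1 * f.2.2 - f.2.1 * e.2.2)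

/-- The inequalities in `y` that are left by the elimination of `z` from the inequalities
`a y + b z + c ≥ 0`, for `(a, b, c)` in the list. -/
def fourierMotzkin (L : List (ℝ × ℝ × ℝ)) : Set (ℝ × ℝ) :=
  {g | (∃ e ∈ L, e.2.1 = 0 ∧ g = (e.1, e.2.2)) ∨
    ∃ e ∈ L, 0 < e.2.1 ∧ ∃ f ∈ L, f.2.1 < 0 ∧ g = cancelSecond e f}

theorem exists_forall_nonneg_iff_fourierMotzkin (L : List (ℝ × ℝ × ℝ)) (y : ℝ) :
    (∃ z, ∀ e ∈ L, 0 ≤ e.1 * y + e.2.1 * z + e.2.2) ↔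
      ∀ g ∈ fourierMotzkin L, 0 ≤ g.1 * y + g.2 := by
  constructor
  · rintro ⟨z, hz⟩ g (⟨e, he, h0, rfl⟩ | ⟨e, he, hpos, f, hf, hneg, rfl⟩)
    · simpa [h0] using hz e he
    · have hf' := mul_nonneg hpos.le (hz f hf)
      have he' := mul_nonneg (neg_nonneg.2 hneg.le) (hz e he)
      dsimp only [cancelSecond]
      linarith
  · intro h
    let S : List (ℝ × ℝ) := L.map fun e => (e.2.1, e.1 * y + e.2.2)
    have hgap : ∀ a ∈ lowerRatios S, ∀ b ∈ upperRatios S, a ≤ b := by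
      rintro _ ⟨_, he', hpos, rfl⟩ _ ⟨_, hf', hneg, rfl⟩
      obtain ⟨e, he, rfl⟩ := List.mem_map.1 he'
      obtain ⟨f, hf, rfl⟩ := List.mem_map.1 hf'
      have hg := h _ (.inr ⟨e, he, hpos, f, hf, hneg, rfl⟩)
      rw [neg_le_neg_iff, le_div_iff₀ hpos, div_mul_eq_mul_div, div_le_iff_of_neg hneg]
      dsimp only [cancelSecond] at hg ⊢
      linarith
    obtain ⟨z, hlower, hupper⟩ :=
      exists_mem_upperBounds_lowerBounds (finite_lowerRatios S) (finite_upperRatios S) hgap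
    have hz := (forall_nonneg_iff S z).2 ⟨hlower, hupper, fun _ he' h0 => ?_⟩
    · refine ⟨z, fun e he => ?_⟩
      have := hz _ (List.mem_map.2 ⟨e, he, rfl⟩)
      linarith
    · obtain ⟨e, he, rfl⟩ := List.mem_map.1 he'
      exact h _ (.inl ⟨e, he, h0, rfl⟩)

theorem eval_solveTwoVar (L : List (ℝ × ℝ × ℝ)) : ∃ (E : List (ℝ × ℝ)) (R : ℝ → List (ℝ × ℝ)),
    (∀ g, g ∈ E ↔ g ∈ fourierMotzkin L) ∧
      (∀ y g, g ∈ R y ↔ ∃ e ∈ L, g = (e.2.1, e.1 * y + e.2.2)) ∧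
      (solveTwoVar L).eval =
        (solveOneVar E).eval.bind fun y => (solveOneVar (R y)).eval.map fun z => (y, z) := by
  simp only [solveTwoVar, eval_bind]
  generalize hparts : (loopList (K := ℝ) L
    (([], [], []) : List (ℝ × ℝ × ℝ) × List (ℝ × ℝ × ℝ) × List (ℝ × ℝ)) _).eval = parts
  have hsign : parts = ((L.filter fun e => 0 < e.2.1).reverse,
      (L.filter fun e => e.2.1 < 0).reverse,
      ((L.filter fun e => e.2.1 = 0).map fun e => (e.1, e.2.2)).reverse) := by
    rw [← hparts]
    refine loopList_induction (fun l (s : List (ℝ × ℝ × ℝ) × List (ℝ × ℝ × ℝ) × List (ℝ × ℝ)) =>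
      s = ((l.filter fun e => 0 < e.2.1).reverse, (l.filter fun e => e.2.1 < 0).reverse,
        ((l.filter fun e => e.2.1 = 0).map fun e => (e.1, e.2.2)).reverse)) rfl ?_ L
    rintro l e _ rfl
    rcases lt_trichotomy e.2.1 0 with hneg | h0 | hpos
    · simp [hneg, hneg.not_gt, hneg.ne]
    · simp [h0]
    · simp [hpos, hpos.not_gt, hpos.ne']
  generalize hE : (loopList (K := ℝ) parts.1 parts.2.2 _).eval = E
  refine ⟨E, fun y => (loopList (K := ℝ) L [] fun acc e => do
    pure ((e.2.1, ← add (← mul e.1 y) e.2.2) :: acc)).eval, fun g => ?_, fun y g => ?_, ?_⟩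
  · rw [← hE, mem_eval_loopList (p := fun e g => ∃ f ∈ parts.2.1, g = cancelSecond e f),
      hsign]
    · simp [fourierMotzkin, and_assoc, eq_comm]
    · intro acc e g
      exact mem_eval_loopList (p := fun f g => g = cancelSecond e f)
        (by simp [cancelSecond, or_comm]) _ _ _
  · rw [mem_eval_loopList (p := fun e g => g = (e.2.1, e.1 * y + e.2.2)) (by simp [or_comm])]
    simp
  · rcases (solveOneVar E).eval with _ | y
    · rfl
    · simp only [eval_bind, Option.bind_some]
      split <;> simp [*]

theorem eval_solveTwoVar_spec {L : List (ℝ × ℝ × ℝ)} {y z : ℝ}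
    (h : (solveTwoVar L).eval = some (y, z)) : ∀ e ∈ L, 0 ≤ e.1 * y + e.2.1 * z + e.2.2 := by
  obtain ⟨E, R, -, hR, heval⟩ := eval_solveTwoVar L
  simp only [heval, Option.bind_eq_some_iff, Option.map_eq_some_iff, Prod.mk.injEq] at h
  obtain ⟨_, -, _, hz, rfl, rfl⟩ := h
  intro e he
  have := eval_solveOneVar_spec hz _ ((hR _ _).2 ⟨e, he, rfl⟩)
  linarith

theorem exists_eval_solveTwoVar {L : List (ℝ × ℝ × ℝ)}
    (h : ∃ y z, ∀ e ∈ L, 0 ≤ e.1 * y + e.2.1 * z + e.2.2) :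
    ∃ y z, (solveTwoVar L).eval = some (y, z) := by
  obtain ⟨E, R, hE, hR, heval⟩ := eval_solveTwoVar L
  simp only [exists_forall_nonneg_iff_fourierMotzkin, ← hE] at h
  obtain ⟨y, hy⟩ := exists_eval_solveOneVar h
  have hyE := eval_solveOneVar_spec hy
  simp only [hE, ← exists_forall_nonneg_iff_fourierMotzkin] at hyE
  obtain ⟨z₀, hz₀⟩ := hyE
  obtain ⟨z, hz⟩ := exists_eval_solveOneVar (L := R y) ⟨z₀, fun g hg => by
    obtain ⟨e, he, rfl⟩ := (hR _ _).1 hg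
    linarith [hz₀ e he]⟩
  exact ⟨y, z, by simp [heval, hy, hz]⟩

end TwoVariables
/-! ## The irreducible diagonal blocks -/

section Blocks

variable {n : ℕ} {M B : Matrix (Fin n) (Fin n) ℝ} {R : Fin n → Fin n → Bool} {s : Finset (Fin n)}
  {i j k : Fin n}

/-- The invariant of Warshall's algorithm: `R` holds between indices that are joined by a path of
nonzero entries of `M` with all inner indices below `m`, and only between indices in the same
irreducible diagonal block. For `m = n` it is the partition of the indices into these blocks. -/
structure IsPathRelation (M : Matrix (Fin n) (Fin n) ℝ) (m : ℕ) (R : Fin n → Fin n → Bool) :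
    Prop where
  refl : ∀ i, R i i
  symm : ∀ i j, R i j → R j i
  edge : ∀ i j, M i j ≠ 0 → R i j
  connected : ∀ Z : Fin n → Prop, (∀ i j, M i j ≠ 0 → Z i → Z j) → ∀ i j, R i j → Z i → Z j
  trans_of_lt : ∀ k : Fin n, k < m → ∀ i j, R i k → R k j → R i j

theorem IsPathRelation.trans (h : IsPathRelation M n R) (hij : R i j) (hjk : R j k) : R i k :=
  h.trans_of_lt j j.2 i k hij hjk

theorem isPathRelation_zero (hM : M.IsSymm) :
    IsPathRelation M 0 fun i j => decide (i = j ∨ M i j ≠ 0) where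
  refl i := by simp
  symm i j h := by simpa [eq_comm (a := j), hM.apply] using h
  edge i j h := by simp [h]
  connected Z hZ i j h hi := by
    rcases of_decide_eq_true h with rfl | h
    exacts [hi, hZ i j h hi]
  trans_of_lt k hk := absurd hk (Nat.not_lt_zero _)

theorem IsPathRelation.succ (h : IsPathRelation M k R) :
    IsPathRelation M (k + 1) fun i j => R i j || (R i k && R k j) := by
  refine ⟨fun i => by simp [h.refl], fun i j hij => ?_, fun i j hij => by simp [h.edge i j hij],
    fun Z hZ i j hij hi => ?_, fun l hl i j hil hlj => ?_⟩
  all_goals simp only [Bool.or_eq_true, Bool.and_eq_true] at *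
  · exact hij.imp (h.symm i j) fun hikj => ⟨h.symm k j hikj.2, h.symm i k hikj.1⟩
  · rcases hij with hij | ⟨hik, hkj⟩
    exacts [h.connected Z hZ i j hij hi,
      h.connected Z hZ k j hkj (h.connected Z hZ i k hik hi)]
  · rcases Nat.lt_succ_iff_lt_or_eq.1 hl with hlk | hlk
    · have := h.trans_of_lt l hlk
      grind
    · obtain rfl : l = k := Fin.ext hlk
      grind

theorem isPathRelation_eval_sameBlock (hM : M.IsSymm) : IsPathRelation M n (sameBlock M).eval := by
  simp only [sameBlock, eval_bind]
  refine loop_induction (IsPathRelation M) ?_ fun k R hR => by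
    simpa only [eval_tab2, eval_pure] using hR.succ
  convert isPathRelation_zero hM using 3 with i j
  simp only [eval_tab2, eval_ite, eval_pure, eval_bind, eval_isPos, eval_isNeg, decide_eq_true_eq]
  grind

theorem abs_dotProduct_comparisonMatrix_mulVec_abs_le (M : Matrix (Fin n) (Fin n) ℝ)
    (x : Fin n → ℝ) :
    (fun i => |x i|) ⬝ᵥ comparisonMatrix M *ᵥ (fun i => |x i|) ≤ x ⬝ᵥ M *ᵥ x := by
  simp only [dotProduct, mulVec, mul_sum]
  refine sum_le_sum fun i _ => sum_le_sum fun j _ => ?_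
  rcases eq_or_ne i j with rfl | hij
  · rw [comparisonMatrix_self]
    linear_combination M i i * abs_mul_abs_self (x i)
  · have hterm := neg_abs_le (x i * (M i j * x j))
    rw [abs_mul, abs_mul] at hterm
    rw [comparisonMatrix_of_ne M hij]
    linarith

theorem mulVec_eq_zero_of_posSemidef_submatrix {A : Matrix (Fin (n + 1)) (Fin (n + 1)) ℝ}
    {i j : Fin (n + 1)} (hA : (A.submatrix i.succAbove i.succAbove).PosSemidef)
    {y : Fin (n + 1) → ℝ} (hi : y i = 0) (hy : y ⬝ᵥ A *ᵥ y ≤ 0) (hj : j ≠ i) :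
    (A *ᵥ y) j = 0 := by
  have hrow : ∀ k, (A.submatrix i.succAbove i.succAbove *ᵥ fun k => y (i.succAbove k)) k =
      (A *ᵥ y) (i.succAbove k) := fun k => by
    simp [mulVec, dotProduct, Fin.sum_univ_succAbove _ i, hi]
  obtain ⟨k, rfl⟩ := Fin.exists_succAbove_eq hj
  rw [← hrow, posSemidef_mulVec_eq_zero hA, Pi.zero_apply]
  simp only [dotProduct, hrow]
  simpa [dotProduct, Fin.sum_univ_succAbove _ i, hi] using hy

/-- The indices where `x` vanishes are closed under nonzero entries of `M`, since `|x|` lies in the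
kernel of the comparison matrix. -/
theorem eq_zero_of_dotProduct_mulVec_eq_zero {M : Matrix (Fin (n + 1)) (Fin (n + 1)) ℝ}
    (hC : ∀ i : Fin (n + 1), (comparisonMatrix (M.submatrix i.succAbove i.succAbove)).PosSemidef)
    {m : ℕ} {R : Fin (n + 1) → Fin (n + 1) → Bool} (hR : IsPathRelation M m R)
    {b₁ b₂ k : Fin (n + 1)} (hb : b₁ ≠ b₂) {x : Fin (n + 1) → ℝ} (hx₁ : x b₁ = 0) (hx₂ : x b₂ = 0)
    (hx : x ⬝ᵥ M *ᵥ x = 0) (hk : R b₁ k) : x k = 0 := by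
  simp only [comparisonMatrix_submatrix M Fin.succAbove_right_injective] at hC
  have hquad := (abs_dotProduct_comparisonMatrix_mulVec_abs_le M x).trans hx.le
  have hker : ∀ i, (comparisonMatrix M *ᵥ fun k => |x k|) i = 0 := fun i => by
    rcases eq_or_ne i b₁ with rfl | hi
    · exact mulVec_eq_zero_of_posSemidef_submatrix (hC b₂) (by simp [hx₂]) hquad hb
    · exact mulVec_eq_zero_of_posSemidef_submatrix (hC b₁) (by simp [hx₁]) hquad hi
  refine hR.connected (x · = 0) (fun i j hij hi => ?_) b₁ k hk hx₁
  rcases eq_or_ne i j with rfl | hne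
  · exact hi
  have hnonpos : ∀ k ∈ univ, comparisonMatrix M i k * |x k| ≤ 0 := fun k _ => by
    rcases eq_or_ne i k with rfl | hik
    · simp [hi]
    · rw [comparisonMatrix_of_ne M hik]
      exact mul_nonpos_of_nonpos_of_nonneg (by simp) (abs_nonneg _)
  have hterm := (sum_eq_zero_iff_of_nonpos hnonpos).1 (hker i) j (mem_univ j)
  simpa [comparisonMatrix_of_ne M hne, hij] using hterm

theorem InverseOn.schurPivot_ne_zero (hB : InverseOn M s B) (hi : i ∉ s)
    (hdef : ∀ x : Fin n → ℝ, (∀ k ∉ insert i s, x k = 0) → x ⬝ᵥ M *ᵥ x = 0 → x i = 0) :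
    schurPivot M s B i ≠ 0 := by
  intro hzero
  let x : Fin n → ℝ := fun k =>
    if k ∈ insert i s then Function.update (schurColumn M s B i) i (-1) k else 0
  have hsupp : ∀ k ∉ insert i s, x k = 0 := fun k hk => if_neg hk
  have hker : ∀ k ∈ insert i s, (M *ᵥ x) k = 0 := fun k hk => by
    have hrow := hB.sum_mul_update_schurColumn hi hk
    rw [mulVec_eq_sum_of_support hsupp,
      sum_congr rfl fun j hj => by rw [show x j = _ from if_pos hj], hrow, hzero]
    simp
  have hxi := hdef x hsupp (sum_eq_zero fun k _ => by
    by_cases hk : k ∈ insert i s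
    · rw [hker k hk, mul_zero]
    · rw [hsupp k hk, zero_mul])
  simp [x] at hxi

end Blocks

section Elimination

variable {n : ℕ} {M B : Matrix (Fin n) (Fin n) ℝ} {q w x x' : Fin n → ℝ} {u : Fin n → WithTop ℝ}
  {C : Fin n → Bool} {s : Finset (Fin n)}

/-- The vector `x` satisfies the equations `q + M x = 0` and the bounds for the indices in `C`. -/
def SolvesOn (M : Matrix (Fin n) (Fin n) ℝ) (q : Fin n → ℝ) (u : Fin n → WithTop ℝ)
    (C : Fin n → Bool) (x : Fin n → ℝ) : Prop :=
  ∀ k, C k → gradient M q x k = 0 ∧ 0 ≤ x k ∧ (x k : WithTop ℝ) ≤ u k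

theorem SolvesOn.congr (hC : ∀ k j, C k → M k j ≠ 0 → C j) (h : SolvesOn M q u C x)
    (hx : ∀ k, C k → x' k = x k) : SolvesOn M q u C x' := by
  intro k hk
  have hrow : gradient M q x' k = gradient M q x k := by
    simp only [gradient_apply]
    congr 1
    refine sum_congr rfl fun j _ => ?_
    by_cases hkj : M k j = 0
    · simp [hkj]
    · rw [hx j (hC k j hk hkj)]
  rw [hrow, hx k hk]
  exact h k hk

/-- The condition that an index of a block imposes after the elimination: an eliminated variable
has the value `-r`, and for another one with value `v` the equation of its row is `r = 0`. -/
def RowCondition (bound : WithTop ℝ) (eliminated : Prop) [Decidable eliminated] (v r : ℝ) : Prop :=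
  if eliminated then 0 ≤ -r ∧ ((-r : ℝ) : WithTop ℝ) ≤ bound
  else r = 0 ∧ 0 ≤ v ∧ (v : WithTop ℝ) ≤ bound

theorem InverseOn.gradient_eq_zero_iff (hM : M.IsSymm) (hB : InverseOn M s B)
    (hw : ∀ k ∈ s, w k = 0) (hx : ∀ k ∉ s, x k = w k) :
    (∀ k ∈ s, gradient M q x k = 0) ↔
      ∀ k ∈ s, x k = -pivotTransform M s B (gradient M q w) k := by
  have hsupp : ∀ k ∉ s, (x - w) k = 0 := fun k hk => sub_eq_zero.2 (hx k hk)
  have hgrad : gradient M q w = gradient M q x + (-1 : ℝ) • (M *ᵥ (x - w)) := by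
    simp only [gradient, mulVec_sub, neg_smul, one_smul]
    abel
  have htransform : ∀ k ∈ s, -pivotTransform M s B (gradient M q w) k =
      x k - pivotTransform M s B (gradient M q x) k := fun k hk => by
    rw [hgrad, pivotTransform_add_smul, hB.pivotTransform_mulVec hM hsupp]
    simp [hw k hk, sub_eq_add_neg]
  refine ⟨fun h k hk => ?_, fun h k hk => ?_⟩
  · rw [htransform k hk, pivotTransform_of_mem hk, sum_eq_zero fun j hj => by rw [h j hj, mul_zero],
      sub_zero]
  · have hzero : ∀ j ∈ s, pivotTransform M s B (gradient M q x) j = 0 := fun j hj => by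
      linarith [h j hj, htransform j hj]
    rw [← hB.sum_mul_pivotTransform (gradient M q x) hk]
    exact sum_eq_zero fun j hj => by rw [hzero j hj, mul_zero]

theorem pivotTransform_gradient_of_notMem (hw : ∀ k ∈ s, w k = 0) (hx : ∀ k ∉ s, x k = w k)
    (h : ∀ k ∈ s, x k = -pivotTransform M s B (gradient M q w) k) {k : Fin n} (hk : k ∉ s) :
    pivotTransform M s B (gradient M q w) k = gradient M q x k := by
  have hsupp : ∀ k ∉ s, (x - w) k = 0 := fun k hk => sub_eq_zero.2 (hx k hk)
  have hgrad : gradient M q x = gradient M q w + M *ᵥ (x - w) := by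
    simp only [gradient, mulVec_sub]
    abel
  rw [pivotTransform_of_notMem hk, hgrad, Pi.add_apply, mulVec_eq_sum_of_support hsupp,
    sub_eq_add_neg, ← sum_neg_distrib]
  congr 1
  refine sum_congr rfl fun j hj => ?_
  rw [Pi.sub_apply, h j hj, hw j hj]
  ring

theorem InverseOn.solvesOn_iff (hM : M.IsSymm) (hB : InverseOn M s B) (hC : ∀ k ∈ s, C k)
    (hw : ∀ k ∈ s, w k = 0) (hx : ∀ k ∉ s, x k = w k) :
    SolvesOn M q u C x ↔ (∀ k ∈ s, x k = -pivotTransform M s B (gradient M q w) k) ∧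
      ∀ k, C k → RowCondition (u k) (k ∈ s) (w k) (pivotTransform M s B (gradient M q w) k) := by
  have hiff := hB.gradient_eq_zero_iff (q := q) hM hw hx
  have helim (h : ∀ k ∈ s, x k = -pivotTransform M s B (gradient M q w) k) (k : Fin n) :
      RowCondition (u k) (k ∈ s) (w k) (pivotTransform M s B (gradient M q w) k) ↔
        gradient M q x k = 0 ∧ 0 ≤ x k ∧ (x k : WithTop ℝ) ≤ u k := by
    by_cases hk : k ∈ s
    · rw [RowCondition, if_pos hk, ← h k hk]
      exact (and_iff_right (hiff.2 h k hk)).symm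
    · rw [RowCondition, if_neg hk, pivotTransform_gradient_of_notMem hw hx h hk, hx k hk]
  refine ⟨fun h => ?_, fun h k hk => (helim h.1 k).1 (h.2 k hk)⟩
  have hval := hiff.1 fun k hk => (h k (hC k hk)).1
  exact ⟨hval, fun k hk => (helim hval k).2 (h k hk)⟩

end Elimination

section BlockPrograms

variable {K : Type} {n : ℕ}

/-- The part of `solveBlock` that inverts the principal submatrix with the indices in `inα`. -/
def blockInverse (M : Fin n → Fin n → K) (inα : Fin n → Bool)
    (zeroMatrix : Fin n → Fin n → K) : Prog K ((Fin n → Bool) × (Fin n → Fin n → K)) :=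
  loop ((fun _ => false, zeroMatrix) : (Fin n → Bool) × (Fin n → Fin n → K))
    fun s k => if inα k then do
        let (h, e) ← schurEntry M s.1 s.2 k
        pure (Function.update s.1 k true, ← addIndex s.2 k h e)
      else pure s

/-- The part of `solveBlock` that adds the inequalities of the index `k` for the values of the two
variables that are not eliminated. -/
def blockRow (u : Fin n → WithTop K) (inC inα : Fin n → Bool) (b₁ : Fin n) (g₁ g₂ qb : Fin n → K)
    (zero one : K) (L : List (K × K × K)) (k : Fin n) : Prog K (List (K × K × K)) :=
    if inC k then do
      let a' ← neg (g₁ k)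
      let b' ← neg (g₂ k)
      let c' ← neg (qb k)
      if inα k then
        match u k with
        | ⊤ => pure ((a', b', c') :: L)
        | (c : K) => do pure ((a', b', c') :: (g₁ k, g₂ k, ← add (qb k) c) :: L)
      else do
        let L := (a', b', c') :: (g₁ k, g₂ k, qb k) :: L
        let m ← neg one
        if k = b₁ then
          match u k with
          | ⊤ => pure ((one, zero, zero) :: L)
          | (c : K) => pure ((one, zero, zero) :: (m, zero, c) :: L)
        else
          match u k with
          | ⊤ => pure ((zero, one, zero) :: L)
          | (c : K) => pure ((zero, one, zero) :: (zero, m, c) :: L)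
    else pure L

/-- The part of `solveBlock` that solves the reduced system. -/
def blockSolution (u : Fin n → WithTop K) (inC inα : Fin n → Bool) (b₁ : Fin n)
    (b₂ : Option (Fin n)) (x : Fin n → K) (g₁ g₂ qb : Fin n → K) (zero one : K) :
    Prog K (Option (Fin n → K)) := do
  let L ← loop ([] : List (K × K × K)) (blockRow u inC inα b₁ g₁ g₂ qb zero one)
  match ← solveTwoVar L with
  | none => pure none
  | some (y, z) => do
    let x' ← tab fun k =>
      if k = b₁ then pure y
      else if some k = b₂ then pure z
      else if inC k then do
        neg (← add (qb k) (← add (← mul (g₁ k) y) (← mul (g₂ k) z)))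
      else pure (x k)
    pure (some x')

theorem solveBlock_eq (M : Fin n → Fin n → K) (q : Fin n → K) (u : Fin n → WithTop K)
    (inC : Fin n → Bool) (b₁ : Fin n) (x : Fin n → K) :
    solveBlock M q u inC b₁ x = (do
      let zero ← lit 0
      let one ← lit 1
      let b₂ ← findFirst fun j => pure (inC j && decide (j ≠ b₁))
      let inα : Fin n → Bool := fun k => inC k && decide (k ≠ b₁) && decide (some k ≠ b₂)
      let zeroMatrix ← tab2 fun _ _ => pure zero
      let (_, B) ← blockInverse M inα zeroMatrix
      let qb ← transform M inα B q
      let g₁ ← transform M inα B fun j => M j b₁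
      let g₂ ← match b₂ with
        | none => tab fun _ => pure zero
        | some b => transform M inα B fun j => M j b
      blockSolution u inC inα b₁ b₂ x g₁ g₂ qb zero one) :=
  rfl

end BlockPrograms

section ReducedSystem

variable {n : ℕ} {M : Matrix (Fin n) (Fin n) ℝ} {q x x' : Fin n → ℝ} {u : Fin n → WithTop ℝ}
  {C inα : Fin n → Bool} {b₁ : Fin n} {b₂ : Option (Fin n)} {g₁ g₂ r : Fin n → ℝ}

theorem inverseOn_eval_blockInverse (hM : M.IsSymm) (Z : Fin n → Fin n → ℝ)
    (hdef : ∀ x : Fin n → ℝ, (∀ k, inα k = false → x k = 0) → x ⬝ᵥ M *ᵥ x = 0 → x = 0) :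
    InverseOn M {k | inα k} (blockInverse M inα Z).eval.2 := by
  let below (m : ℕ) (k : Fin n) : Bool := inα k && decide (k.1 < m)
  let P (m : ℕ) (t : (Fin n → Bool) × (Fin n → Fin n → ℝ)) : Prop :=
    t.1 = below m ∧ InverseOn M {k | t.1 k} t.2
  suffices h : P n (blockInverse M inα Z).eval by simpa [h.1, below] using h.2
  refine loop_induction P ⟨by simp [below], by simpa using inverseOn_empty⟩ ?_
  rintro k ⟨_, B⟩ ⟨rfl, hB⟩
  dsimp only [P] at hB ⊢
  by_cases hk : inα k
  · have hbelow : Function.update (below k) k true = below (k + 1) := by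
      funext j
      simp only [below, Function.update_apply, Fin.ext_iff]
      grind
    have hinsert : univ.filter (below (k + 1) ·) = insert k (univ.filter (below k ·)) := by
      ext j
      by_cases hj : j = k <;> simp [← hbelow, hj]
    have hmem : k ∉ univ.filter (below k ·) := by simp [below]
    have hschur : (schurEntry M (below k) B k).eval = _ := eval_schurEntry M (below k) B k
    simp only [if_pos hk, eval_bind, hschur, eval_pure, hbelow, true_and]
    rw [hinsert]
    refine hB.addIndex hM hmem (hB.schurPivot_ne_zero hmem fun x hx hquad => ?_)
    exact congrFun (hdef x (fun j hj => hx j (by grind)) hquad) k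
  · have hbelow : below (k + 1) = below k := by
      funext j
      simp only [below]
      grind
    simpa only [if_neg hk, eval_pure, hbelow, true_and] using hB

theorem forall_mem_eval_blockRow_iff (L : List (ℝ × ℝ × ℝ)) (k : Fin n) (y z : ℝ) :
    (∀ e ∈ (blockRow u C inα b₁ g₁ g₂ r 0 1 L k).eval, 0 ≤ e.1 * y + e.2.1 * z + e.2.2) ↔
      (∀ e ∈ L, 0 ≤ e.1 * y + e.2.1 * z + e.2.2) ∧ (C k → RowCondition (u k) (inα k)
        (if k = b₁ then y else z) (r k + (g₁ k * y + g₂ k * z))) := by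
  by_cases hC : C k
  swap
  · simp [blockRow, hC]
  have hneg : -g₁ k * y + -g₂ k * z + -r k = -(r k + (g₁ k * y + g₂ k * z)) := by ring
  have hpos : g₁ k * y + g₂ k * z + r k = r k + (g₁ k * y + g₂ k * z) := by ring
  have hbound (c : ℝ) : g₁ k * y + g₂ k * z + (r k + c) = r k + (g₁ k * y + g₂ k * z) + c := by
    ring
  simp only [blockRow, hC, if_true, RowCondition, true_imp_iff]
  generalize r k + (g₁ k * y + g₂ k * z) = ρ at *
  have hzero : ρ = 0 ↔ 0 ≤ -ρ ∧ 0 ≤ ρ := by rw [neg_nonneg]; exact le_antisymm_iff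
  rcases u k with _ | c
  · have htop (v : ℝ) : (v : WithTop ℝ) ≤ none := le_top
    rcases eq_or_ne k b₁ with rfl | hk <;> by_cases hα : inα k <;>
      simp only [*, eval_bind, eval_neg, eval_pure, List.forall_mem_cons, if_true,
        if_false, Bool.false_eq_true, one_mul, zero_mul, add_zero, zero_add, and_true] <;> tauto
  · have hcoe (v : ℝ) : (v : WithTop ℝ) ≤ some c ↔ v ≤ c := WithTop.coe_le_coe
    have hcap (v : ℝ) : 0 ≤ -1 * v + c ↔ v ≤ c := by constructor <;> intro h <;> linarith
    have hcap' : 0 ≤ ρ + c ↔ -ρ ≤ c := by constructor <;> intro h <;> linarith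
    rcases eq_or_ne k b₁ with rfl | hk <;> by_cases hα : inα k <;>
      simp only [*, eval_bind, eval_neg, eval_add, eval_pure, List.forall_mem_cons,
        if_true, if_false, Bool.false_eq_true, one_mul, zero_mul, add_zero, zero_add] <;> tauto

theorem forall_mem_eval_loop_blockRow_iff (y z : ℝ) :
    (∀ e ∈ (loop [] (blockRow u C inα b₁ g₁ g₂ r 0 1)).eval,
        0 ≤ e.1 * y + e.2.1 * z + e.2.2) ↔
      ∀ k, C k → RowCondition (u k) (inα k) (if k = b₁ then y else z)
        (r k + (g₁ k * y + g₂ k * z)) := by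
  have h := loop_induction (s := []) (f := blockRow u C inα b₁ g₁ g₂ r 0 1)
    (fun m L => (∀ e ∈ L, 0 ≤ e.1 * y + e.2.1 * z + e.2.2) ↔ ∀ k : Fin n, k.1 < m →
      C k → RowCondition (u k) (inα k) (if k = b₁ then y else z)
        (r k + (g₁ k * y + g₂ k * z))) (by simp) fun k L hL => by
    rw [forall_mem_eval_blockRow_iff, hL]
    refine ⟨fun h j hj => ?_, fun h => ⟨fun j hj => h j (by omega), h k (by omega)⟩⟩
    rcases Nat.lt_succ_iff_lt_or_eq.1 hj with hj | hj
    · exact h.1 j hj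
    · rw [Fin.ext hj]; exact h.2
  simpa using h

/-- The result of `solveBlock` for the values `y` and `z` of the variables that are not
eliminated. -/
def blockPoint (C : Fin n → Bool) (b₁ : Fin n) (b₂ : Option (Fin n)) (x : Fin n → ℝ) (y z : ℝ)
    (r : Fin n → ℝ) (k : Fin n) : ℝ :=
  if k = b₁ then y else if some k = b₂ then z else if C k then -r k else x k

theorem eval_blockSolution_spec (h : (blockSolution u C inα b₁ b₂ x g₁ g₂ r 0 1).eval = some x') :
    ∃ y z, (∀ k, C k → RowCondition (u k) (inα k) (if k = b₁ then y else z)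
        (r k + (g₁ k * y + g₂ k * z))) ∧
      x' = blockPoint C b₁ b₂ x y z fun k => r k + (g₁ k * y + g₂ k * z) := by
  simp only [blockSolution, eval_bind] at h
  split at h
  · simp at h
  · next y z hsol =>
    refine ⟨y, z, (forall_mem_eval_loop_blockRow_iff y z).1 (eval_solveTwoVar_spec hsol), ?_⟩
    funext k
    simp only [eval_bind, eval_tab, eval_ite, eval_pure, eval_mul, eval_add, eval_neg,
      Option.some.injEq] at h
    exact (congrFun h k).symm

theorem exists_eval_blockSolution (h : ∃ y z, ∀ k, C k → RowCondition (u k) (inα k)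
      (if k = b₁ then y else z) (r k + (g₁ k * y + g₂ k * z))) :
    ∃ x', (blockSolution u C inα b₁ b₂ x g₁ g₂ r 0 1).eval = some x' := by
  obtain ⟨y, z, hyz⟩ := h
  obtain ⟨y, z, hsol⟩ :=
    exists_eval_solveTwoVar ⟨y, z, (forall_mem_eval_loop_blockRow_iff y z).2 hyz⟩
  simp [blockSolution, hsol]

end ReducedSystem

section SolveBlock

variable {n : ℕ} {M : Matrix (Fin n) (Fin n) ℝ} {q x x' : Fin n → ℝ} {u : Fin n → WithTop ℝ}
  {C : Fin n → Bool} {b₁ k : Fin n} {b₂ : Option (Fin n)}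

/-- The second index of the block `C` with first index `b₁`, if there is one. -/
def secondIndex (C : Fin n → Bool) (b₁ : Fin n) : Option (Fin n) :=
  Fin.find? fun j => C j && decide (j ≠ b₁)

/-- The indices of the block `C` whose variables are eliminated. -/
def eliminated (C : Fin n → Bool) (b₁ : Fin n) (b₂ : Option (Fin n)) (k : Fin n) : Bool :=
  C k && decide (k ≠ b₁) && decide (some k ≠ b₂)

/-- The vector with entries `y` and `z` at the indices that are not eliminated. -/
def restPoint (b₁ : Fin n) (b₂ : Option (Fin n)) (y z : ℝ) (k : Fin n) : ℝ :=
  if k = b₁ then y else if some k = b₂ then z else 0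

theorem secondIndex_mem (h : secondIndex C b₁ = some k) : C k ∧ k ≠ b₁ := by
  simpa using (Fin.find?_eq_some_iff.1 h).1

theorem eq_of_secondIndex_eq_none (h : secondIndex C b₁ = none) (hk : C k) : k = b₁ := by
  simpa [hk] using Fin.find?_eq_none_iff.1 h k

theorem gradient_restPoint (hb : b₂ ≠ some b₁) (y z : ℝ) :
    gradient M q (restPoint b₁ b₂ y z) = q + y • M.col b₁ + z • b₂.elim 0 M.col := by
  have hpoint : restPoint b₁ b₂ y z = Pi.single b₁ y + b₂.elim 0 (Pi.single · z) := by
    funext k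
    rcases b₂ with _ | b <;> by_cases hk : k = b₁ <;>
      simp_all [restPoint, Pi.single_apply, eq_comm]
  rcases b₂ with _ | b <;>
    simp [hpoint, gradient, mulVec_add, add_assoc]

/-- The inverse of the principal submatrix of the eliminated variables, as computed by
`solveBlock`. -/
noncomputable def eliminationInverse (M : Matrix (Fin n) (Fin n) ℝ) (C : Fin n → Bool)
    (b₁ : Fin n) : Matrix (Fin n) (Fin n) ℝ :=
  (blockInverse M (eliminated C b₁ (secondIndex C b₁)) 0).eval.2

theorem eval_solveBlock (M : Fin n → Fin n → ℝ) (q : Fin n → ℝ) (u : Fin n → WithTop ℝ)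
    (C : Fin n → Bool) (b₁ : Fin n) (x : Fin n → ℝ) :
    let inα := eliminated C b₁ (secondIndex C b₁)
    let T := fun r => (transform M inα (eliminationInverse M C b₁) r).eval
    (solveBlock M q u C b₁ x).eval = (blockSolution u C inα b₁ (secondIndex C b₁) x
      (T fun j => M j b₁) ((secondIndex C b₁).elim 0 fun b => T fun j => M j b) (T q)
      0 1).eval := by
  intro inα T
  have hfind : (findFirst fun j => (pure (C j && decide (j ≠ b₁)) : Prog ℝ Bool)).eval =
      secondIndex C b₁ := eval_findFirst _
  have helim : (fun k => C k && decide (k ≠ b₁) && decide (some k ≠ secondIndex C b₁)) =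
      inα := rfl
  have hinv : (blockInverse M inα fun _ _ => 0).eval.2 = eliminationInverse M C b₁ := rfl
  simp only [solveBlock_eq, eval_bind, eval_lit, hfind, helim, eval_tab2, eval_pure, Nat.cast_zero,
    Nat.cast_one, hinv]
  rcases secondIndex C b₁ with _ | b
  · simp only [eval_bind, eval_tab, eval_pure]; rfl
  · simp only [eval_bind]; rfl

/-- The transformed linear term of the reduced system of a block, at the values `y` and `z` of the
variables that are not eliminated. -/
noncomputable def reducedGradient (M : Matrix (Fin n) (Fin n) ℝ) (q : Fin n → ℝ)
    (C : Fin n → Bool) (b₁ : Fin n) (y z : ℝ) : Fin n → ℝ :=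
  pivotTransform M {k | eliminated C b₁ (secondIndex C b₁) k} (eliminationInverse M C b₁)
    (gradient M q (restPoint b₁ (secondIndex C b₁) y z))

theorem exists_eval_solveBlock_eq (M : Matrix (Fin n) (Fin n) ℝ) (q : Fin n → ℝ)
    (u : Fin n → WithTop ℝ) (C : Fin n → Bool) (b₁ : Fin n) (x : Fin n → ℝ) : ∃ g₁ g₂ r,
      (∀ y z k, r k + (g₁ k * y + g₂ k * z) = reducedGradient M q C b₁ y z k) ∧
      (solveBlock M q u C b₁ x).eval = (blockSolution u C (eliminated C b₁ (secondIndex C b₁))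
        b₁ (secondIndex C b₁) x g₁ g₂ r 0 1).eval := by
  refine ⟨_, _, _, fun y z k => ?_, eval_solveBlock M q u C b₁ x⟩
  have hne : secondIndex C b₁ ≠ some b₁ := fun h => (secondIndex_mem h).2 rfl
  rw [reducedGradient, gradient_restPoint hne, pivotTransform_add_smul, pivotTransform_add_smul]
  have htransform (r : Fin n → ℝ) := eval_transform M (eliminated C b₁ (secondIndex C b₁))
    (eliminationInverse M C b₁) r
  have hcol (b : Fin n) : (fun j => M j b) = M.col b := rfl
  simp only [htransform, hcol, Pi.add_apply, Pi.smul_apply, smul_eq_mul]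
  rcases secondIndex C b₁ with _ | b
  · have hzero : pivotTransform M {k | eliminated C b₁ none k} (eliminationInverse M C b₁) 0 = 0 :=
      funext fun i => by simp [pivotTransform]
    simp only [Option.elim_none, hzero, Pi.zero_apply]
    ring
  · simp only [Option.elim_some]
    ring

/-- What the elimination of a block rests on: a quadratic form that vanishes at a vector with
zero entries at two indices vanishes only if the vector does so on the whole block. -/
def DefiniteAfter (M : Matrix (Fin n) (Fin n) ℝ) (C : Fin n → Bool) (b₁ : Fin n) : Prop :=
  ∀ b₂ (x : Fin n → ℝ), b₁ ≠ b₂ → x b₁ = 0 → x b₂ = 0 → x ⬝ᵥ M *ᵥ x = 0 → ∀ k, C k → x k = 0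

theorem inverseOn_eliminationInverse (hM : M.IsSymm) (hdef : DefiniteAfter M C b₁) :
    InverseOn M {k | eliminated C b₁ (secondIndex C b₁) k} (eliminationInverse M C b₁) := by
  refine inverseOn_eval_blockInverse hM 0 fun x hx hquad => funext fun k => ?_
  by_cases hk : eliminated C b₁ (secondIndex C b₁) k
  swap
  · exact hx k (by simpa using hk)
  rcases hb : secondIndex C b₁ with _ | b₂
  · simp_all [eliminated, eq_of_secondIndex_eq_none hb]
  · have hx₁ : x b₁ = 0 := hx b₁ (by simp [eliminated])
    have hx₂ : x b₂ = 0 := hx b₂ (by simp [eliminated, hb])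
    exact hdef b₂ x (secondIndex_mem hb).2.symm hx₁ hx₂ hquad k (by simp_all [eliminated])

theorem solvesOn_iff_rowCondition (hM : M.IsSymm) (hdef : DefiniteAfter M C b₁) {y z : ℝ}
    (hx : ∀ k, ¬ eliminated C b₁ (secondIndex C b₁) k →
      x k = restPoint b₁ (secondIndex C b₁) y z k) :
    SolvesOn M q u C x ↔
      (∀ k, eliminated C b₁ (secondIndex C b₁) k → x k = -reducedGradient M q C b₁ y z k) ∧
      ∀ k, C k → RowCondition (u k) (eliminated C b₁ (secondIndex C b₁) k)
        (if k = b₁ then y else z) (reducedGradient M q C b₁ y z k) := by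
  have hiff := (inverseOn_eliminationInverse hM hdef).solvesOn_iff (q := q) (u := u) (C := C)
    (w := restPoint b₁ (secondIndex C b₁) y z) (x := x) hM (by simp_all [eliminated])
    (by simp_all [eliminated, restPoint]) (by simpa using hx)
  have hvalue (k : Fin n) (hk : C k) (hel : ¬ eliminated C b₁ (secondIndex C b₁) k) :
      restPoint b₁ (secondIndex C b₁) y z k = if k = b₁ then y else z := by
    simp only [eliminated, restPoint] at hel ⊢
    grind
  rw [hiff]
  refine and_congr (by simp [reducedGradient]) (forall₂_congr fun k hk => ?_)
  by_cases hel : eliminated C b₁ (secondIndex C b₁) k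
  · simp [RowCondition, reducedGradient, hel]
  · simp [RowCondition, reducedGradient, hel, hvalue k hk hel]

theorem solvesOn_of_eval_solveBlock (hM : M.IsSymm) (hdef : DefiniteAfter M C b₁)
    (hC : ∀ k j, C k → M k j ≠ 0 → C j) (h : (solveBlock M q u C b₁ x).eval = some x') :
    SolvesOn M q u C x' := by
  obtain ⟨g₁, g₂, r, hrow, heval⟩ := exists_eval_solveBlock_eq M q u C b₁ x
  obtain ⟨y, z, hcond, rfl⟩ := eval_blockSolution_spec (heval.symm.trans h)
  simp only [hrow] at hcond ⊢
  let X := blockPoint C b₁ (secondIndex C b₁) 0 y z (reducedGradient M q C b₁ y z)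
  have hX : SolvesOn M q u C X := by
    refine (solvesOn_iff_rowCondition hM hdef fun k hk => ?_).2 ⟨fun k hk => ?_, hcond⟩
    · simp only [eliminated, X, blockPoint, restPoint, Pi.zero_apply] at hk ⊢
      grind
    · simp only [eliminated, X, blockPoint] at hk ⊢
      grind
  exact hX.congr hC fun k hk => by simp [X, blockPoint, hk]

theorem eval_solveBlock_apply_of_notMem (hb₁ : C b₁) (hk : C k = false)
    (h : (solveBlock M q u C b₁ x).eval = some x') : x' k = x k := by
  obtain ⟨g₁, g₂, r, -, heval⟩ := exists_eval_solveBlock_eq M q u C b₁ x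
  obtain ⟨y, z, -, rfl⟩ := eval_blockSolution_spec (heval.symm.trans h)
  have hk₁ : k ≠ b₁ := fun h => by simp_all
  have hk₂ : some k ≠ secondIndex C b₁ := fun h => by
    simpa [hk] using (secondIndex_mem h.symm).1
  simp [blockPoint, hk, hk₁, hk₂]

theorem exists_eval_solveBlock (hM : M.IsSymm) (hdef : DefiniteAfter M C b₁)
    (hC : ∀ k j, C k → M k j ≠ 0 → C j) (hb₁ : C b₁) (h : SolvesOn M q u C x') :
    ∃ x'', (solveBlock M q u C b₁ x).eval = some x'' := by
  obtain ⟨g₁, g₂, r, hrow, heval⟩ := exists_eval_solveBlock_eq M q u C b₁ x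
  let X (k : Fin n) : ℝ := if C k then x' k else 0
  have hX : SolvesOn M q u C X := h.congr hC fun k hk => by simp [X, hk]
  rw [heval]
  refine exists_eval_blockSolution ⟨X b₁, (secondIndex C b₁).elim 0 X, ?_⟩
  simp only [hrow]
  refine ((solvesOn_iff_rowCondition hM hdef fun k hk => ?_).1 hX).2
  rcases hb : secondIndex C b₁ with _ | b₂
  · simp only [eliminated, hb, restPoint, X] at hk ⊢
    grind
  · simp only [eliminated, hb, restPoint, X] at hk ⊢
    grind

end SolveBlock

section FinalCheck

/-- The part of `finalCheck` that handles the block with first index `i`. -/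
def checkBlock {K : Type} {n : ℕ} (M : Fin n → Fin n → K) (q : Fin n → K) (u : Fin n → WithTop K)
    (R : Fin n → Fin n → Bool) (s : Option (Fin n → K)) (i : Fin n) :
    Prog K (Option (Fin n → K)) :=
  match s with
  | none => pure none
  | some x => do
    match ← findFirst fun j => pure (R i j) with
    | some j => if j = i then solveBlock M q u (R i) i x else pure (some x)
    | none => pure (some x)

theorem finalCheck_eq {K : Type} {n : ℕ} (M : Fin n → Fin n → K) (q : Fin n → K)
    (u : Fin n → WithTop K) :
    finalCheck M q u = (do
      let R ← sameBlock M
      let x₀ ← tab fun _ => lit 0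
      let res ← loop (some x₀) (checkBlock M q u R)
      match res with
      | some x => pure (.optimal x)
      | none => pure .noSolution) :=
  rfl

theorem eval_finalCheck {n : ℕ} (M : Fin n → Fin n → ℝ) (q : Fin n → ℝ) (u : Fin n → WithTop ℝ) :
    (finalCheck M q u).eval =
      match (loop (some 0) (checkBlock M q u (sameBlock M).eval)).eval with
      | some x => .optimal x
      | none => .noSolution := by
  have hzero : (tab fun _ : Fin n => (lit 0 : Prog ℝ ℝ)).eval = 0 := by
    simp only [eval_tab, eval_lit, Nat.cast_zero]
    rfl
  simp only [finalCheck_eq, eval_bind, hzero]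
  split <;> simp [*]

variable {n : ℕ} {M : Matrix (Fin n) (Fin n) ℝ} {q x x' : Fin n → ℝ} {u : Fin n → WithTop ℝ}
  {R : Fin n → Fin n → Bool} {i : Fin n}

/-- `i` is the first index of its block. -/
def IsFirst (R : Fin n → Fin n → Bool) (i : Fin n) : Prop :=
  ∀ j < i, R i j = false

theorem IsPathRelation.solvesOn_of_isFirst (hR : IsPathRelation M n R)
    (h : ∀ i, IsFirst R i → SolvesOn M q u (R i) x) : SolvesOn M q u (fun _ => true) x := by
  intro k _
  obtain ⟨i, hi, hmin⟩ := exists_min_image ({j | R k j} : Finset (Fin n)) id ⟨k, by simp [hR.refl]⟩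
  simp only [mem_filter, mem_univ, true_and, id] at hi hmin
  refine h i (fun j hj => ?_) k (hR.symm k i hi)
  rw [Bool.eq_false_iff]
  exact fun hij => absurd (hmin j (hR.trans hi hij)) (not_le.2 hj)

theorem eval_checkBlock (hR : R i i) :
    IsFirst R i ∧ (checkBlock M q u R (some x) i).eval = (solveBlock M q u (R i) i x).eval ∨
      ¬ IsFirst R i ∧ (checkBlock M q u R (some x) i).eval = some x := by
  have hfirst : Fin.find? (R i ·) = some i ↔ IsFirst R i := by
    rw [Fin.find?_eq_some_iff]; simp [hR, IsFirst]
  simp only [checkBlock, eval_bind, eval_findFirst, eval_pure, ← hfirst]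
  rcases Fin.find? (R i ·) with _ | j
  · simp
  · by_cases hj : j = i <;> simp [hj]

theorem eval_checkBlock_spec (hM : M.IsSymm) (hR : IsPathRelation M n R)
    (hdef : DefiniteAfter M (R i) i)
    (hx : ∀ r < i, IsFirst R r → SolvesOn M q u (R r) x)
    (h : (checkBlock M q u R (some x) i).eval = some x') :
    ∀ r ≤ i, IsFirst R r → SolvesOn M q u (R r) x' := by
  have hclosed (r k j : Fin n) (hrk : R r k) (hkj : M k j ≠ 0) : R r j :=
    hR.trans hrk (hR.edge k j hkj)
  intro r hr hrfirst
  rcases eval_checkBlock (hR.refl i) with ⟨hi, heval⟩ | ⟨hi, heval⟩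
  · have hsolve := heval.symm.trans h
    rcases hr.lt_or_eq with hlt | rfl
    · refine (hx r hlt hrfirst).congr (hclosed r) fun k hk =>
        eval_solveBlock_apply_of_notMem (hR.refl i) (Bool.eq_false_iff.2 fun hik => ?_) hsolve
      simpa [hi r hlt] using hR.trans hik (hR.symm r k hk)
    · exact solvesOn_of_eval_solveBlock hM hdef (hclosed r) hsolve
  · obtain rfl : x = x' := Option.some.inj (heval.symm.trans h)
    exact hx r (hr.lt_of_ne fun hri => hi (hri ▸ hrfirst)) hrfirst

theorem exists_eval_checkBlock (hM : M.IsSymm) (hR : IsPathRelation M n R)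
    (hdef : DefiniteAfter M (R i) i) (h : SolvesOn M q u (fun _ => true) x') :
    ∃ x'', (checkBlock M q u R (some x) i).eval = some x'' := by
  rcases eval_checkBlock (M := M) (q := q) (u := u) (x := x) (hR.refl i) with
    ⟨-, heval⟩ | ⟨-, heval⟩
  · rw [heval]
    exact exists_eval_solveBlock hM hdef (fun k j hk hkj => hR.trans hk (hR.edge k j hkj))
      (hR.refl i) fun k _ => h k rfl
  · exact ⟨x, heval⟩

theorem finalCheck_spec {M : Matrix (Fin (n + 1)) (Fin (n + 1)) ℝ} (hM : M.IsSymm)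
    (hC : ∀ i : Fin (n + 1), (comparisonMatrix (M.submatrix i.succAbove i.succAbove)).PosSemidef)
    (q : Fin (n + 1) → ℝ) (u : Fin (n + 1) → WithTop ℝ) :
    (∃ x, (finalCheck M q u).eval = .optimal x ∧ SolvesOn M q u (fun _ => true) x) ∨
      ((finalCheck M q u).eval = .noSolution ∧ ¬ ∃ x, SolvesOn M q u (fun _ => true) x) := by
  have hR := isPathRelation_eval_sameBlock hM
  have heval := eval_finalCheck M q u
  generalize (sameBlock M).eval = R at hR heval
  have hdef (i : Fin (n + 1)) : DefiniteAfter M (R i) i := fun b₂ x hb hx₁ hx₂ hx k hk =>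
    eq_zero_of_dotProduct_mulVec_eq_zero hC hR hb hx₁ hx₂ hx hk
  let P (m : ℕ) (s : Option (Fin (n + 1) → ℝ)) : Prop :=
    (∀ x, s = some x → ∀ r : Fin (n + 1), r.1 < m → IsFirst R r → SolvesOn M q u (R r) x) ∧
      ((∃ x, SolvesOn M q u (fun _ => true) x) → ∃ x, s = some x)
  have hP : P (n + 1) (loop (some 0) (checkBlock M q u R)).eval := by
    refine loop_induction P ⟨by simp, fun _ => ⟨0, rfl⟩⟩ ?_
    rintro i (_ | x) ⟨hsound, hcomplete⟩
    · exact ⟨by simp [checkBlock], fun hx => by simpa using hcomplete hx⟩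
    · refine ⟨fun x' hx' r hr => ?_, fun ⟨y, hy⟩ => exists_eval_checkBlock hM hR (hdef i) hy⟩
      exact eval_checkBlock_spec hM hR (hdef i) (hsound x rfl) hx' r (Nat.lt_succ_iff.1 hr)
  rcases hres : (loop (some 0) (checkBlock M q u R)).eval with _ | x <;>
    simp only [hres] at hP heval
  · exact Or.inr ⟨heval, fun hx => by simpa using hP.2 hx⟩
  · exact Or.inl ⟨x, heval, hR.solvesOn_of_isFirst fun i hi => hP.1 x rfl i i.2 hi⟩

end FinalCheck
/-! ## Correctness of the algorithm -/

section FixedVariable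

variable {n : ℕ} {M : Matrix (Fin (n + 1)) (Fin (n + 1)) ℝ} {q x : Fin (n + 1) → ℝ}
  {u : Fin (n + 1) → WithTop ℝ} {i : Fin (n + 1)} {c : ℝ} {y v : Fin n → ℝ}

/-- The linear term of the problem with the variable `x_i` fixed at `c`. -/
def fixedTerm (M : Matrix (Fin (n + 1)) (Fin (n + 1)) ℝ) (q : Fin (n + 1) → ℝ) (i : Fin (n + 1))
    (c : ℝ) (j : Fin n) : ℝ :=
  q (i.succAbove j) + M (i.succAbove j) i * c

theorem kkt_insertNth (h : KKT (M.submatrix i.succAbove i.succAbove) (fixedTerm M q i c)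
      (fun j => u (i.succAbove j)) y) (hi : KKTAt M q u (i.insertNth c y) i) :
    KKT M q u (i.insertNth c y) :=
  (Fin.forall_iff_succAbove i).2 ⟨hi, fun k =>
    (h k).congr (by simp) rfl (gradient_insertNth_succAbove M q c y k)⟩

theorem isRay_insertNth (hM : M.PosSemidef)
    (h : IsRay (M.submatrix i.succAbove i.succAbove) (fixedTerm M q i c)
      (fun j => u (i.succAbove j)) v) :
    IsRay M q u (i.insertNth 0 v) := by
  have hterm : fixedTerm M q i c = fun j => (q + c • M.col i) (i.succAbove j) :=
    funext fun j => by simp [fixedTerm, mul_comm]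
  have hray := isRay_insertNth_zero hM (hterm ▸ h)
  refine ⟨hray.nonneg, hray.eq_zero, hray.mulVec_eq_zero, ?_⟩
  have hcol : M.col i ⬝ᵥ i.insertNth 0 v = 0 := by
    have hi := congrFun hray.mulVec_eq_zero i
    simpa [mulVec, dotProduct, (posSemidef_isSymm hM).apply] using hi
  simpa [add_dotProduct, hcol] using hray.dotProduct_neg

theorem KKT.gradient_eq_of_fixed (hM : M.PosSemidef) (hx : KKT M q u x) (hi : x i = c)
    (hy : KKT (M.submatrix i.succAbove i.succAbove) (fixedTerm M q i c)
      (fun j => u (i.succAbove j)) y) :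
    gradient M q x i = gradient M q (i.insertNth c y) i := by
  have hrest (k : Fin n) : KKTAt M q u (i.insertNth c y) (i.succAbove k) :=
    (hy k).congr (by simp) rfl (gradient_insertNth_succAbove M q c y k)
  simp only [gradient]
  rw [mulVec_eq_of_kktAt hM (y := i.insertNth c y) <|
    (Fin.forall_iff_succAbove i).2 ⟨.inl (by simp [hi]), fun k => .inr ⟨hx _, hrest k⟩⟩]

end FixedVariable

section Resolve

/-- The part of `tryIndex` in which the variable `x_i` is fixed at its upper bound `c`. -/
def tryUpperBound {K : Type} {n : ℕ} (M : Fin (n + 1) → Fin (n + 1) → K)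
    (q : Fin (n + 1) → K) (M' : Fin n → Fin n → K) (u' : Fin n → WithTop K) (i : Fin (n + 1))
    (c : K) : Prog K (Option (Outcome K (n + 1))) := do
  let qub ← tab fun j => do
    add (q (i.succAbove j)) (← mul (M (i.succAbove j) i) c)
  match ← pppa M' qub u' with
  | .failed => pure (some .failed)
  | .noSolution => pure (some .noSolution)
  | .optimal x => do
    let t ← add (q i) (← mul (M i i) c)
    let g ← add t (← sumOn (fun _ => true) fun j => mul (M i (i.succAbove j)) (x j))
    if ← isPos g then pure none else pure (some (.optimal (i.insertNth c x)))

theorem tryIndex_eq {K : Type} {n : ℕ} (M : Fin (n + 1) → Fin (n + 1) → K) (q : Fin (n + 1) → K)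
    (u : Fin (n + 1) → WithTop K) (i : Fin (n + 1)) :
    tryIndex M q u i = (do
      let M' ← tab2 fun j k => pure (M (i.succAbove j) (i.succAbove k))
      let u' ← tab fun j => pure (u (i.succAbove j))
      let qlb ← tab fun j => pure (q (i.succAbove j))
      match ← pppa M' qlb u' with
      | .failed => pure (some .failed)
      | .noSolution => pure (some .noSolution)
      | .optimal x => do
        let g ← add (q i) (← sumOn (fun _ => true) fun j => mul (M i (i.succAbove j)) (x j))
        if ← isNeg g then
          match u i with
          | ⊤ => pure none
          | (c : K) => tryUpperBound M q M' u' i c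
        else pure (some (.optimal (i.insertNth (← lit 0) x)))) :=
  rfl

variable {n : ℕ} {M : Matrix (Fin (n + 1)) (Fin (n + 1)) ℝ} {q : Fin (n + 1) → ℝ}
  {u : Fin (n + 1) → WithTop ℝ} {i : Fin (n + 1)}

theorem eval_tryUpperBound (M : Fin (n + 1) → Fin (n + 1) → ℝ) (q : Fin (n + 1) → ℝ)
    (M' : Fin n → Fin n → ℝ) (u' : Fin n → WithTop ℝ) (i : Fin (n + 1)) (c : ℝ) :
    (tryUpperBound M q M' u' i c).eval = match (pppa M' (fixedTerm M q i c) u').eval with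
      | .failed => some .failed
      | .noSolution => some .noSolution
      | .optimal y => if 0 < gradient M q (i.insertNth c y) i then none
        else some (.optimal (i.insertNth c y)) := by
  have hterm : (tab fun j => do
      add (q (i.succAbove j)) (← mul (M (i.succAbove j) i) c)).eval = fixedTerm M q i c := by
    funext j
    simp [fixedTerm]
  have hgrad (y : Fin n → ℝ) : gradient M q (i.insertNth c y) i =
    q i + M i i * c + ∑ k, M i (i.succAbove k) * y k := gradient_insertNth_self M q c y
  simp only [tryUpperBound, eval_bind, hterm]
  split <;> simp [*]

theorem eval_tryIndex (M : Fin (n + 1) → Fin (n + 1) → ℝ) (q : Fin (n + 1) → ℝ)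
    (u : Fin (n + 1) → WithTop ℝ) (i : Fin (n + 1)) :
    let M' := fun j k => M (i.succAbove j) (i.succAbove k)
    let u' := fun j => u (i.succAbove j)
    (tryIndex M q u i).eval = match (pppa M' (fixedTerm M q i 0) u').eval with
      | .failed => some .failed
      | .noSolution => some .noSolution
      | .optimal y => if gradient M q (i.insertNth 0 y) i < 0 then
          match u i with
          | ⊤ => none
          | (c : ℝ) => (tryUpperBound M q M' u' i c).eval
        else some (.optimal (i.insertNth 0 y)) := by
  have hterm : (fun j => q (i.succAbove j)) = fixedTerm M q i 0 := by
    funext j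
    simp [fixedTerm]
  have hgrad (y : Fin n → ℝ) : gradient M q (i.insertNth 0 y) i =
      q i + ∑ k, M i (i.succAbove k) * y k := by
    simpa using gradient_insertNth_self M q 0 y
  simp only [tryIndex_eq, eval_bind, eval_tab2, eval_tab, eval_pure, hterm]
  split
  · simp [*]
  · simp [*]
  · next y _ =>
    rcases lt_or_ge (q i + ∑ k, M i (i.succAbove k) * y k) 0 with hneg | hneg
    · rcases u i <;> simp [*]
    · simp [*, hneg.not_gt]

theorem tryUpperBound_spec (hM : M.PosSemidef)
    (hC : (comparisonMatrix (M.submatrix i.succAbove i.succAbove)).PosSemidef)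
    (hu : ∀ i, 0 < u i) {c : ℝ} (hc : u i = c) :
    let o := (tryUpperBound M q (M.submatrix i.succAbove i.succAbove)
      (fun j => u (i.succAbove j)) i c).eval
    (∃ o', o = some o' ∧ Resolves M q u o') ∨
      (o = none ∧ ∀ x, KKT M q u x → 0 < x i → (x i : WithTop ℝ) < u i) := by
  intro o
  have heval : o = _ := eval_tryUpperBound M q (M.submatrix i.succAbove i.succAbove) _ i c
  have hcpos : (0 : WithTop ℝ) < (c : ℝ) := hc ▸ hu i
  rcases eval_pppa_spec (fixedTerm M q i c) (hM.submatrix i.succAbove) hC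
    (fun j => hu (i.succAbove j)) with ⟨y, hy, hkkt⟩ | ⟨hy, v, hv⟩ <;> simp only [hy] at heval
  · split_ifs at heval with hgrad
    · refine .inr ⟨heval, fun x hx hpos => (hx i).le.lt_of_ne fun hi => ?_⟩
      have heq := hx.gradient_eq_of_fixed hM (WithTop.coe_injective (hi.trans hc)) hkkt
      exact absurd ((hx i).grad_nonpos hpos) (by rw [heq]; exact hgrad.not_ge)
    · refine .inl ⟨_, heval, .inl ⟨_, rfl,
        kkt_insertNth hkkt ⟨?_, ?_, fun _ => not_lt.1 hgrad, ?_⟩⟩⟩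
      all_goals simp only [Fin.insertNth_apply_same, hc, le_refl, lt_self_iff_false, false_imp_iff]
      exact_mod_cast hcpos.le
  · exact .inl ⟨_, heval, .inr ⟨rfl, _, isRay_insertNth hM hv⟩⟩

theorem tryIndex_spec (hM : M.PosSemidef)
    (hC : (comparisonMatrix (M.submatrix i.succAbove i.succAbove)).PosSemidef)
    (hu : ∀ i, 0 < u i) :
    (∃ o, (tryIndex M q u i).eval = some o ∧ Resolves M q u o) ∨
      ((tryIndex M q u i).eval = none ∧
        ∀ x, KKT M q u x → 0 < x i ∧ (x i : WithTop ℝ) < u i) := by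
  have heval := eval_tryIndex M q u i
  have hupos : ((0 : ℝ) : WithTop ℝ) < u i := hu i
  obtain ⟨o, ho⟩ : ∃ o, (pppa (fun j k => M (i.succAbove j) (i.succAbove k)) (fixedTerm M q i 0)
    (fun j => u (i.succAbove j))).eval = o := ⟨_, rfl⟩
  have hspec : Resolves (M.submatrix i.succAbove i.succAbove) (fixedTerm M q i 0)
      (fun j => u (i.succAbove j)) o :=
    ho ▸ eval_pppa_spec (fixedTerm M q i 0) (hM.submatrix i.succAbove) hC fun j => hu _
  simp only [ho] at heval
  rcases hspec with ⟨y, rfl, hkkt⟩ | ⟨rfl, v, hv⟩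
  swap
  · exact .inl ⟨_, heval, .inr ⟨rfl, _, isRay_insertNth hM hv⟩⟩
  dsimp only at heval
  split_ifs at heval with hgrad
  · have hpos (x : Fin (n + 1) → ℝ) (hx : KKT M q u x) : 0 < x i := by
      refine (hx i).nonneg.lt_of_ne fun hi => ?_
      have heq := hx.gradient_eq_of_fixed hM hi.symm hkkt
      exact absurd ((hx i).grad_nonneg (hi ▸ hupos)) (by rw [heq]; exact hgrad.not_ge)
    rcases hui : u i with _ | c
    · exact .inr ⟨by simpa only [hui] using heval, fun x hx => ⟨hpos x hx, WithTop.coe_lt_top _⟩⟩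
    · have hc : u i = c := hui
      simp only [hui] at heval
      rcases tryUpperBound_spec (q := q) hM hC hu hc with ⟨o, hval, ho⟩ | ⟨hval, hlt⟩
      · exact .inl ⟨o, heval.trans hval, ho⟩
      · exact .inr ⟨heval.trans hval, fun x hx => ⟨hpos x hx, hui ▸ hlt x hx (hpos x hx)⟩⟩
  · exact .inl ⟨_, heval, .inl ⟨_, rfl, kkt_insertNth hkkt
      ⟨by simp, by simpa using hupos.le, by simp, fun _ => not_lt.1 hgrad⟩⟩⟩

/-- What the reduced problems of the indices below `m` have shown: either one of them has resolved
the quadratic program, or no solution has one of these variables at a bound. -/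
def SettledBelow (M : Matrix (Fin (n + 1)) (Fin (n + 1)) ℝ) (q : Fin (n + 1) → ℝ)
    (u : Fin (n + 1) → WithTop ℝ) (m : ℕ) (res : Option (Outcome ℝ (n + 1))) : Prop :=
  (∃ o, res = some o ∧ Resolves M q u o) ∨ (res = none ∧ ∀ j : Fin (n + 1), j.1 < m →
    ∀ x, KKT M q u x → 0 < x j ∧ (x j : WithTop ℝ) < u j)

theorem SettledBelow.tryIndex (hM : M.PosSemidef)
    (hC : (comparisonMatrix (M.submatrix i.succAbove i.succAbove)).PosSemidef)
    (hu : ∀ i, 0 < u i) (h : SettledBelow M q u i.1 none) :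
    SettledBelow M q u (i.1 + 1) (tryIndex M q u i).eval := by
  rcases h with ⟨o, ho, -⟩ | ⟨-, h⟩
  · cases ho
  rcases tryIndex_spec (q := q) hM hC hu with hsome | ⟨hnone, hi⟩
  · exact .inl hsome
  refine .inr ⟨hnone, fun j hj => ?_⟩
  rcases Nat.lt_succ_iff_lt_or_eq.1 hj with hj | hj
  · exact h j hj
  · exact Fin.ext hj ▸ hi

theorem Resolves.isOptimal_or (hM : M.PosSemidef) {o : Outcome ℝ (n + 1)}
    (h : Resolves M q u o) :
    (∃ x, o = .optimal x ∧ IsOptimal M q u x) ∨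
      (o = .noSolution ∧ ¬ ∃ x, IsOptimal M q u x) :=
  h.imp (fun ⟨x, ho, hx⟩ => ⟨x, ho, hx.isOptimal hM⟩)
    fun ⟨ho, _, hv⟩ => ⟨ho, hv.not_exists_isOptimal (posSemidef_isSymm hM)⟩

theorem isOptimal_iff_solvesOn (hM : M.PosSemidef)
    (h : ∀ j x, KKT M q u x → 0 < x j ∧ (x j : WithTop ℝ) < u j) (x : Fin (n + 1) → ℝ) :
    IsOptimal M q u x ↔ SolvesOn M q u (fun _ => true) x := by
  refine ⟨fun hopt j _ => ?_, fun hs => KKT.isOptimal hM fun j => ?_⟩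
  · have hx := hopt.kkt (posSemidef_isSymm hM)
    obtain ⟨hpos, hlt⟩ := h j x hx
    exact ⟨le_antisymm ((hx j).grad_nonpos hpos) ((hx j).grad_nonneg hlt), (hx j).nonneg, (hx j).le⟩
  · obtain ⟨hgrad, hnonneg, hle⟩ := hs j rfl
    exact ⟨hnonneg, hle, fun _ => hgrad.le, fun _ => hgrad.ge⟩

theorem resolveQP_spec (hM : M.PosSemidef)
    (hC : ∀ i : Fin (n + 1), (comparisonMatrix (M.submatrix i.succAbove i.succAbove)).PosSemidef)
    (hu : ∀ i, 0 < u i) :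
    (∃ x, (resolveQP M q u).eval = .optimal x ∧ IsOptimal M q u x) ∨
      ((resolveQP M q u).eval = .noSolution ∧ ¬ ∃ x, IsOptimal M q u x) := by
  simp only [resolveQP, eval_bind]
  generalize hloop : (loop (K := ℝ) (n := n + 1) (none : Option (Outcome ℝ (n + 1))) _).eval = res
  have hsettled : SettledBelow M q u (n + 1) res := by
    refine hloop ▸ loop_induction (SettledBelow M q u) (.inr ⟨rfl, fun j hj => ?_⟩) ?_
    · exact absurd hj j.1.not_lt_zero
    · rintro i (_ | o) h
      · exact h.tryIndex hM (hC i) hu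
      · exact h.imp_right fun ⟨hnone, _⟩ => nomatch hnone
  rcases hsettled with ⟨o, rfl, ho⟩ | ⟨rfl, h⟩
  · exact ho.isOptimal_or hM
  · simpa only [isOptimal_iff_solvesOn hM fun j => h j j.2] using
      finalCheck_spec (posSemidef_isSymm hM) hC q u

end Resolve

theorem WeaklyQuasiDominant.posSemidef_comparisonMatrix {n : ℕ}
    {M : Matrix (Fin (n + 1)) (Fin (n + 1)) ℝ} (h : WeaklyQuasiDominant 1 M) (i : Fin (n + 1)) :
    (comparisonMatrix (M.submatrix i.succAbove i.succAbove)).PosSemidef := by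
  let f (j : Fin n) : (univ.erase i : Finset (Fin (n + 1))) :=
    ⟨i.succAbove j, by simp [Fin.succAbove_ne]⟩
  have hf : f.Injective := fun j k hjk =>
    Fin.succAbove_right_injective (congrArg Subtype.val hjk)
  have hsub := (h.2 (univ.erase i) (by simp)).submatrix f
  rwa [← comparisonMatrix_submatrix _ hf, submatrix_submatrix] at hsub
/-! ## The number of operations -/

section Cost

variable {K α β σ : Type} [Field K] [LinearOrder K] {n : ℕ}

theorem cost_bind_add_le {a c d : ℕ} {p : Prog K α} {f : α → Prog K β} (h : p.cost ≤ a)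
    (hf : ∀ x, (f x).cost + (a + d) ≤ c) : (p >>= f).cost + d ≤ c := by
  have hcont := hf p.eval
  rw [cost_bind]
  omega

theorem cost_bind_le {a c : ℕ} {p : Prog K α} {f : α → Prog K β} (h : p.cost ≤ a)
    (hf : ∀ x, (f x).cost + a ≤ c) : (p >>= f).cost ≤ c := by
  have hcont := hf p.eval
  rw [cost_bind]
  omega

theorem cost_dotProductOn_le (c : Fin n → Bool) (v w : Fin n → K) :
    (sumOn c fun j => mul (v j) (w j)).cost ≤ n * 3 + 1 :=
  cost_sumOn_le fun _ => le_rfl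

theorem cost_transform_le (M : Fin n → Fin n → K) (inα : Fin n → Bool) (B : Fin n → Fin n → K)
    (r : Fin n → K) : (transform M inα B r).cost ≤ 6 * (n + 1) ^ 2 := by
  refine cost_bind_le (cost_tab_le fun i => cost_dotProductOn_le inα (B i) r) fun y => ?_
  refine (Nat.add_le_add_right (cost_tab_le (c := n * 3 + 2) fun i => ?_) _).trans (by nlinarith)
  have hrow := cost_dotProductOn_le inα (M i) y
  simp only [cost_ite, cost_bind, cost_pure, cost_sub]
  split_ifs <;> omega

theorem cost_schurEntry_le (M : Fin n → Fin n → K) (inα : Fin n → Bool) (B : Fin n → Fin n → K)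
    (i : Fin n) : (schurEntry M inα B i).cost ≤ 3 * (n + 1) ^ 2 := by
  refine cost_bind_le (cost_tab_le fun k => cost_dotProductOn_le inα (B k) fun j => M j i)
    fun h => ?_
  refine cost_bind_add_le (cost_dotProductOn_le inα (M i) h) fun t => ?_
  refine cost_bind_add_le le_rfl fun s => ?_
  simp only [cost_pure, cost_sub]
  nlinarith

theorem cost_addIndex_le (B : Fin n → Fin n → K) (i : Fin n) (h : Fin n → K) (s : K) :
    (addIndex B i h s).cost ≤ 4 * (n + 1) ^ 2 := by
  refine (cost_tab2_le (c := 3) fun k l => ?_).trans (by nlinarith)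
  split_ifs <;> simp

theorem cost_dropIndex_le (B : Fin n → Fin n → K) (j : Fin n) :
    (dropIndex B j).cost ≤ 4 * (n + 1) ^ 2 := by
  refine (cost_tab2_le (c := 3) fun k l => ?_).trans (by nlinarith)
  simp

theorem cost_shiftedLinearTerm_le (M : Fin n → Fin n → K) (q : Fin n → K) (u : Fin n → WithTop K)
    (st : Fin n → Status) : (shiftedLinearTerm M q u st).cost ≤ 3 * (n + 1) ^ 2 := by
  refine (cost_tab_le (c := n * 3 + 2) fun i => ?_).trans (by nlinarith)
  refine cost_bind_le (cost_sumOn_le (b := 1) fun k => ?_) fun t => ?_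
  · rcases u k with _ | c <;> exact le_rfl
  · simp only [cost_add]; omega

theorem cost_keepMax_le {τ : Type} (best : Option (K × τ)) (r : K) (t : τ) :
    (keepMax best r t).cost ≤ 1 := by
  rcases best with _ | b <;> simp [keepMax]

theorem cost_keepMin_le {τ : Type} (best : Option (K × τ)) (r : K) (t : τ) :
    (keepMin best r t).cost ≤ 1 := by
  rcases best with _ | b <;> simp [keepMin]

theorem cost_criticalValue_le (u : Fin n → WithTop K) (st : Fin n → Status) (qb pb : Fin n → K) :
    (criticalValue u st qb pb).cost ≤ 8 * n := by
  refine (cost_loop_le (c := 7) fun best i => ?_).trans (by omega)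
  refine cost_bind_le (cost_isPos _).le fun b => ?_
  have hk := fun r => cost_keepMax_le best r i
  rcases b
  · simp
  · rcases st i <;> rcases u i with _ | c <;> simp
    all_goals grind

theorem cost_blockingValue_le (u : Fin n → WithTop K) (st : Fin n → Status) (qb pb h : Fin n → K)
    (τ : K) (i : Fin n) : (blockingValue u st qb pb h τ i).cost ≤ 12 * n + 1 := by
  refine cost_bind_le (a := n * 12) (cost_loop_le fun best j => ?_) fun best => ?_
  · split_ifs
    · refine cost_bind_le (cost_mul _ _).le fun _ => ?_
      refine cost_bind_add_le (cost_add _ _).le fun _ => ?_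
      refine cost_bind_add_le (cost_isPos _).le fun b => ?_
      rcases b
      · refine cost_bind_add_le (cost_isNeg _).le fun b => ?_
        rcases b
        · simp
        · rcases u j with _ | c
          · simp
          · refine cost_bind_add_le (cost_add _ _).le fun _ => ?_
            refine cost_bind_add_le (cost_neg _).le fun _ => ?_
            refine cost_bind_add_le (cost_div _ _).le fun _ => ?_
            exact Nat.add_le_add_right (cost_keepMin_le _ _ _) _
      · refine cost_bind_add_le (cost_neg _).le fun _ => ?_
        refine cost_bind_add_le (cost_div _ _).le fun _ => ?_
        exact (Nat.add_le_add_right (cost_keepMin_le _ _ _) _).trans (by omega)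
    · simp
  · rcases u i with _ | c
    · simp; omega
    · exact (Nat.add_le_add_right (cost_keepMin_le _ _ _) _).trans (by omega)

section PivotLoop

omit [Field K] [LinearOrder K]

/-- The part of `pivotLoop` that follows the determination of the positive critical value, if there
is one, together with its index; the remaining iterations are `next`. -/
def pivotOrStop (M : Fin n → Fin n → K) (u : Fin n → WithTop K)
    (next : (Fin n → Status) → (Fin n → Fin n → K) → Prog K (Outcome K n))
    (st : Fin n → Status) (B : Fin n → Fin n → K) (qb pb : Fin n → K) :
    Option (K × Fin n) → Prog K (Outcome K n)
  | none => do
    let x ← tab fun i => match st i, u i with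
      | .between, _ => neg (qb i)
      | .lower, _ => lit 0
      | .upper, (c : K) => pure c
      | .upper, ⊤ => lit 0
    pure (.optimal x)
  | some (τ, i) =>
    if st i = .between then do next (Function.update st i .upper) (← dropIndex B i)
    else do
      let (h, s) ← schurEntry M (isBetween st) B i
      if ← isPos s then next (Function.update st i .between) (← addIndex B i h s)
      else
        match ← blockingValue u st qb pb h τ i with
        | none => pure .noSolution
        | some (_, j, side) =>
          if j = i then next (Function.update st i .upper) B
          else do
            let st' := Function.update st j side
            let B' ← dropIndex B j
            let (h', s') ← schurEntry M (isBetween st') B' i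
            next (Function.update st' i .between) (← addIndex B' i h' s')

theorem pivotLoop_succ (M : Fin n → Fin n → K) (q : Fin n → K) (u : Fin n → WithTop K)
    (p : Fin n → K) (fuel : ℕ) (st : Fin n → Status) (B : Fin n → Fin n → K) :
    pivotLoop M q u p (fuel + 1) st B = (do
      step
      let qb ← transform M (isBetween st) B (← shiftedLinearTerm M q u st)
      let pb ← transform M (isBetween st) B p
      let crit ← do match ← criticalValue u st qb pb with
        | none => pure none
        | some c => do if ← isPos c.1 then pure (some c) else pure none
      pivotOrStop M u (pivotLoop M q u p fuel) st B qb pb crit) :=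
  rfl

end PivotLoop

theorem cost_pivotOrStop_le (M : Fin n → Fin n → K) (u : Fin n → WithTop K)
    {next : (Fin n → Status) → (Fin n → Fin n → K) → Prog K (Outcome K n)} {c : ℕ}
    (hnext : ∀ st B, (next st B).cost ≤ c) (st : Fin n → Status) (B : Fin n → Fin n → K)
    (qb pb : Fin n → K) (crit : Option (K × Fin n)) :
    (pivotOrStop M u next st B qb pb crit).cost ≤ c + 30 * (n + 1) ^ 2 := by
  have hn : n + 1 ≤ (n + 1) ^ 2 := Nat.le_self_pow two_ne_zero _
  have hlast (st B) {d : ℕ} (hd : d ≤ 30 * (n + 1) ^ 2) :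
      (next st B).cost + d ≤ c + 30 * (n + 1) ^ 2 := Nat.add_le_add (hnext st B) hd
  rcases crit with _ | ⟨τ, i⟩ <;> dsimp only [pivotOrStop]
  · refine cost_bind_le (a := n * 3) (cost_tab_le fun i => ?_) fun _ => ?_
    · rcases st i <;> rcases u i with _ | c <;> simp
    · simp only [cost_pure]; omega
  split_ifs
  · exact cost_bind_le (cost_dropIndex_le _ _) fun _ => hlast _ _ (by omega)
  refine cost_bind_le (cost_schurEntry_le _ _ _ _) fun (h, s) => ?_
  refine cost_bind_add_le (cost_isPos _).le fun b => ?_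
  split_ifs
  · exact cost_bind_add_le (cost_addIndex_le _ _ _ _) fun _ => hlast _ _ (by omega)
  refine cost_bind_add_le (cost_blockingValue_le _ _ _ _ _ _ _) fun t => ?_
  rcases t with _ | ⟨_, j, side⟩
  · simp only [cost_pure]; omega
  dsimp only
  split_ifs
  · exact hlast _ _ (by omega)
  refine cost_bind_add_le (cost_dropIndex_le _ _) fun _ => ?_
  refine cost_bind_add_le (cost_schurEntry_le _ _ _ _) fun (h, s) => ?_
  exact cost_bind_add_le (cost_addIndex_le _ _ _ _) fun _ => hlast _ _ (by omega)

theorem cost_pivotLoop_le (M : Fin n → Fin n → K) (q : Fin n → K) (u : Fin n → WithTop K)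
    (p : Fin n → K) : ∀ (fuel : ℕ) (st : Fin n → Status) (B : Fin n → Fin n → K),
    (pivotLoop M q u p fuel st B).cost ≤ fuel * (60 * (n + 1) ^ 2)
  | 0, _, _ => by simp [pivotLoop]
  | fuel + 1, st, B => by
    have hn : n + 1 ≤ (n + 1) ^ 2 := Nat.le_self_pow two_ne_zero _
    rw [pivotLoop_succ, Nat.succ_mul]
    refine cost_bind_le cost_step.le fun _ => ?_
    refine cost_bind_add_le (cost_shiftedLinearTerm_le M q u st) fun _ => ?_
    refine cost_bind_add_le (cost_transform_le _ _ _ _) fun qb => ?_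
    refine cost_bind_add_le (cost_transform_le _ _ _ _) fun pb => ?_
    have hrest (crit : Option (K × Fin n)) {d : ℕ} (hd : d ≤ 30 * (n + 1) ^ 2) :
        (pivotOrStop M u (pivotLoop M q u p fuel) st B qb pb crit).cost + d ≤
          fuel * (60 * (n + 1) ^ 2) + 60 * (n + 1) ^ 2 := by
      have hle := cost_pivotOrStop_le M u (cost_pivotLoop_le M q u p fuel) st B qb pb crit
      omega
    refine cost_bind_add_le (cost_criticalValue_le u st qb pb) fun crit => ?_
    rcases crit with _ | c
    · exact cost_bind_add_le (cost_pure _).le fun _ => hrest _ (by omega)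
    · refine cost_bind_add_le (cost_isPos _).le fun b => ?_
      split_ifs <;> exact cost_bind_add_le (cost_pure _).le fun _ => hrest _ (by omega)

theorem cost_comparison_le (M : Fin n → Fin n → K) :
    (comparison M).cost ≤ 5 * (n + 1) ^ 2 := by
  refine (cost_tab2_le (c := 4) fun i j => ?_).trans (by nlinarith)
  simp only [cost_ite, cost_bind, cost_pure, cost_isPos, cost_neg]
  split_ifs <;> omega

theorem cost_parametricVector_le (M : Fin n → Fin n → K) (d : Fin n → K) :
    (parametricVector M d).cost ≤ 10 * (n + 1) ^ 2 := by
  refine cost_bind_le (cost_comparison_le M) fun C => ?_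
  refine cost_bind_add_le (cost_lit _).le fun two => ?_
  refine (Nat.add_le_add_right (cost_tab_le (c := n * 4 + 2) fun i => ?_) _).trans (by nlinarith)
  refine cost_bind_le (cost_sumOn_le (b := 2) fun j => ?_) fun _ => ?_
  · simp
  · simp only [cost_div]; omega

theorem cost_dominanceVector_le : ∀ {n : ℕ} (A : Fin n → Fin n → K),
    (dominanceVector A).cost ≤ 8 * n ^ 3
  | 0, _ => by simp [dominanceVector]
  | n + 1, A => by
    have ih (S : Fin n → Fin n → K) := cost_dominanceVector_le S
    suffices h : (dominanceVector A).cost ≤ 8 * n ^ 3 + (4 * n ^ 2 + 4 * n + 8) from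
      h.trans (by nlinarith)
    unfold dominanceVector
    refine cost_bind_le (cost_isPos _).le fun b => ?_
    split_ifs
    · refine cost_bind_add_le (cost_tab2_le (c := 3) fun j k => ?_) fun S => ?_
      · simp
      refine cost_bind_add_le (ih S) fun d => ?_
      refine cost_bind_add_le (cost_sumOn_le (b := 1) fun k => le_rfl) fun t => ?_
      refine cost_bind_add_le (cost_isNeg _).le fun b => ?_
      split_ifs <;> simp <;> nlinarith
    · refine cost_bind_add_le (cost_tab2_le (c := 0) fun j k => le_rfl) fun S => ?_
      refine cost_bind_add_le (ih S) fun d => ?_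
      simp
      nlinarith

section Reductions

omit [Field K] [LinearOrder K]

/-- Elimination of `x i`, whose upper bound is infinite, in `reduceAndPivot`; the reduced problem is
solved by `next`. -/
def reduceBySchur (M : Fin (n + 1) → Fin (n + 1) → K) (q : Fin (n + 1) → K) (i : Fin (n + 1))
    (next : (Fin n → Fin n → K) → (Fin n → K) → Prog K (Outcome K n)) :
    Prog K (Outcome K (n + 1)) := do
  let S ← tab2 fun j k => do
    sub (M (i.succAbove j) (i.succAbove k))
      (← div (← mul (M (i.succAbove j) i) (M i (i.succAbove k))) (M i i))
  let r ← tab fun j => do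
    sub (q (i.succAbove j)) (← mul (← div (M (i.succAbove j) i) (M i i)) (q i))
  match ← next S r with
  | .optimal x => do
    let t ← add (q i) (← sumOn (fun _ => true) fun k => mul (M i (i.succAbove k)) (x k))
    pure (.optimal (i.insertNth (← neg (← div t (M i i))) x))
  | .noSolution => pure .noSolution
  | .failed => pure .failed

/-- Replacement of `x i`, whose upper bound is `c`, by `c - z i` in `reduceAndPivot`; the new
problem is solved by `next`. -/
def reduceByReflection (M : Fin (n + 1) → Fin (n + 1) → K) (q : Fin (n + 1) → K) (c : K)
    (i : Fin (n + 1))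
    (next : (Fin (n + 1) → Fin (n + 1) → K) → (Fin (n + 1) → K) → Prog K (Outcome K (n + 1))) :
    Prog K (Outcome K (n + 1)) := do
  let M' ← tab2 fun j k =>
    if (j = i ∧ k ≠ i) ∨ (j ≠ i ∧ k = i) then neg (M j k) else pure (M j k)
  let q' ← tab fun j => do
    let t ← add (q j) (← mul (M j i) c)
    if j = i then neg t else pure t
  match ← next M' q' with
  | .optimal z => do
    pure (.optimal (Function.update z i (← sub c (z i))))
  | .noSolution => pure .noSolution
  | .failed => pure .failed

/-- Separation of `x i`, whose row of the matrix is zero, in `reduceAndPivot`; the problem in the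
other variables is solved by `next`. -/
def separateVariable (q : Fin (n + 1) → K) (u : Fin (n + 1) → WithTop K) (i : Fin (n + 1))
    (next : Prog K (Outcome K n)) : Prog K (Outcome K (n + 1)) := do
  let fixed ← do
    if ← isNeg (q i) then
      match u i with
      | ⊤ => pure none
      | (c : K) => pure (some c)
    else do pure (some (← lit 0))
  match fixed with
  | none => pure .noSolution
  | some c =>
    match ← next with
    | .optimal x => pure (.optimal (i.insertNth c x))
    | .noSolution => pure .noSolution
    | .failed => pure .failed

theorem reduceAndPivot_succ (fuel : ℕ) (M : Fin (n + 1) → Fin (n + 1) → K) (q : Fin (n + 1) → K)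
    (u : Fin (n + 1) → WithTop K) (d : Fin (n + 1) → K) :
    reduceAndPivot (fuel + 1) M q u d = (do
      step
      let p ← parametricVector M d
      let bad ← findFirst fun i => do
        if ← isPos (M i i) then
          if ← isPos (p i) then pure false else isNeg (q i)
        else pure true
      match bad with
      | none => do
        let zero ← tab2 fun _ _ => lit 0
        pivotLoop M q u p (2 * (n + 1) + 1) (fun _ => .lower) zero
      | some i =>
        if ← isPos (M i i) then
          match u i with
          | ⊤ => reduceBySchur M q i (reduceAndPivot fuel · ·
              (fun j => u (i.succAbove j)) (fun j => d (i.succAbove j)))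
          | (c : K) =>
            reduceByReflection M q c i (reduceAndPivot fuel · · (Function.update u i ⊤) d)
        else
          separateVariable q u i (reduceAndPivot fuel
            (fun j k => M (i.succAbove j) (i.succAbove k)) (fun j => q (i.succAbove j))
            (fun j => u (i.succAbove j)) (fun j => d (i.succAbove j)))) :=
  rfl

end Reductions

theorem cost_reduceBySchur_le (M : Fin (n + 1) → Fin (n + 1) → K) (q : Fin (n + 1) → K)
    (i : Fin (n + 1)) {next : (Fin n → Fin n → K) → (Fin n → K) → Prog K (Outcome K n)} {c : ℕ}
    (hnext : ∀ S r, (next S r).cost ≤ c) :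
    (reduceBySchur M q i next).cost ≤ c + 8 * (n + 1) ^ 2 := by
  refine cost_bind_le (cost_tab2_le (c := 3) fun j k => by simp) fun S => ?_
  refine cost_bind_add_le (cost_tab_le (c := 3) fun j => by simp) fun r => ?_
  refine cost_bind_add_le (hnext _ _) fun o => ?_
  rcases o with x | _ | _
  · refine cost_bind_add_le (cost_sumOn_le (b := 1) fun k => le_rfl) fun t => ?_
    simp only [cost_bind, cost_add, cost_div, cost_neg, cost_pure]
    nlinarith
  · simp only [cost_pure]; nlinarith
  · simp only [cost_pure]; nlinarith

theorem cost_reduceByReflection_le (M : Fin (n + 1) → Fin (n + 1) → K) (q : Fin (n + 1) → K)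
    (c : K) (i : Fin (n + 1))
    {next : (Fin (n + 1) → Fin (n + 1) → K) → (Fin (n + 1) → K) → Prog K (Outcome K (n + 1))}
    {b : ℕ} (hnext : ∀ M' q', (next M' q').cost ≤ b) :
    (reduceByReflection M q c i next).cost ≤ b + 8 * (n + 1 + 1) ^ 2 := by
  refine cost_bind_le (cost_tab2_le (c := 2) fun j k => ?_) fun M' => ?_
  · split_ifs <;> simp
  refine cost_bind_add_le (cost_tab_le (c := 4) fun j => ?_) fun q' => ?_
  · simp only [cost_bind, cost_mul, cost_add, cost_ite, cost_neg, cost_pure]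
    split_ifs <;> omega
  refine cost_bind_add_le (hnext _ _) fun o => ?_
  rcases o with x | _ | _ <;>
  · simp only [cost_bind, cost_sub, cost_pure]
    nlinarith

theorem cost_separateVariable_le (q : Fin (n + 1) → K) (u : Fin (n + 1) → WithTop K)
    (i : Fin (n + 1)) {next : Prog K (Outcome K n)} {c : ℕ} (hnext : next.cost ≤ c) :
    (separateVariable q u i next).cost ≤ c + 8 := by
  refine cost_bind_le (cost_isNeg _).le fun b => ?_
  dsimp only
  split_ifs
  on_goal 1 => rcases u i with _ | c
  on_goal 3 => refine cost_bind_add_le (cost_lit _).le fun _ => ?_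
  all_goals
    try dsimp only
    refine cost_bind_add_le (cost_pure _).le fun fixed => ?_
    rcases fixed with _ | c
    · simp only [cost_pure]; omega
    · refine cost_bind_add_le hnext fun o => ?_
      rcases o with x | _ | _ <;> simp only [cost_pure] <;> omega

theorem cost_reduceAndPivot_le {N : ℕ} : ∀ (fuel : ℕ) {n : ℕ} (M : Fin n → Fin n → K)
    (q : Fin n → K) (u : Fin n → WithTop K) (d : Fin n → K), n + 1 ≤ N →
    (reduceAndPivot fuel M q u d).cost ≤ fuel * (40 * N ^ 2) + 130 * N ^ 3
  | 0, _, _, _, _, _, _ => by simp [reduceAndPivot]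
  | _ + 1, 0, _, _, _, _, _ => by simp [reduceAndPivot]
  | fuel + 1, n + 1, M, q, u, d, hn => by
    have ih (n) := cost_reduceAndPivot_le (N := N) fuel (n := n)
    have hsq : (n + 1 + 1) ^ 2 ≤ N ^ 2 := Nat.pow_le_pow_left hn _
    have hexp : (n + 1 + 1) ^ 2 = (n + 1) ^ 2 + 2 * (n + 1) + 1 := by ring
    rw [Nat.succ_mul, add_right_comm, reduceAndPivot_succ]
    generalize fuel * (40 * N ^ 2) = F at ih ⊢
    refine cost_bind_le cost_step.le fun _ => ?_
    refine cost_bind_add_le (cost_parametricVector_le M d) fun p => ?_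
    refine cost_bind_add_le (cost_findFirst_le (c := 6) fun i => ?_) fun bad => ?_
    · simp only [cost_bind, cost_ite, cost_pure, cost_isPos, cost_isNeg]
      split_ifs <;> omega
    rcases bad with _ | i
    · refine cost_bind_add_le (cost_tab2_le (c := 1) fun _ _ => le_rfl) fun zero => ?_
      refine (Nat.add_le_add_right (cost_pivotLoop_le M q u p _ _ zero) _).trans ?_
      have hloop : (2 * (n + 1) + 1) * (60 * (n + 1 + 1) ^ 2) ≤ 120 * N ^ 3 :=
        calc (2 * (n + 1) + 1) * (60 * (n + 1 + 1) ^ 2) ≤ (2 * N) * (60 * N ^ 2) := by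
              gcongr; omega
          _ = 120 * N ^ 3 := by ring
      nlinarith
    · refine cost_bind_add_le (cost_isPos _).le fun b => ?_
      split_ifs
      · rcases u i with _ | c
        · have hle := cost_reduceBySchur_le M q i fun S r => ih n S r
            (fun j => u (i.succAbove j)) (fun j => d (i.succAbove j)) (by omega)
          dsimp only
          omega
        · have hle := cost_reduceByReflection_le M q c i fun M' q' => ih _ M' q'
            (Function.update u i ⊤) d hn
          dsimp only
          omega
      · have hle := cost_separateVariable_le q u i (ih n (fun j k => M (i.succAbove j)
          (i.succAbove k)) (fun j => q (i.succAbove j)) (fun j => u (i.succAbove j))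
          (fun j => d (i.succAbove j)) (by omega))
        omega

theorem cost_pppa_le (M : Fin n → Fin n → K) (q : Fin n → K) (u : Fin n → WithTop K) :
    (pppa M q u).cost ≤ 250 * (n + 1) ^ 3 := by
  refine cost_bind_le (cost_comparison_le M) fun C => ?_
  refine cost_bind_add_le (cost_dominanceVector_le C) fun d => ?_
  refine (Nat.add_le_add_right (cost_reduceAndPivot_le (N := n + 1) _ M q u d le_rfl) _).trans ?_
  nlinarith

theorem cost_solveOneVar_le (L : List (K × K)) : (solveOneVar L).cost ≤ 14 * L.length + 1 := by
  refine cost_bind_le (cost_lit _).le fun zero => ?_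
  refine cost_bind_add_le (cost_loopList_le (c := 8) (fun b e => ?_) L _) fun bounds => ?_
  · refine cost_bind_le (cost_isPos _).le fun p => ?_
    split_ifs
    · refine cost_bind_add_le (cost_div _ _).le fun _ => ?_
      refine cost_bind_add_le (cost_neg _).le fun _ => ?_
      refine cost_bind_add_le (cost_keepMax_le _ _ _) fun _ => ?_
      simp
    · refine cost_bind_add_le (cost_isNeg _).le fun p => ?_
      split_ifs
      · refine cost_bind_add_le (cost_div _ _).le fun _ => ?_
        refine cost_bind_add_le (cost_neg _).le fun _ => ?_
        refine cost_bind_add_le (cost_keepMin_le _ _ _) fun _ => ?_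
        simp
      · simp
  · refine cost_bind_add_le (cost_loopList_le (c := 4) (fun ok e => ?_) L _) fun ok => ?_
    · simp
    · simp only [cost_pure]; omega

section TwoVariables

omit [Field K] [LinearOrder K]

/-- The inequalities of `L` with positive, with negative, and with zero coefficient of the second
variable. -/
def splitBySign (L : List (K × K × K)) :
    Prog K (List (K × K × K) × List (K × K × K) × List (K × K)) :=
  loopList L (([], [], []) : List (K × K × K) × List (K × K × K) × List (K × K)) fun s e => do
    if ← isPos e.2.1 then pure (e :: s.1, s.2.1, s.2.2)
    else if ← isNeg e.2.1 then pure (s.1, e :: s.2.1, s.2.2)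
    else pure (s.1, s.2.1, (e.1, e.2.2) :: s.2.2)

/-- The combinations of an inequality `e` with those of `N` in which the second variable cancels,
prepended to `L`. -/
def combineWith (N : List (K × K × K)) (L : List (K × K)) (e : K × K × K) :
    Prog K (List (K × K)) :=
  loopList N L fun acc f => do
    let a ← sub (← mul e.2.1 f.1) (← mul f.2.1 e.1)
    let c ← sub (← mul e.2.1 f.2.2) (← mul f.2.1 e.2.2)
    pure ((a, c) :: acc)

/-- The inequalities of `L` in the second variable for the value `y` of the first. -/
def substituteFirst (L : List (K × K × K)) (y : K) : Prog K (List (K × K)) :=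
  loopList L [] fun acc e => do
    pure ((e.2.1, ← add (← mul e.1 y) e.2.2) :: acc)

theorem solveTwoVar_eq (L : List (K × K × K)) :
    solveTwoVar L = (do
      let parts ← splitBySign L
      let elim ← loopList parts.1 parts.2.2 (combineWith parts.2.1)
      match ← solveOneVar elim with
      | none => pure none
      | some y => do
        match ← solveOneVar (← substituteFirst L y) with
        | none => pure none
        | some z => pure (some (y, z))) :=
  rfl

end TwoVariables

theorem cost_splitBySign_le (L : List (K × K × K)) : (splitBySign L).cost ≤ 5 * L.length := by
  refine (cost_loopList_le (c := 4) (fun s e => ?_) L _).trans (by omega)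
  simp only [cost_bind, cost_ite, cost_pure, cost_isPos, cost_isNeg]
  split_ifs <;> omega

theorem length_splitBySign_le (L : List (K × K × K)) :
    (splitBySign L).eval.1.length + (splitBySign L).eval.2.1.length +
      (splitBySign L).eval.2.2.length ≤ L.length := by
  refine loopList_induction (fun l (s : List (K × K × K) × List (K × K × K) × List (K × K)) =>
    s.1.length + s.2.1.length + s.2.2.length ≤ l.length) (by simp) (fun l a s h => ?_) L
  simp only [eval_bind, eval_ite, eval_pure, List.length_append, List.length_singleton]
  split_ifs <;> simp only [List.length_cons] <;> omega

theorem cost_loopList_combineWith_le (P N : List (K × K × K)) (L : List (K × K)) :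
    (loopList (K := K) P L (combineWith N)).cost ≤ P.length * (7 * N.length + 1) := by
  refine cost_loopList_le (c := 7 * N.length) (fun acc e => ?_) P L
  exact (cost_loopList_le (c := 6) (fun acc f => by simp) N acc).trans (by omega)

theorem length_combineWith_le (N : List (K × K × K)) (L : List (K × K)) (e : K × K × K) :
    (combineWith N L e).eval.length ≤ L.length + N.length :=
  loopList_induction (fun l (t : List (K × K)) => t.length ≤ L.length + l.length) (by simp)
    (fun l b t ht => by simp; omega) N

theorem length_loopList_combineWith_le (P N : List (K × K × K)) (L : List (K × K)) :
    (loopList (K := K) P L (combineWith N)).eval.length ≤ L.length + P.length * N.length := by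
  refine loopList_induction (fun l (s : List (K × K)) =>
    s.length ≤ L.length + l.length * N.length) (by simp) (fun l a s h => ?_) P
  refine (length_combineWith_le N s a).trans ?_
  simp only [List.length_append, List.length_singleton, Nat.succ_mul]
  omega

theorem cost_substituteFirst_le (L : List (K × K × K)) (y : K) :
    (substituteFirst L y).cost ≤ 3 * L.length :=
  (cost_loopList_le (c := 2) (fun acc e => by simp) L _).trans (by omega)

theorem length_substituteFirst_le (L : List (K × K × K)) (y : K) :
    (substituteFirst L y).eval.length ≤ L.length :=
  loopList_induction (fun l (s : List (K × K)) => s.length ≤ l.length) (by simp)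
    (fun l a s h => by simpa using h) L

theorem cost_solveTwoVar_le (L : List (K × K × K)) :
    (solveTwoVar L).cost ≤ 50 * (L.length + 1) ^ 2 := by
  have hsplit := cost_splitBySign_le L
  have hparts := length_splitBySign_le L
  rw [solveTwoVar_eq, cost_bind]
  generalize (splitBySign L).eval = parts at hparts ⊢
  have helim := cost_loopList_combineWith_le parts.1 parts.2.1 parts.2.2
  have hlen := length_loopList_combineWith_le parts.1 parts.2.1 parts.2.2
  rw [cost_bind]
  generalize (loopList parts.1 parts.2.2 (combineWith parts.2.1)).eval = elim at hlen ⊢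
  have hcost : parts.1.length * (7 * parts.2.1.length + 1) ≤ 7 * (L.length + 1) ^ 2 := by nlinarith
  have hlen' : elim.length ≤ (L.length + 1) ^ 2 := by nlinarith
  have hsq : L.length + 1 ≤ (L.length + 1) ^ 2 := Nat.le_self_pow two_ne_zero _
  rw [← add_assoc, add_comm]
  refine cost_bind_add_le (cost_solveOneVar_le elim) fun y => ?_
  rcases y with _ | y
  · simp only [cost_pure]; omega
  · have hsubst := cost_substituteFirst_le L y
    have hrest := length_substituteFirst_le L y
    dsimp only
    rw [cost_bind, add_right_comm, add_comm]
    refine cost_bind_add_le (cost_solveOneVar_le _) fun z => ?_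
    rcases z with _ | z <;> simp only [cost_pure] <;> omega

theorem cost_blockRow_le (u : Fin n → WithTop K) (inC inα : Fin n → Bool) (b₁ : Fin n)
    (g₁ g₂ qb : Fin n → K) (zero one : K) (L : List (K × K × K)) (k : Fin n) :
    (blockRow u inC inα b₁ g₁ g₂ qb zero one L k).cost ≤ 8 := by
  unfold blockRow
  split_ifs <;> rcases u k with _ | c <;> simp

theorem length_blockRow_le (u : Fin n → WithTop K) (inC inα : Fin n → Bool) (b₁ : Fin n)
    (g₁ g₂ qb : Fin n → K) (zero one : K) (L : List (K × K × K)) (k : Fin n) :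
    (blockRow u inC inα b₁ g₁ g₂ qb zero one L k).eval.length ≤ L.length + 4 := by
  unfold blockRow
  split_ifs <;> rcases u k with _ | c <;> simp

theorem cost_blockSolution_le (u : Fin n → WithTop K) (inC inα : Fin n → Bool) (b₁ : Fin n)
    (b₂ : Option (Fin n)) (x : Fin n → K) (g₁ g₂ qb : Fin n → K) (zero one : K) :
    (blockSolution u inC inα b₁ b₂ x g₁ g₂ qb zero one).cost ≤ 1000 * (n + 1) ^ 2 := by
  unfold blockSolution
  rw [cost_bind, add_comm]
  refine (Nat.add_le_add_left (cost_loop_le (c := 8) fun L k =>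
    cost_blockRow_le u inC inα b₁ g₁ g₂ qb zero one L k) _).trans ?_
  generalize hL : (loop (K := K) ([] : List (K × K × K)) _).eval = L
  have hl : L.length ≤ 4 * n := by
    rw [← hL]
    refine loop_induction (fun m (L : List (K × K × K)) => L.length ≤ 4 * m) (by simp)
      fun i t ht => (length_blockRow_le _ _ _ _ _ _ _ _ _ _ _).trans (by omega)
  refine cost_bind_add_le (a := 50 * (4 * n + 1) ^ 2) ((cost_solveTwoVar_le L).trans ?_)
    fun s => ?_
  · gcongr
  · rcases s with _ | ⟨y, z⟩
    · simp only [cost_pure]; nlinarith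
    · refine cost_bind_add_le (cost_tab_le (c := 6) fun k => ?_) fun _ => ?_
      · split_ifs <;> simp
      · simp only [cost_pure]; nlinarith

theorem cost_blockInverse_le (M : Fin n → Fin n → K) (inα : Fin n → Bool)
    (Z : Fin n → Fin n → K) : (blockInverse M inα Z).cost ≤ 8 * (n + 1) ^ 3 := by
  refine (cost_loop_le (c := 7 * (n + 1) ^ 2) fun s k => ?_).trans (by nlinarith)
  split_ifs
  · refine cost_bind_le (cost_schurEntry_le _ _ _ _) fun (h, e) => ?_
    refine cost_bind_add_le (cost_addIndex_le _ _ _ _) fun _ => ?_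
    simp only [cost_pure]
    omega
  · simp

theorem cost_solveBlock_le (M : Fin n → Fin n → K) (q : Fin n → K) (u : Fin n → WithTop K)
    (inC : Fin n → Bool) (b₁ : Fin n) (x : Fin n → K) :
    (solveBlock M q u inC b₁ x).cost ≤ 1050 * (n + 1) ^ 3 := by
  have hsq : n + 1 ≤ (n + 1) ^ 2 := Nat.le_self_pow two_ne_zero _
  have hcube : (n + 1) ^ 2 ≤ (n + 1) ^ 3 := Nat.pow_le_pow_right (by omega) (by omega)
  have hZ : n * (n * (0 + 1) + 1) ≤ (n + 1) ^ 2 := by nlinarith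
  rw [solveBlock_eq]
  refine cost_bind_le (cost_lit _).le fun zero => ?_
  refine cost_bind_add_le (cost_lit _).le fun one => ?_
  refine cost_bind_add_le (cost_findFirst_le (c := 0) fun _ => le_rfl) fun b₂ => ?_
  refine cost_bind_add_le (cost_tab2_le (c := 0) fun _ _ => le_rfl) fun Z => ?_
  refine cost_bind_add_le (cost_blockInverse_le _ _ _) fun (_, B) => ?_
  refine cost_bind_add_le (cost_transform_le _ _ _ _) fun qb => ?_
  refine cost_bind_add_le (cost_transform_le _ _ _ _) fun g₁ => ?_
  rcases b₂ with _ | b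
  · refine cost_bind_add_le (cost_tab_le (c := 0) fun _ => le_rfl) fun g₂ => ?_
    exact (Nat.add_le_add_right (cost_blockSolution_le _ _ _ _ _ _ _ _ _ _ _) _).trans (by omega)
  · refine cost_bind_add_le (cost_transform_le _ _ _ _) fun g₂ => ?_
    exact (Nat.add_le_add_right (cost_blockSolution_le _ _ _ _ _ _ _ _ _ _ _) _).trans (by omega)

theorem cost_sameBlock_le (M : Fin n → Fin n → K) : (sameBlock M).cost ≤ 10 * (n + 1) ^ 3 := by
  refine cost_bind_le (cost_tab2_le (c := 4) fun i j => ?_) fun R => ?_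
  · simp only [cost_ite, cost_bind, cost_pure, cost_isPos, cost_isNeg]
    split_ifs <;> omega
  · refine (Nat.add_le_add_right (cost_loop_le fun R k => cost_tab2_le (c := 0)
      fun i j => le_rfl) _).trans ?_
    nlinarith [Nat.zero_le (n ^ 2), Nat.zero_le (n ^ 3)]

theorem cost_finalCheck_le (M : Fin n → Fin n → K) (q : Fin n → K) (u : Fin n → WithTop K) :
    (finalCheck M q u).cost ≤ 1100 * (n + 1) ^ 4 := by
  have hcube : n + 1 ≤ (n + 1) ^ 3 := Nat.le_self_pow (by omega) _
  refine cost_bind_le (cost_sameBlock_le M) fun R => ?_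
  refine cost_bind_add_le (cost_tab_le (c := 1) fun _ => le_rfl) fun x₀ => ?_
  refine cost_bind_add_le (cost_loop_le (c := 1051 * (n + 1) ^ 3) fun s i => ?_) fun res => ?_
  · rcases s with _ | x
    · simp
    · refine cost_bind_le (cost_findFirst_le (c := 0) fun _ => le_rfl) fun j => ?_
      have hblock := cost_solveBlock_le M q u (R i) i x
      rcases j with _ | j
      · simp only [cost_pure]; omega
      · dsimp only
        split_ifs
        · omega
        · simp only [cost_pure]; omega
  · have hloop : n * (1051 * (n + 1) ^ 3 + 1) + 1051 * (n + 1) ^ 3 =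
        1051 * (n + 1) ^ 4 + n := by ring
    rcases res with _ | x <;> simp only [cost_pure] <;> omega

theorem cost_tryIndex_le (M : Fin (n + 1) → Fin (n + 1) → K) (q : Fin (n + 1) → K)
    (u : Fin (n + 1) → WithTop K) (i : Fin (n + 1)) :
    (tryIndex M q u i).cost ≤ 600 * (n + 1) ^ 3 := by
  have hsq : n + 1 ≤ (n + 1) ^ 2 := Nat.le_self_pow two_ne_zero _
  have hcube : (n + 1) ^ 2 ≤ (n + 1) ^ 3 := Nat.pow_le_pow_right (by omega) (by omega)
  have hM' : n * (n * (0 + 1) + 1) ≤ (n + 1) ^ 2 := by nlinarith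
  have hpppa := cost_pppa_le (K := K) (n := n)
  generalize (n + 1) ^ 3 = cube at hcube hpppa ⊢
  generalize (n + 1) ^ 2 = square at hsq hcube hM'
  refine cost_bind_le (cost_tab2_le (c := 0) fun _ _ => le_rfl) fun M' => ?_
  refine cost_bind_add_le (cost_tab_le (c := 0) fun _ => le_rfl) fun u' => ?_
  refine cost_bind_add_le (cost_tab_le (c := 0) fun _ => le_rfl) fun qlb => ?_
  refine cost_bind_add_le (hpppa _ _ _) fun o => ?_
  rcases o with x | _ | _
  · refine cost_bind_add_le (cost_sumOn_le (b := 1) fun _ => le_rfl) fun t => ?_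
    refine cost_bind_add_le (cost_add _ _).le fun g => ?_
    refine cost_bind_add_le (cost_isNeg _).le fun b => ?_
    split_ifs
    · rcases u i with _ | c
      · simp only [cost_pure]; omega
      · refine cost_bind_add_le (cost_tab_le (c := 2) fun _ => by simp) fun qub => ?_
        refine cost_bind_add_le (hpppa _ _ _) fun o => ?_
        rcases o with x | _ | _
        · refine cost_bind_add_le (cost_mul _ _).le fun _ => ?_
          refine cost_bind_add_le (cost_add _ _).le fun _ => ?_
          refine cost_bind_add_le (cost_sumOn_le (b := 1) fun _ => le_rfl) fun t => ?_
          refine cost_bind_add_le (cost_add _ _).le fun g => ?_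
          refine cost_bind_add_le (cost_isPos _).le fun b => ?_
          split_ifs <;> simp only [cost_pure] <;> linarith
        · simp only [cost_pure]; omega
        · simp only [cost_pure]; omega
    · simp only [cost_bind, cost_lit, cost_pure]; omega
  · simp only [cost_pure]; omega
  · simp only [cost_pure]; omega

theorem cost_resolveQP_le (M : Fin (n + 1) → Fin (n + 1) → K) (q : Fin (n + 1) → K)
    (u : Fin (n + 1) → WithTop K) : (resolveQP M q u).cost ≤ 18300 * (n + 1) ^ 4 := by
  refine cost_bind_le (cost_loop_le (c := 600 * (n + 1) ^ 3) fun s i => ?_) fun res => ?_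
  · rcases s with _ | _
    · exact cost_tryIndex_le M q u i
    · simp
  · have hfourth : n + 1 ≤ (n + 1) ^ 4 := Nat.le_self_pow (by omega) _
    have hloop : (n + 1) * (600 * (n + 1) ^ 3 + 1) = 600 * (n + 1) ^ 4 + (n + 1) := by ring
    rcases res with _ | _
    · refine (Nat.add_le_add_right (cost_finalCheck_le M q u) _).trans ?_
      have hcheck : (n + 1 + 1) ^ 4 ≤ 16 * (n + 1) ^ 4 :=
        calc (n + 1 + 1) ^ 4 ≤ (2 * (n + 1)) ^ 4 := Nat.pow_le_pow_left (by omega) _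
          _ = 16 * (n + 1) ^ 4 := by ring
      omega
    · simp only [cost_pure]; omega

end Cost

end BoundedQP

theorem theorem7p2 :
    ∃ C : ℕ, ∀ (n : ℕ) (M : Matrix (Fin (n + 1)) (Fin (n + 1)) ℝ) (q : Fin (n + 1) → ℝ)
      (u : Fin (n + 1) → WithTop ℝ), BoundedQP.WeaklyQuasiDominant 1 M → (∀ i, 0 < u i) →
      ((∃ x, (BoundedQP.resolveQP M q u).eval = .optimal x ∧ BoundedQP.IsOptimal M q u x) ∨
        ((BoundedQP.resolveQP M q u).eval = .noSolution ∧
          ¬ ∃ x, BoundedQP.IsOptimal M q u x)) ∧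
      (BoundedQP.resolveQP M q u).cost ≤ C * (n + 1) ^ 4 := by
  refine ⟨18300, fun n M q u hW hu => ⟨?_, BoundedQP.cost_resolveQP_le M q u⟩⟩
  exact BoundedQP.resolveQP_spec hW.1 hW.posSemidef_comparisonMatrix hu
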